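/- Let $T\ge 1$, $\alpha\in(0,1]$, $\beta,\lambda>0$, $\sigma\in\mathbb R$ be fixed, let $\nu_1,\dots,\nu_T\ge 0$ and assume $\nu=T^{-1}\sum_{t}\nu_t>0$. Let $\hat M\to\infty$, $N=T\hat M$, $M=\alpha N$. For every such $N$ let $\boldsymbol u_1,\dots,\boldsymbol u_T\in\mathbb R^{\hat M}$ be deterministic vectors with $\|\boldsymbol u_t\|^2=\hat M\nu_t$, let $\boldsymbol u\in\mathbb R^N$ be obtained by stacking them, let $\boldsymbol w$ be a standard Gaussian vector in $\mathbb R^M$, and let $\boldsymbol A\in\mathbb R^{M\times N}$ be a random matrix independent of $\boldsymbol w$ which is rotationally invariant: $\boldsymbol A^{\mathsf T}\boldsymbol A$ is distributed as $\boldsymbol O^{\mathsf T}\boldsymbol D\boldsymbol O$ with $\boldsymbol O$ a Haar distributed orthogonal $N\times N$ matrix and $\boldsymbol D$ a random diagonal matrix independent of $\boldsymbol O$. Assume $\alpha\,\mathsf E\boldsymbol A\boldsymbol A^{\mathsf T}=\boldsymbol I_M$. Let $F_N$ be the empirical distribution (function) of the $M$ eigenvalues of $\boldsymbol A\boldsymbol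 A^{\mathsf T}$. Assume that $F_N$ converges to a non-random probability distribution $F=F_{\boldsymbol A\boldsymbol A^{\mathsf T}}$ in the following sense (which includes weakly convergent deterministic spectra): for every continuity point $x$ of $F$, every $\epsilon>0$ and every $C$, $\mathsf P(|F_N(x)-F(x)|\ge\epsilon)\le e^{-CN}$ for all large $N$. If $\alpha=1$, assume in addition that there are no low outliers: if $F$ gives no mass to $(-\infty,a)$ and $b<a$, then for every $C$, $\mathsf P(\lambda_{\min}(\boldsymbol A\boldsymbol A^{\mathsf T})<b)\le e^{-CN}$ for all large $N$. Put $H^{(N)}=\frac1N\ln\mathsf E_{\boldsymbol w,\boldsymbol A}\exp\big(-\frac{\beta}{2\lambda}\|\sigma\boldsymbol w-\boldsymbol A\boldsymbol u\|^2\big)$ and, for a probability distribution $G$ on $[0,\infty)$, $$\phi_G(\Lambda)=\Lambda\beta\nu-(1-\alpha)\ln\Lambda-\alpha\int\ln(\Lambda\beta\sigma^2+\Lambda\lambda+x)\,\mathrm dG(x),$$ $$H_{\beta,\lambda}(\sigma^2,\nu;G)=\frac12\,\mathop{\rm extr}_{\Lambda}\phi_G(\Lambda)-\frac{1+\ln(\beta\nu)-\alpha\ln\lambda}{2}.$$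 Here $\Lambda$ ranges over the set $\mathcal D_G$ of reals for which $\Lambda\beta\sigma^2+\Lambda\lambda+x$ is positive and bounded away from $0$ for $G$-almost every $x$, and $\Lambda>0$ if $\alpha<1$; $\mathrm{extr}$ denotes the value at a stationary point ($\phi_G'(\Lambda)=0$) in $\mathcal D_G$, and the infimum over $\mathcal D_G$ if there is no stationary point. Then $\mathcal D_F$ is non-empty, the logarithm in $\phi_F(\Lambda)$ is $F$-integrable for every $\Lambda\in\mathcal D_F$, $\phi_F$ is bounded below on $\mathcal D_F$ and has at most one stationary point there, and exactly one if $\alpha<1$; and $$\lim_{N\to\infty}H^{(N)}=H_{\beta,\lambda}(\sigma^2,\nu;F),$$ so that the limit depends on $\{\nu_t\}$ only through $\nu$. If $\alpha<1$, then moreover the error, measured relative to the empirical spectrum, is of order $1/N$: $$H^{(N)}=\frac1N\ln\mathsf E_{\boldsymbol A}\exp\big(N\,H_{\beta,\lambda}(\sigma^2,\nu;F_N)\big)+O(1/N);$$ in particular $H^{(N)}=H_{\beta,\lambda}(\sigma^2,\nu;F)+O(1/N)$ when $F_N=F$ for all $N$. -/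

import Mathlib

open MeasureTheory ProbabilityTheory Filter Topology Asymptotics
open scoped Matrix ENNReal

noncomputable section

/-- The product (equivalently Borel) sigma-algebra on real matrices. -/
instance instMeasurableSpaceRealMatrix {m n : Type*} : MeasurableSpace (Matrix m n ℝ) :=
  inferInstanceAs (MeasurableSpace (m → n → ℝ))

/-- The Gram matrix `A Aᵀ` is symmetric. -/
theorem isHermitian_mul_transpose_real {m n : Type*} [Fintype n] (A : Matrix m n ℝ) :
    (A * Aᵀ).IsHermitian := by
  simpa using Matrix.isHermitian_mul_conjTranspose_self A

/-- The eigenvalues of `A Aᵀ`, listed with multiplicity. -/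
def gramEig {M : ℕ} {n : Type*} [Fintype n] (A : Matrix (Fin M) n ℝ) : Fin M → ℝ :=
  (isHermitian_mul_transpose_real A).eigenvalues

/-- The empirical spectral distribution of `A Aᵀ`: mass `1 / M` at each of its `M` eigenvalues. -/
def esd {M : ℕ} {n : Type*} [Fintype n] (A : Matrix (Fin M) n ℝ) : Measure ℝ :=
  (M : ℝ≥0∞)⁻¹ • ∑ i, Measure.dirac (gramEig A i)

/-- `Aᵀ A` is distributed as `Oᵀ D O` with `O` a Haar orthogonal matrix and `D = diag d` a random
diagonal matrix independent of `O`. (The `d i` are then the eigenvalues of `Aᵀ A`.) -/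
def IsRotationallyInvariant {Ω m n : Type*} [MeasurableSpace Ω] [Fintype m] [Fintype n]
    [DecidableEq n] (P : Measure Ω) (A : Ω → Matrix m n ℝ) : Prop :=
  ∃ (η : Measure (Matrix.orthogonalGroup n ℝ)) (ρ : Measure (n → ℝ)),
    η.IsHaarMeasure ∧ IsProbabilityMeasure η ∧ IsProbabilityMeasure ρ ∧
    P.map (fun ω => (A ω)ᵀ * A ω) =
      (η.prod ρ).map (fun q =>
        (q.1 : Matrix n n ℝ)ᵀ * Matrix.diagonal q.2 * (q.1 : Matrix n n ℝ))

/-- The normalization `α E[A Aᵀ] = I`. -/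
def IsNormalized {Ω : Type*} {M : ℕ} {n : Type*} [MeasurableSpace Ω] [Fintype n]
    (α : ℝ) (P : Measure Ω) (A : Ω → Matrix (Fin M) n ℝ) : Prop :=
  ∀ i j, Integrable (fun ω => (A ω * (A ω)ᵀ) i j) P ∧
    α * ∫ ω, (A ω * (A ω)ᵀ) i j ∂P = (1 : Matrix (Fin M) (Fin M) ℝ) i j

/-- The empirical spectral distributions of `A k (A k)ᵀ` converge to the non-random `F`, in the
sense that at every continuity point of `F` the probability of an `ε`-deviation of the distribution
functions is superexponentially small in the dimension `N k`. Deterministic spectra that converge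
weakly qualify. -/
def SpectrumConverges {Ω : ℕ → Type*} [∀ k, MeasurableSpace (Ω k)] (P : ∀ k, Measure (Ω k))
    {M : ℕ → ℕ} {n : ℕ → Type*} [∀ k, Fintype (n k)]
    (A : ∀ k, Ω k → Matrix (Fin (M k)) (n k) ℝ) (N : ℕ → ℝ) (F : Measure ℝ) : Prop :=
  ∀ x : ℝ, F {x} = 0 → ∀ ε > 0, ∀ C : ℝ, ∀ᶠ k in atTop,
    (P k).real {ω | ε ≤ |(esd (A k ω)).real (Set.Iic x) - F.real (Set.Iic x)|} ≤
      Real.exp (-C * N k)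

/-- No eigenvalue of `A k (A k)ᵀ` lies below the support of `F` by a fixed amount, up to
superexponentially small probability. (Vacuous if `0` is in the support of `F`.) -/
def NoLowOutliers {Ω : ℕ → Type*} [∀ k, MeasurableSpace (Ω k)] (P : ∀ k, Measure (Ω k))
    {M : ℕ → ℕ} {n : ℕ → Type*} [∀ k, Fintype (n k)]
    (A : ∀ k, Ω k → Matrix (Fin (M k)) (n k) ℝ) (N : ℕ → ℝ) (F : Measure ℝ) : Prop :=
  ∀ a b : ℝ, b < a → F (Set.Iio a) = 0 → ∀ C : ℝ, ∀ᶠ k in atTop,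
    (P k).real {ω | ∃ i, gramEig (A k ω) i < b} ≤ Real.exp (-C * N k)

/-- `N⁻¹ log E exp (-(β / (2 lam)) ‖σ w - A u‖²)`, with `N` the number of columns. -/
def finiteH {Ω n : Type*} {M : ℕ} [MeasurableSpace Ω] [Fintype n]
    (P : Measure Ω) (w : Ω → Fin M → ℝ) (A : Ω → Matrix (Fin M) n ℝ)
    (β lam σ : ℝ) (u : n → ℝ) : ℝ :=
  (Fintype.card n : ℝ)⁻¹ * Real.log (∫ ω,
    Real.exp (-(β / (2 * lam)) * ‖WithLp.toLp 2 (σ • w ω - (A ω) *ᵥ u)‖ ^ 2) ∂P)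

/-- The function of `Λ` to be extremized. -/
def objective (α β lam σ ν : ℝ) (F : Measure ℝ) (Λ : ℝ) : ℝ :=
  Λ * (β * ν) - (1 - α) * Real.log Λ
    - α * ∫ x, Real.log (Λ * β * σ ^ 2 + Λ * lam + x) ∂F

/-- The `Λ` at which all arguments of logarithms in `objective` are positive, and bounded away from
zero on the support of `F`; for `α = 1` the term `(1 - α) log Λ` is absent. -/
def objectiveDomain (α β lam σ : ℝ) (F : Measure ℝ) : Set ℝ :=
  {Λ | ∃ ε > 0, (α < 1 → ε ≤ Λ) ∧ ∀ᵐ x ∂F, ε ≤ Λ * β * σ ^ 2 + Λ * lam + x}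

/-- The stationary points of `f` in `D`. -/
def stationaryPoints (f : ℝ → ℝ) (D : Set ℝ) : Set ℝ :=
  {z | z ∈ D ∧ HasDerivAt f 0 z}

open Classical in
/-- The extremum of `f` over `D`: its value at a stationary point in `D`; if there is none,
the infimum of `f` over `D`. -/
def extr (f : ℝ → ℝ) (D : Set ℝ) : ℝ :=
  if h : (stationaryPoints f D).Nonempty then f h.some else sInf (f '' D)

/-- The function `H_{β, lam}(σ², ν)` for the spectral distribution `F`. -/
def HFun (α β lam σ ν : ℝ) (F : Measure ℝ) : ℝ :=
  1 / 2 * extr (objective α β lam σ ν F) (objectiveDomain α β lam σ F)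
    - (1 + Real.log (β * ν) - α * Real.log lam) / 2

end

/-! Write c = βσ² + λ, p = βν, θ = p/c. Given the matrix, the Gaussian noise integrates out and
leaves (c/λ)^(-M/2) times the exponential of a multiple of uᵀAᵀAu. Under rotation invariance u may
be replaced by a uniform point on the sphere of radius √(Nν), so what remains is the expectation
over the spectrum of the rank one spherical integral E exp(-(N/2) sᵀBs) with B = θAᵀA. Only ‖u‖²
survives, hence only ν.

For B with eigenvalues a_i the spherical integral is compared with the Gaussian integral E exp(-½
Σ(z + a_i - 1)x_i²) = ∏(z + a_i)^(-1/2). Upper bound (`sphericalIntegral_diagonal_le`): split x into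
direction and independent radius and apply Jensen to the radius; this works for every z with all z +
a_i > 0. Lower bound (`exists_le_sphericalIntegral_diagonal`): if Σ(z + a_i)⁻¹ = N, then under the
Gaussian with variances (z + a_i)⁻¹ both ‖x‖² and Σ a_i x_i² stay within O(√N) of their means with
probability at least 1/2. On that event the two exponents differ by O(1), because their difference
is a product of two deviations divided by ‖x‖².

With z = Λp the exponent becomes N/2 times `potential` minus 1 + ln θ, where the potential is Λp - ∫
ln(Λc + x) dG and G is the law of the spectrum of AᵀA. That spectrum is the spectrum of AAᵀ together
with N - M zeros, so G = (1 - α)δ₀ + αF, and the zeros produce the term (1 - α) ln Λ. The potential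
is convex, so a stationary point is a minimizer and `extr` is always an infimum (`HFun_eq`).

If α < 1, the atom at zero has mass at least 1 - α. This solves the saddle point equation with z in
[1 - α, 1], bounds the variances by (1 - α)⁻¹, and makes both bounds uniform over matrices; this is
the O(1/N) statement (`integral_exp_HFun_bounds`).

For the limit with α ≤ 1 the saddle may be missing. The upper bound
(`eventually_lintegral_sphericalIntegral_le`) tests one admissible Λ at a time; spectra that are not
close to G are harmless because the spherical integral is at most 1 and their probability is
superexponentially small. The lower bound (`eventually_le_lintegral_sphericalIntegral`) flattens the
spectrum slightly above its lower edge. After a shift this creates an atom at zero, the uniform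
saddle point bound applies, and the cost in the exponent is arbitrarily small. -/

/-! ### Gaussian changes of variance and concentration of weighted sums of squares -/

section Gaussian

/-- The standard Gaussian measure on `n → ℝ`. -/
noncomputable abbrev stdGaussianPi (n : Type*) [Fintype n] : Measure (n → ℝ) :=
  Measure.pi fun _ => gaussianReal 0 1

/-- Both sides have explicit densities, which agree pointwise. The mass b^(-1/2) is kept as an
exponential of a logarithm so that products over coordinates become sums. -/
theorem gaussianReal_withDensity_exp {b : ℝ} (hb : 0 < b) :
    (gaussianReal 0 1).withDensity (fun x => ENNReal.ofReal (Real.exp (-(b - 1) / 2 * x ^ 2))) =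
      ENNReal.ofReal (Real.exp (-(1 / 2) * Real.log b)) •
        (gaussianReal 0 1).map (fun x => (√b)⁻¹ * x) := by
  have hsb : √b ≠ 0 := (Real.sqrt_pos.2 hb).ne'
  rw [gaussianReal_map_const_mul, gaussianReal_of_var_ne_zero _ one_ne_zero,
    gaussianReal_of_var_ne_zero _ (by
      intro h
      have := congrArg NNReal.toReal h
      simp [hsb] at this
      ),
    ← withDensity_mul _ (by fun_prop) (by fun_prop), ← withDensity_smul _ (by fun_prop)]
  congr 1
  ext x
  simp only [Pi.mul_apply, Pi.smul_apply, gaussianPDF, gaussianPDFReal, smul_eq_mul]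
  rw [← ENNReal.ofReal_mul (by positivity), ← ENNReal.ofReal_mul (by positivity)]
  congr 1
  have h1 : Real.exp (-(1 / 2) * Real.log b) = (√b)⁻¹ := by
    rw [Real.sqrt_eq_rpow, ← Real.rpow_neg hb.le, Real.rpow_def_of_pos hb]
    congr 1; ring
  rw [h1]
  simp only [NNReal.coe_one, mul_one, NNReal.coe_mk, mul_zero, sub_zero]
  have h2 : √(2 * Real.pi * (√b)⁻¹ ^ 2) = √(2 * Real.pi) * (√b)⁻¹ := by
    rw [Real.sqrt_mul (by positivity), Real.sqrt_sq (by positivity)]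
  rw [h2, mul_inv, inv_inv, mul_assoc, ← Real.exp_add]
  field_simp
  rw [Real.sq_sqrt hb.le]
  ring_nf

variable {n : Type*} [Fintype n]

theorem lintegral_pi_prod (μ : n → Measure ℝ) [∀ i, IsProbabilityMeasure (μ i)]
    (f : n → ℝ → ℝ≥0∞) (hf : ∀ i, Measurable (f i)) :
    ∫⁻ x, ∏ i, f i (x i) ∂Measure.pi μ = ∏ i, ∫⁻ x, f i x ∂μ i := by
  have h := lintegral_prod_eq_prod_lintegral_of_indepFun (μ := Measure.pi μ) Finset.univ
    (fun i x => f i (x i)) (iIndepFun_pi fun i => (hf i).aemeasurable)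
    (fun i => (hf i).comp (measurable_pi_apply i))
  rw [h]
  refine Finset.prod_congr rfl fun i _ => ?_
  rw [← (measurePreserving_eval μ i).lintegral_comp (hf i)]

theorem stdGaussianPi_withDensity_exp (b : n → ℝ) (hb : ∀ i, 0 < b i) :
    (stdGaussianPi n).withDensity
        (fun x => ENNReal.ofReal (Real.exp (-(1 / 2) * ∑ i, (b i - 1) * x i ^ 2))) =
      ENNReal.ofReal (Real.exp (-(1 / 2) * ∑ i, Real.log (b i))) •
        (stdGaussianPi n).map (fun x i => (√(b i))⁻¹ * x i) := by
  classical
  have hC : ENNReal.ofReal (Real.exp (-(1 / 2) * ∑ i, Real.log (b i))) ≠ 0 := by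
    simp [Real.exp_pos]
  have hmap : (stdGaussianPi n).map (fun x i => (√(b i))⁻¹ * x i) =
      Measure.pi (fun i => (gaussianReal 0 1).map (fun x => (√(b i))⁻¹ * x)) := by
    rw [Measure.pi_map_pi (fun i => by fun_prop)]
  -- The constant is moved to the density side, so that the other side is a genuine product measure
  -- and can be identified on boxes.
  have key : Measure.pi (fun i => (gaussianReal 0 1).map (fun x => (√(b i))⁻¹ * x)) =
      (ENNReal.ofReal (Real.exp (-(1 / 2) * ∑ i, Real.log (b i))))⁻¹ •
      (stdGaussianPi n).withDensity
        (fun x => ENNReal.ofReal (Real.exp (-(1 / 2) * ∑ i, (b i - 1) * x i ^ 2))) := by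
    have : ∀ i, IsProbabilityMeasure ((gaussianReal 0 1).map (fun x => (√(b i))⁻¹ * x)) :=
      fun i => Measure.isProbabilityMeasure_map (by fun_prop)
    refine Measure.pi_eq fun s hs => ?_
    rw [Measure.smul_apply, withDensity_apply _ (MeasurableSet.univ_pi hs), smul_eq_mul,
      ← lintegral_indicator (MeasurableSet.univ_pi hs)]
    have h1 : ∀ x : n → ℝ, (Set.univ.pi s).indicator
        (fun x => ENNReal.ofReal (Real.exp (-(1 / 2) * ∑ i, (b i - 1) * x i ^ 2))) x =
        ∏ i, (s i).indicator
          (fun y => ENNReal.ofReal (Real.exp (-(b i - 1) / 2 * y ^ 2))) (x i) := by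
      intro x
      by_cases hx : x ∈ Set.univ.pi s
      · rw [Set.indicator_of_mem hx]
        rw [Finset.prod_congr rfl (fun i _ => Set.indicator_of_mem (hx i trivial) _),
          ← ENNReal.ofReal_prod_of_nonneg (fun i _ => (Real.exp_pos _).le), ← Real.exp_sum,
          Finset.mul_sum]
        congr 3
        ext i; ring
      · rw [Set.indicator_of_notMem hx]
        simp only [Set.mem_univ_pi, not_forall] at hx
        obtain ⟨i, hi⟩ := hx
        exact (Finset.prod_eq_zero (Finset.mem_univ i) (Set.indicator_of_notMem hi _)).symm
    rw [lintegral_congr h1, lintegral_pi_prod _ _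
      (fun i => Measurable.indicator (by fun_prop) (hs i))]
    have h2 : ∀ i, ∫⁻ x, (s i).indicator
          (fun y => ENNReal.ofReal (Real.exp (-(b i - 1) / 2 * y ^ 2))) x ∂gaussianReal 0 1 =
        ENNReal.ofReal (Real.exp (-(1 / 2) * Real.log (b i))) *
          (gaussianReal 0 1).map (fun x => (√(b i))⁻¹ * x) (s i) := by
      intro i
      rw [lintegral_indicator (hs i), ← withDensity_apply _ (hs i),
        gaussianReal_withDensity_exp (hb i), Measure.smul_apply, smul_eq_mul]
    rw [Finset.prod_congr rfl (fun i _ => h2 i), Finset.prod_mul_distrib,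
      ← ENNReal.ofReal_prod_of_nonneg (fun i _ => (Real.exp_pos _).le), ← Real.exp_sum,
      ← Finset.mul_sum, ← mul_assoc, ENNReal.inv_mul_cancel hC ENNReal.ofReal_ne_top, one_mul]
  rw [hmap, key, smul_smul, ENNReal.mul_inv_cancel hC ENNReal.ofReal_ne_top, one_smul]

/-- Gaussian change of variance, evaluated on a measurable set. -/
theorem setLIntegral_exp_stdGaussianPi (b : n → ℝ) (hb : ∀ i, 0 < b i) {s : Set (n → ℝ)}
    (hs : MeasurableSet s) :
    ∫⁻ x in s, ENNReal.ofReal (Real.exp (-(1 / 2) * ∑ i, (b i - 1) * x i ^ 2)) ∂stdGaussianPi n =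
      ENNReal.ofReal (Real.exp (-(1 / 2) * ∑ i, Real.log (b i))) *
        stdGaussianPi n {x | (fun i => (√(b i))⁻¹ * x i) ∈ s} := by
  rw [← withDensity_apply _ hs, stdGaussianPi_withDensity_exp b hb, Measure.smul_apply,
    Measure.map_apply (by fun_prop) hs, smul_eq_mul]
  rfl

theorem lintegral_exp_stdGaussianPi (b : n → ℝ) (hb : ∀ i, 0 < b i) :
    ∫⁻ x, ENNReal.ofReal (Real.exp (-(1 / 2) * ∑ i, (b i - 1) * x i ^ 2)) ∂stdGaussianPi n =
      ENNReal.ofReal (Real.exp (-(1 / 2) * ∑ i, Real.log (b i))) := by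
  rw [← setLIntegral_univ, setLIntegral_exp_stdGaussianPi b hb MeasurableSet.univ]
  simp

theorem memLp_sq_gaussianReal : MemLp (fun x : ℝ => x ^ 2) 2 (gaussianReal 0 1) := by
  have h : MemLp (fun x : ℝ => x) 4 (gaussianReal 0 1) := memLp_id_gaussianReal' 4 (by simp)
  have := h.mul (p := 4) (q := 4) (r := 2) h (hpqr := ⟨by
    have : (4 : ℝ≥0∞) = 2 * 2 := by norm_num
    rw [this, ENNReal.mul_inv (by simp) (by simp), ← two_mul, ← mul_assoc,
      ENNReal.mul_inv_cancel (by simp) (by simp), one_mul]⟩)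
  simpa [pow_two, Pi.mul_def] using this

theorem integral_sq_gaussianReal : ∫ x : ℝ, x ^ 2 ∂gaussianReal 0 1 = 1 := by
  have h := variance_of_integral_eq_zero (X := fun x : ℝ => x) (μ := gaussianReal 0 1)
    (by fun_prop) (by simp)
  have h2 := variance_fun_id_gaussianReal (μ := 0) (v := 1)
  rw [h] at h2
  simpa using h2

/-- Chebyshev's inequality for a weighted sum of squares of independent standard Gaussians. -/
theorem stdGaussianPi_sum_sq_deviation (a : n → ℝ) {r : ℝ} (hr : 0 < r) :
    stdGaussianPi n {x | r ≤ |∑ i, a i * x i ^ 2 - ∑ i, a i|} ≤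
      ENNReal.ofReal (Var[fun x : ℝ => x ^ 2; gaussianReal 0 1] * (∑ i, a i ^ 2) / r ^ 2) := by
  have hmem : ∀ i, MemLp (fun x : ℝ => a i * x ^ 2) 2 (gaussianReal 0 1) :=
    fun i => memLp_sq_gaussianReal.const_mul (a i)
  have hmem' : ∀ i, MemLp (fun x : n → ℝ => a i * x i ^ 2) 2 (stdGaussianPi n) :=
    fun i => (hmem i).comp_measurePreserving (measurePreserving_eval _ i)
  have hvar := variance_sum_pi (μ := fun _ : n => gaussianReal 0 1)
    (X := fun i x => a i * x ^ 2) hmem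
  have hm : MemLp (∑ i, fun x : n → ℝ => a i * x i ^ 2) 2 (stdGaussianPi n) :=
    memLp_finsetSum' _ fun i _ => hmem' i
  have hmean : ∫ x, (∑ i, fun x : n → ℝ => a i * x i ^ 2) x ∂stdGaussianPi n = ∑ i, a i := by
    simp only [Finset.sum_apply]
    rw [integral_finsetSum _ (fun i _ => (hmem' i).integrable (by norm_num))]
    refine Finset.sum_congr rfl fun i _ => ?_
    rw [integral_comp_eval (μ := fun _ : n => gaussianReal 0 1) (i := i)
      (f := fun y : ℝ => a i * y ^ 2) (by fun_prop), integral_const_mul, integral_sq_gaussianReal,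
      mul_one]
  have := meas_ge_le_variance_div_sq hm hr
  rw [hmean, hvar] at this
  simp only [Finset.sum_apply, variance_const_mul] at this
  rw [← Finset.sum_mul, mul_comm (∑ i, a i ^ 2)] at this
  exact this

theorem integral_sum_sq_stdGaussianPi :
    Integrable (fun x : n → ℝ => ∑ i, x i ^ 2) (stdGaussianPi n) ∧
      ∫ x, ∑ i, x i ^ 2 ∂stdGaussianPi n = Fintype.card n := by
  have hi : ∀ i, Integrable (fun x : n → ℝ => x i ^ 2) (stdGaussianPi n) := fun i =>
    (memLp_sq_gaussianReal.comp_measurePreserving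
      (measurePreserving_eval (fun _ : n => gaussianReal 0 1) i)).integrable (by norm_num)
  refine ⟨integrable_finsetSum _ fun i _ => hi i, ?_⟩
  rw [integral_finsetSum _ fun i _ => hi i]
  have : ∀ i, ∫ x : n → ℝ, x i ^ 2 ∂stdGaussianPi n = 1 := by
    intro i
    rw [integral_comp_eval (μ := fun _ : n => gaussianReal 0 1) (i := i)
      (f := fun y : ℝ => y ^ 2) (by fun_prop), integral_sq_gaussianReal]
  simp [this]

end Gaussian

/-! ### Haar rotations of a fixed vector and normalized Gaussian vectors -/

section Sphere

variable {n : Type*} [Fintype n]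

instance instBorelSpaceRealMatrix {m n : Type*} [Countable m] [Countable n] :
    BorelSpace (Matrix m n ℝ) :=
  inferInstanceAs (BorelSpace (m → n → ℝ))

instance instSecondCountableTopologyRealMatrix {m n : Type*} [Countable m] [Countable n] :
    SecondCountableTopology (Matrix m n ℝ) :=
  inferInstanceAs (SecondCountableTopology (m → n → ℝ))

theorem measurable_mulVec_uncurry {m : Type*} [Fintype m] :
    Measurable (fun p : Matrix m n ℝ × (n → ℝ) => p.1 *ᵥ p.2) :=
  (Continuous.matrix_mulVec continuous_fst continuous_snd).measurable

theorem dotProduct_self_nonneg_real (v : n → ℝ) : 0 ≤ v ⬝ᵥ v :=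
  Finset.sum_nonneg fun i _ => mul_self_nonneg (v i)

theorem stdGaussianPi_ae_ne_zero [Nonempty n] :
    ∀ᵐ g ∂stdGaussianPi n, g ⬝ᵥ g ≠ 0 := by
  have : NullSingletonClass (gaussianReal 0 1) := nullSingletonClass_gaussianReal one_ne_zero
  have h0 : stdGaussianPi n {0} = 0 := measure_singleton _
  filter_upwards [compl_mem_ae_iff.2 h0] with g hg
  rwa [Ne, dotProduct_self_eq_zero]

variable [DecidableEq n]

instance instBorelSpaceOrthogonalGroup : BorelSpace (Matrix.orthogonalGroup n ℝ) :=
  Subtype.borelSpace _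

instance instSecondCountableTopologyOrthogonalGroup :
    SecondCountableTopology (Matrix.orthogonalGroup n ℝ) :=
  TopologicalSpace.Subtype.secondCountableTopology _

theorem dotProduct_mulVec_orthogonal {Q : Matrix n n ℝ} (hQ : Q ∈ Matrix.orthogonalGroup n ℝ)
    (x y : n → ℝ) : (Q *ᵥ x) ⬝ᵥ (Q *ᵥ y) = x ⬝ᵥ y := by
  rw [Matrix.dotProduct_mulVec, ← Matrix.mulVec_transpose, Matrix.mulVec_mulVec,
    (Matrix.mem_orthogonalGroup_iff' n ℝ).1 hQ, Matrix.one_mulVec]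

/-- The standard Gaussian measure is invariant under orthogonal transformations. -/
theorem measurePreserving_mulVec_stdGaussianPi {Q : Matrix n n ℝ}
    (hQ : Q ∈ Matrix.orthogonalGroup n ℝ) :
    MeasurePreserving (fun x => Q *ᵥ x) (stdGaussianPi n) (stdGaussianPi n) := by
  let Li : EuclideanSpace ℝ n →ₗᵢ[ℝ] EuclideanSpace ℝ n :=
    { Matrix.toEuclideanLin Q with
      norm_map' := fun x => by
        rw [← sq_eq_sq₀ (norm_nonneg _) (norm_nonneg _), EuclideanSpace.real_norm_sq_eq,
          EuclideanSpace.real_norm_sq_eq]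
        have := dotProduct_mulVec_orthogonal hQ x.ofLp x.ofLp
        simpa [dotProduct, pow_two, Matrix.toEuclideanLin] using this }
  let Le := Li.toLinearIsometryEquiv rfl
  have h1 := stdGaussian_map Le
  rw [← map_pi_eq_stdGaussian] at h1
  refine ⟨by fun_prop, ?_⟩
  have h2 := congrArg (Measure.map WithLp.ofLp) h1
  rw [Measure.map_map (by fun_prop) (by fun_prop), Measure.map_map (by fun_prop) (by fun_prop),
    Measure.map_map (by fun_prop) (by fun_prop)] at h2
  have h3 : (WithLp.ofLp ∘ (WithLp.toLp 2) : (n → ℝ) → (n → ℝ)) = id := rfl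
  rw [h3, Measure.map_id] at h2
  exact h2

/-- The orthogonal group acts transitively on spheres. -/
theorem exists_orthogonal_mulVec_eq {v v' : n → ℝ} (h : v ⬝ᵥ v = v' ⬝ᵥ v') :
    ∃ Q ∈ Matrix.orthogonalGroup n ℝ, Q *ᵥ v = v' := by
  by_cases hv : v = v'
  · exact ⟨1, one_mem _, by simp [hv]⟩
  set d := v - v' with hd
  have hdd : d ⬝ᵥ d ≠ 0 := by
    rw [Ne, dotProduct_self_eq_zero]
    exact sub_ne_zero.2 hv
  have hdv : 2 * (d ⬝ᵥ v) = d ⬝ᵥ d := by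
    simp only [hd, sub_dotProduct, dotProduct_sub]
    rw [dotProduct_comm v' v, h]; ring
  -- The Householder reflection in the hyperplane orthogonal to v - v'.
  refine ⟨1 - (2 / (d ⬝ᵥ d)) • Matrix.vecMulVec d d, ?_, ?_⟩
  · rw [Matrix.mem_orthogonalGroup_iff]
    have ht : (Matrix.vecMulVec d d)ᵀ = Matrix.vecMulVec d d := by
      ext i j; simp [Matrix.vecMulVec_apply, mul_comm]
    have hs : Matrix.vecMulVec d d * Matrix.vecMulVec d d = (d ⬝ᵥ d) • Matrix.vecMulVec d d := by
      rw [Matrix.vecMulVec_mul_vecMulVec]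
      ext i j; simp [Matrix.vecMulVec_apply]; ring
    rw [Matrix.transpose_sub, Matrix.transpose_smul, ht, Matrix.transpose_one, sub_mul, mul_sub,
      mul_sub, smul_mul_smul_comm, hs, smul_smul]
    simp only [mul_one, one_mul]
    rw [show 2 / (d ⬝ᵥ d) * (2 / (d ⬝ᵥ d)) * (d ⬝ᵥ d) = 2 / (d ⬝ᵥ d) + 2 / (d ⬝ᵥ d) by
      field_simp; ring, add_smul]
    abel
  · rw [Matrix.sub_mulVec, Matrix.one_mulVec, Matrix.smul_mulVec, Matrix.vecMulVec_mulVec]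
    ext i
    simp only [Pi.sub_apply, Pi.smul_apply, smul_eq_mul, MulOpposite.smul_eq_mul_unop,
      MulOpposite.unop_op]
    rw [show 2 / (d ⬝ᵥ d) * (d i * (d ⬝ᵥ v)) = d i * (2 * (d ⬝ᵥ v) / (d ⬝ᵥ d)) by ring, hdv,
      div_self hdd, hd]
    simp

/-- The image of a fixed vector under a Haar distributed orthogonal matrix is distributed as a
normalized Gaussian vector. -/
theorem lintegral_orthogonal_mulVec [Nonempty n] (η : Measure (Matrix.orthogonalGroup n ℝ))
    [η.IsMulLeftInvariant] [IsProbabilityMeasure η] {f : (n → ℝ) → ℝ≥0∞} (hf : Measurable f)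
    (u : n → ℝ) :
    ∫⁻ O, f ((O : Matrix n n ℝ) *ᵥ u) ∂η =
      ∫⁻ g, f (√(u ⬝ᵥ u / g ⬝ᵥ g) • g) ∂stdGaussianPi n := by
  -- Inversion turns left invariance into right invariance. Averaging over both η and its inverse
  -- measure makes two-sided invariance of η unnecessary.
  have : IsProbabilityMeasure η.inv := Measure.isProbabilityMeasure_map (by fun_prop)
  have hmul : Measurable (fun p : Matrix.orthogonalGroup n ℝ × (n → ℝ) => (p.1 : Matrix n n ℝ) *ᵥ p.2) :=
    measurable_mulVec_uncurry.comp
      ((measurable_subtype_coe.comp measurable_fst).prodMk measurable_snd)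
  -- averages over a right invariant measure only depend on the norm of the vector
  have hR : ∀ v v' : n → ℝ, v ⬝ᵥ v = v' ⬝ᵥ v' →
      ∫⁻ Q, f ((Q : Matrix n n ℝ) *ᵥ v) ∂η.inv = ∫⁻ Q, f ((Q : Matrix n n ℝ) *ᵥ v') ∂η.inv := by
    intro v v' h
    obtain ⟨R, hR, rfl⟩ := exists_orthogonal_mulVec_eq h
    have := lintegral_mul_right_eq_self (μ := η.inv)
      (fun Q : Matrix.orthogonalGroup n ℝ => f ((Q : Matrix n n ℝ) *ᵥ v)) ⟨R, hR⟩
    rw [← this]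
    simp [Matrix.mulVec_mulVec]
  have hL : ∀ Q : Matrix.orthogonalGroup n ℝ, ∫⁻ O, f ((O : Matrix n n ℝ) *ᵥ u) ∂η =
      ∫⁻ O, f ((Q : Matrix n n ℝ) *ᵥ ((O : Matrix n n ℝ) *ᵥ u)) ∂η := by
    intro Q
    have := lintegral_mul_left_eq_self (μ := η)
      (fun O : Matrix.orthogonalGroup n ℝ => f ((O : Matrix n n ℝ) *ᵥ u)) Q
    rw [← this]
    simp [Matrix.mulVec_mulVec]
  have h1 : ∫⁻ O, f ((O : Matrix n n ℝ) *ᵥ u) ∂η = ∫⁻ Q, f ((Q : Matrix n n ℝ) *ᵥ u) ∂η.inv := by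
    calc ∫⁻ O, f ((O : Matrix n n ℝ) *ᵥ u) ∂η
        = ∫⁻ Q, ∫⁻ O, f ((O : Matrix n n ℝ) *ᵥ u) ∂η ∂η.inv := by simp
      _ = ∫⁻ Q, ∫⁻ O, f ((Q : Matrix n n ℝ) *ᵥ ((O : Matrix n n ℝ) *ᵥ u)) ∂η ∂η.inv :=
          lintegral_congr fun Q => hL Q
      _ = ∫⁻ O, ∫⁻ Q, f ((Q : Matrix n n ℝ) *ᵥ ((O : Matrix n n ℝ) *ᵥ u)) ∂η.inv ∂η :=
          lintegral_lintegral_swap (by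
            refine (hf.comp (hmul.comp (measurable_fst.prodMk ?_))).aemeasurable
            exact hmul.comp (measurable_snd.prodMk measurable_const))
      _ = ∫⁻ O, ∫⁻ Q, f ((Q : Matrix n n ℝ) *ᵥ u) ∂η.inv ∂η :=
          lintegral_congr fun O => hR _ _ (dotProduct_mulVec_orthogonal O.2 u u)
      _ = _ := by simp
  have hscale : Measurable (fun g : n → ℝ => √(u ⬝ᵥ u / g ⬝ᵥ g) • g) := by
    unfold dotProduct; fun_prop
  calc ∫⁻ O, f ((O : Matrix n n ℝ) *ᵥ u) ∂η
      = ∫⁻ g, ∫⁻ Q, f ((Q : Matrix n n ℝ) *ᵥ u) ∂η.inv ∂stdGaussianPi n := by simp [h1]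
    _ = ∫⁻ g, ∫⁻ Q, f ((Q : Matrix n n ℝ) *ᵥ (√(u ⬝ᵥ u / g ⬝ᵥ g) • g)) ∂η.inv
          ∂stdGaussianPi n := by
        refine lintegral_congr_ae ?_
        filter_upwards [stdGaussianPi_ae_ne_zero] with g hg
        refine hR _ _ ?_
        rw [smul_dotProduct, dotProduct_smul, smul_smul, Real.mul_self_sqrt, smul_eq_mul,
          div_mul_cancel₀ _ hg]
        exact div_nonneg (dotProduct_self_nonneg_real u) (dotProduct_self_nonneg_real g)
    _ = ∫⁻ Q, ∫⁻ g, f ((Q : Matrix n n ℝ) *ᵥ (√(u ⬝ᵥ u / g ⬝ᵥ g) • g)) ∂stdGaussianPi n ∂η.inv :=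
        lintegral_lintegral_swap (by
          refine (hf.comp (hmul.comp (measurable_snd.prodMk ?_))).aemeasurable
          exact hscale.comp measurable_fst)
    _ = ∫⁻ Q, ∫⁻ g, f (√(u ⬝ᵥ u / g ⬝ᵥ g) • g) ∂stdGaussianPi n ∂η.inv := by
        refine lintegral_congr fun Q => ?_
        refine Eq.trans ?_
          ((measurePreserving_mulVec_stdGaussianPi Q.2).lintegral_comp (hf.comp hscale))
        refine lintegral_congr fun g => ?_
        rw [dotProduct_mulVec_orthogonal Q.2, Matrix.mulVec_smul]
    _ = _ := by simp

end Sphere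

/-! ### The spherical integral and its Jensen upper bound -/

section SphericalIntegral

variable {n : Type*} [Fintype n]

/-- The rank one spherical integral `E exp (-(N / 2) sᵀ B s)`, where `N` is the dimension and `s` is
uniformly distributed on the unit sphere. -/
noncomputable def sphericalIntegral (B : Matrix n n ℝ) : ℝ≥0∞ :=
  ∫⁻ g, ENNReal.ofReal (Real.exp (-(1 / 2) * (Fintype.card n * (g ⬝ᵥ B *ᵥ g / g ⬝ᵥ g))))
    ∂stdGaussianPi n

theorem measurable_dotProduct_mulVec :
    Measurable (fun p : Matrix n n ℝ × (n → ℝ) => p.2 ⬝ᵥ p.1 *ᵥ p.2) :=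
  (continuous_snd.dotProduct (Continuous.matrix_mulVec continuous_fst continuous_snd)).measurable

theorem measurable_dotProduct_self : Measurable (fun g : n → ℝ => g ⬝ᵥ g) := by
  unfold dotProduct; fun_prop

theorem measurable_sphericalIntegrand :
    Measurable (fun p : Matrix n n ℝ × (n → ℝ) => ENNReal.ofReal
      (Real.exp (-(1 / 2) * (Fintype.card n * (p.2 ⬝ᵥ p.1 *ᵥ p.2 / p.2 ⬝ᵥ p.2))))) := by
  have h1 := measurable_dotProduct_mulVec (n := n)
  have h2 : Measurable (fun p : Matrix n n ℝ × (n → ℝ) => p.2 ⬝ᵥ p.2) :=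
    measurable_dotProduct_self.comp measurable_snd
  fun_prop

theorem measurable_sphericalIntegral : Measurable (sphericalIntegral (n := n)) :=
  Measurable.lintegral_prod_right' measurable_sphericalIntegrand

theorem dotProduct_self_eq_sum_sq (g : n → ℝ) : g ⬝ᵥ g = ∑ i, g i ^ 2 := by
  simp [dotProduct, pow_two]

theorem dotProduct_conj_mulVec (Q B : Matrix n n ℝ) (g : n → ℝ) :
    g ⬝ᵥ (Qᵀ * B * Q) *ᵥ g = (Q *ᵥ g) ⬝ᵥ B *ᵥ (Q *ᵥ g) := by
  rw [← Matrix.mulVec_mulVec, ← Matrix.mulVec_mulVec, Matrix.dotProduct_mulVec,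
    Matrix.vecMul_transpose]

theorem sphericalIntegral_le_one {B : Matrix n n ℝ} (hB : ∀ g, 0 ≤ g ⬝ᵥ B *ᵥ g) :
    sphericalIntegral B ≤ 1 := by
  refine (lintegral_mono (g := fun _ => 1) fun g => ?_).trans (by simp)
  rw [ENNReal.ofReal_le_one, Real.exp_le_one_iff]
  have : 0 ≤ (Fintype.card n : ℝ) * (g ⬝ᵥ B *ᵥ g / g ⬝ᵥ g) :=
    mul_nonneg (by positivity) (div_nonneg (hB g) (dotProduct_self_nonneg_real g))
  linarith

/-- Jensen's inequality for the squared norm of a standard Gaussian vector. -/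
theorem le_lintegral_exp_norm_sq_stdGaussianPi (q : ℝ) :
    ENNReal.ofReal (Real.exp (-(1 / 2) * (Fintype.card n * q))) ≤
      ∫⁻ g, ENNReal.ofReal (Real.exp (-(1 / 2) * (∑ i, g i ^ 2) * q)) ∂stdGaussianPi n := by
  by_cases htop : ∫⁻ g, ENNReal.ofReal (Real.exp (-(1 / 2) * (∑ i, g i ^ 2) * q))
      ∂stdGaussianPi n = ∞
  · rw [htop]; exact le_top
  have hint : Integrable (fun g : n → ℝ => Real.exp (-(1 / 2) * (∑ i, g i ^ 2) * q))
      (stdGaussianPi n) := by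
    refine ⟨Measurable.aestronglyMeasurable (by fun_prop), ?_⟩
    rw [hasFiniteIntegral_iff_ofReal (ae_of_all _ fun g => (Real.exp_pos _).le)]
    exact lt_top_iff_ne_top.2 htop
  rw [← ofReal_integral_eq_lintegral_ofReal hint (ae_of_all _ fun g => (Real.exp_pos _).le)]
  refine ENNReal.ofReal_le_ofReal ?_
  obtain ⟨hi, hv⟩ := integral_sum_sq_stdGaussianPi (n := n)
  set N : ℝ := (Fintype.card n : ℝ) with hN
  have hd : Integrable (fun g : n → ℝ => -(1 / 2) * q * (∑ i, g i ^ 2 - N)) (stdGaussianPi n) :=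
    (hi.sub (integrable_const N)).const_mul _
  have hlin : Integrable (fun g : n → ℝ =>
      Real.exp (-(1 / 2) * (N * q)) * (1 + -(1 / 2) * q * (∑ i, g i ^ 2 - N)))
      (stdGaussianPi n) :=
    ((integrable_const 1).add hd).const_mul _
  -- The exponential is bounded below by its tangent at the mean N of ‖g‖²; the linear term
  -- integrates to zero.
  calc Real.exp (-(1 / 2) * (N * q))
      = ∫ g, Real.exp (-(1 / 2) * (N * q)) * (1 + -(1 / 2) * q * (∑ i, g i ^ 2 - N))
          ∂stdGaussianPi n := by
        rw [integral_const_mul, integral_add (integrable_const _) hd, integral_const_mul,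
          integral_sub hi (integrable_const N), hv]
        simp
    _ ≤ _ := by
        refine integral_mono hlin hint fun g => ?_
        have := Real.add_one_le_exp (-(1 / 2) * q * (∑ i, g i ^ 2 - N))
        calc Real.exp (-(1 / 2) * (N * q)) * (1 + -(1 / 2) * q * (∑ i, g i ^ 2 - N))
            ≤ Real.exp (-(1 / 2) * (N * q)) * Real.exp (-(1 / 2) * q * (∑ i, g i ^ 2 - N)) := by
              gcongr; linarith
          _ = _ := by rw [← Real.exp_add]; congr 1; ring

variable [DecidableEq n]

theorem dotProduct_diagonal_mulVec (a g : n → ℝ) :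
    g ⬝ᵥ Matrix.diagonal a *ᵥ g = ∑ i, a i * g i ^ 2 := by
  simp only [dotProduct, Matrix.mulVec_diagonal]
  exact Finset.sum_congr rfl fun i _ => by ring

theorem sphericalIntegral_conj {Q : Matrix n n ℝ} (hQ : Q ∈ Matrix.orthogonalGroup n ℝ)
    (B : Matrix n n ℝ) : sphericalIntegral (Qᵀ * B * Q) = sphericalIntegral B := by
  unfold sphericalIntegral
  have hm : Measurable (fun g : n → ℝ => ENNReal.ofReal
      (Real.exp (-(1 / 2) * (Fintype.card n * (g ⬝ᵥ B *ᵥ g / g ⬝ᵥ g))))) := by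
    have h1 : Measurable (fun g : n → ℝ => g ⬝ᵥ B *ᵥ g) :=
      (continuous_id.dotProduct (Continuous.matrix_mulVec continuous_const continuous_id)).measurable
    have h2 := measurable_dotProduct_self (n := n)
    fun_prop
  rw [← (measurePreserving_mulVec_stdGaussianPi hQ).lintegral_comp hm]
  refine lintegral_congr fun g => ?_
  rw [dotProduct_conj_mulVec, dotProduct_mulVec_orthogonal hQ]

/-- The Gaussian integral with the tilt z + a is evaluated exactly. For a fixed direction its
exponent is linear in the squared radius, so averaging over the radius only increases it beyond the
spherical integrand, by Jensen. The measure η is only a tool for separating radius from direction.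
-/
theorem sphericalIntegral_diagonal_le [Nonempty n] (η : Measure (Matrix.orthogonalGroup n ℝ))
    [η.IsMulLeftInvariant] [IsProbabilityMeasure η] (a : n → ℝ) {z : ℝ}
    (hz : ∀ i, 0 < z + a i) :
    sphericalIntegral (Matrix.diagonal a) ≤ ENNReal.ofReal
      (Real.exp (1 / 2 * (Fintype.card n * (z - 1) - ∑ i, Real.log (z + a i)))) := by
  set N : ℝ := (Fintype.card n : ℝ) with hN
  let f : (n → ℝ) → ℝ≥0∞ := fun x =>
    ENNReal.ofReal (Real.exp (-(1 / 2) * ∑ i, (z + a i - 1) * x i ^ 2))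
  have hf : Measurable f := by fun_prop
  have hscale : Measurable (fun p : (n → ℝ) × (n → ℝ) => √(p.1 ⬝ᵥ p.1 / p.2 ⬝ᵥ p.2) • p.2) := by
    unfold dotProduct; fun_prop
  -- Resampling: a random rotation replaces x by a vector whose length comes from g and whose
  -- direction comes from an independent copy g'.
  have h1 : ∫⁻ x, f x ∂stdGaussianPi n =
      ∫⁻ g', ∫⁻ g, f (√(g ⬝ᵥ g / g' ⬝ᵥ g') • g') ∂stdGaussianPi n ∂stdGaussianPi n := by
    calc ∫⁻ x, f x ∂stdGaussianPi n = ∫⁻ O, ∫⁻ x, f x ∂stdGaussianPi n ∂η := by simp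
      _ = ∫⁻ O, ∫⁻ x, f ((O : Matrix n n ℝ) *ᵥ x) ∂stdGaussianPi n ∂η :=
          lintegral_congr fun O =>
            ((measurePreserving_mulVec_stdGaussianPi O.2).lintegral_comp hf).symm
      _ = ∫⁻ x, ∫⁻ O, f ((O : Matrix n n ℝ) *ᵥ x) ∂η ∂stdGaussianPi n :=
          lintegral_lintegral_swap ((hf.comp (measurable_mulVec_uncurry.comp
            ((measurable_subtype_coe.comp measurable_fst).prodMk measurable_snd))).aemeasurable)
      _ = ∫⁻ g, ∫⁻ g', f (√(g ⬝ᵥ g / g' ⬝ᵥ g') • g') ∂stdGaussianPi n ∂stdGaussianPi n :=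
          lintegral_congr fun g => lintegral_orthogonal_mulVec η hf g
      _ = _ := lintegral_lintegral_swap (hf.comp hscale).aemeasurable
  have h2 : ENNReal.ofReal (Real.exp (-(1 / 2) * (N * (z - 1)))) *
      sphericalIntegral (Matrix.diagonal a) ≤ ∫⁻ x, f x ∂stdGaussianPi n := by
    rw [h1, sphericalIntegral, ← lintegral_const_mul' _ _ ENNReal.ofReal_ne_top]
    refine lintegral_mono_ae ?_
    filter_upwards [stdGaussianPi_ae_ne_zero] with g' hg'
    set q : ℝ := (z - 1) + g' ⬝ᵥ Matrix.diagonal a *ᵥ g' / g' ⬝ᵥ g' with hq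
    rw [← ENNReal.ofReal_mul (Real.exp_pos _).le, ← Real.exp_add]
    refine le_of_eq_of_le ?_ ((le_lintegral_exp_norm_sq_stdGaussianPi (n := n) q).trans_eq ?_)
    · congr 2; rw [hq]; ring
    · refine lintegral_congr fun g => ?_
      simp only [f]
      congr 2
      have hnn : 0 ≤ g ⬝ᵥ g / g' ⬝ᵥ g' :=
        div_nonneg (dotProduct_self_nonneg_real g) (dotProduct_self_nonneg_real g')
      simp only [Pi.smul_apply, smul_eq_mul, mul_pow, Real.sq_sqrt hnn]
      have : ∑ i, (z + a i - 1) * (g ⬝ᵥ g / g' ⬝ᵥ g' * g' i ^ 2) =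
          g ⬝ᵥ g / g' ⬝ᵥ g' * ((z - 1) * (g' ⬝ᵥ g') + g' ⬝ᵥ Matrix.diagonal a *ᵥ g') := by
        rw [dotProduct_diagonal_mulVec, dotProduct_self_eq_sum_sq g', Finset.mul_sum,
          ← Finset.sum_add_distrib, Finset.mul_sum]
        exact Finset.sum_congr rfl fun i _ => by ring
      rw [this, hq, ← dotProduct_self_eq_sum_sq g]
      field_simp
  have h3 : ∫⁻ x, f x ∂stdGaussianPi n =
      ENNReal.ofReal (Real.exp (-(1 / 2) * ∑ i, Real.log (z + a i))) :=
    lintegral_exp_stdGaussianPi (fun i => z + a i) hz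
  rw [h3] at h2
  calc sphericalIntegral (Matrix.diagonal a)
      = ENNReal.ofReal (Real.exp (1 / 2 * (N * (z - 1)))) *
        (ENNReal.ofReal (Real.exp (-(1 / 2) * (N * (z - 1)))) *
          sphericalIntegral (Matrix.diagonal a)) := by
        rw [← mul_assoc, ← ENNReal.ofReal_mul (Real.exp_pos _).le, ← Real.exp_add]
        simp
    _ ≤ _ := by
        refine (mul_le_mul_right h2 _).trans_eq ?_
        rw [← ENNReal.ofReal_mul (Real.exp_pos _).le, ← Real.exp_add]
        congr 2; ring

end SphericalIntegral

/-! ### The saddle point lower bound for the spherical integral -/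

section SphericalIntegralLower

/-- Here S stands for ‖x‖² and Q for Σ a_i x_i². The two exponents differ by (S - N)((z - 1)S +
Q)/(2S), and (z - 1)S + Q vanishes at the means S = N, Q = N(1 - z). Both factors are O(R), so the
quotient is O(R²/N) = O(r²). -/
theorem saddle_exponent_bound {S Q N z R r : ℝ} (hR : R ^ 2 = r ^ 2 * N)
    (hRN : R ≤ N / 2) (hz : 0 < z) (hz1 : z ≤ 1) (hS : |S - N| < R) (hQ : |Q - N * (1 - z)| < R) :
    1 / 2 * (N * (z - 1)) - 2 * r ^ 2 + -(1 / 2) * ((z - 1) * S + Q) ≤ -(1 / 2) * (N * (Q / S)) := by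
  have hR0 : 0 < R := (abs_nonneg _).trans_lt hS
  have hS0 : N / 2 < S := by have := (abs_lt.1 hS).1; linarith
  have hSpos : 0 < S := by linarith
  have h1 : |(S - N) * ((z - 1) * (S - N) + (Q - N * (1 - z)))| ≤ R * (2 * R) := by
    rw [abs_mul]
    refine mul_le_mul hS.le ?_ (abs_nonneg _) hR0.le
    refine (abs_add_le _ _).trans ?_
    have : |(z - 1) * (S - N)| ≤ 1 * R := by
      rw [abs_mul]
      refine mul_le_mul ?_ hS.le (abs_nonneg _) zero_le_one
      rw [abs_le]; constructor <;> linarith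
    linarith
  have h2 := (abs_le.1 h1).1
  have h3 : -(1 / 2) * (N * (Q / S)) -
      (1 / 2 * (N * (z - 1)) - 2 * r ^ 2 + -(1 / 2) * ((z - 1) * S + Q)) =
      (1 / 2 * ((S - N) * ((z - 1) * (S - N) + (Q - N * (1 - z)))) + 2 * r ^ 2 * S) / S := by
    field_simp; ring
  have h4 : 0 ≤ (1 / 2 * ((S - N) * ((z - 1) * (S - N) + (Q - N * (1 - z)))) + 2 * r ^ 2 * S) / S := by
    refine div_nonneg ?_ hSpos.le
    have : r ^ 2 * N ≤ r ^ 2 * (2 * S) := mul_le_mul_of_nonneg_left (by linarith) (sq_nonneg r)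
    nlinarith
  linarith

/-- At a saddle point at which the tilted variances are at most `L`, the saddle point value of
the spherical integral is sharp up to a constant depending on `L` only. -/
theorem exists_le_sphericalIntegral_diagonal (L : ℝ) :
    ∃ c > 0, ∃ N₀ : ℕ, ∀ {n : Type*} [Fintype n] [DecidableEq n], N₀ ≤ Fintype.card n →
      ∀ (a : n → ℝ) (z : ℝ), 0 < z → z ≤ 1 → (∀ i, 0 ≤ a i) → (∀ i, (z + a i)⁻¹ ≤ L) →
      ∑ i, (z + a i)⁻¹ = Fintype.card n →
      ENNReal.ofReal (c * Real.exp
        (1 / 2 * (Fintype.card n * (z - 1) - ∑ i, Real.log (z + a i)))) ≤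
        sphericalIntegral (Matrix.diagonal a) := by
  set V := Var[fun x : ℝ => x ^ 2; gaussianReal 0 1] with hV
  have hV0 : 0 ≤ V := variance_nonneg _ _
  -- Chosen so that the two Chebyshev bounds, with variances at most V·L²·N and V·N, together stay
  -- below 1/2 at deviation r√N; the summand 1 keeps r positive.
  set r := √(4 * V * (L ^ 2 + 1) + 1) with hr
  have hr2 : r ^ 2 = 4 * V * (L ^ 2 + 1) + 1 := Real.sq_sqrt (by positivity)
  have hr0 : 0 < r := Real.sqrt_pos.2 (by positivity)
  refine ⟨Real.exp (-2 * r ^ 2) / 2, by positivity, ⌈4 * r ^ 2⌉₊, ?_⟩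
  intro n _ _ hcard a z hz hz1 ha hL hsum
  set N : ℝ := (Fintype.card n : ℝ) with hNdef
  have hN4 : 4 * r ^ 2 ≤ N := (Nat.le_ceil _).trans (Nat.cast_le.2 hcard)
  have hN : 0 < N := lt_of_lt_of_le (by positivity) hN4
  set R := r * √N with hRdef
  have hR2 : R ^ 2 = r ^ 2 * N := by rw [hRdef, mul_pow, Real.sq_sqrt hN.le]
  have hR0 : 0 < R := mul_pos hr0 (Real.sqrt_pos.2 hN)
  have hRN : R ≤ N / 2 := by
    refine (sq_le_sq₀ hR0.le (by positivity)).1 ?_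
    rw [hR2]; nlinarith
  have hb : ∀ i, 0 < z + a i := fun i => by linarith [ha i]
  let s : Set (n → ℝ) :=
    {x | |∑ i, x i ^ 2 - N| < R ∧ |∑ i, a i * x i ^ 2 - N * (1 - z)| < R}
  have hs : MeasurableSet s :=
    (measurableSet_lt (f := fun x : n → ℝ => |∑ i, x i ^ 2 - N|) (by fun_prop)
      measurable_const).inter (measurableSet_lt
        (f := fun x : n → ℝ => |∑ i, a i * x i ^ 2 - N * (1 - z)|) (by fun_prop) measurable_const)
  have hsq : ∀ i, (√(z + a i))⁻¹ ^ 2 = (z + a i)⁻¹ := fun i => by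
    rw [inv_pow, Real.sq_sqrt (hb i).le]
  -- The saddle point equation also fixes the tilted mean of Σ a_i x_i².
  have hsum2 : ∑ i, a i * (z + a i)⁻¹ = N * (1 - z) := by
    have : ∀ i, a i * (z + a i)⁻¹ = 1 - z * (z + a i)⁻¹ := fun i => by
      have := (hb i).ne'; field_simp; ring
    simp only [this, Finset.sum_sub_distrib, ← Finset.mul_sum, hsum]
    simp [hNdef]; ring
  have hprob : ENNReal.ofReal (1 / 2) ≤
      stdGaussianPi n {x | (fun i => (√(z + a i))⁻¹ * x i) ∈ s} := by
    set t : Set (n → ℝ) := {x | (fun i => (√(z + a i))⁻¹ * x i) ∈ s} with ht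
    have htm : MeasurableSet t := by
      have : Measurable (fun (x : n → ℝ) i => (√(z + a i))⁻¹ * x i) := by fun_prop
      exact this hs
    have h1 := stdGaussianPi_sum_sq_deviation (fun i => (z + a i)⁻¹) hR0
    have h2 := stdGaussianPi_sum_sq_deviation (fun i => a i * (z + a i)⁻¹) hR0
    rw [hsum] at h1
    rw [hsum2] at h2
    have hL1 : ∑ i, (z + a i)⁻¹ ^ 2 ≤ N * L ^ 2 := by
      calc ∑ i, (z + a i)⁻¹ ^ 2 ≤ ∑ _i : n, L ^ 2 :=
            Finset.sum_le_sum fun i _ => pow_le_pow_left₀ (inv_nonneg.2 (hb i).le) (hL i) 2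
        _ = _ := by simp [hNdef]
    have hL2 : ∑ i, (a i * (z + a i)⁻¹) ^ 2 ≤ N * 1 := by
      calc ∑ i, (a i * (z + a i)⁻¹) ^ 2 ≤ ∑ _i : n, (1 : ℝ) := by
            refine Finset.sum_le_sum fun i _ => ?_
            refine pow_le_one₀ (mul_nonneg (ha i) (inv_nonneg.2 (hb i).le)) ?_
            rw [← div_eq_mul_inv, div_le_one (hb i)]; linarith
        _ = _ := by simp [hNdef]
    have hcompl : stdGaussianPi n tᶜ ≤ ENNReal.ofReal (1 / 2) := by
      calc stdGaussianPi n tᶜ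
          ≤ stdGaussianPi n ({x | R ≤ |∑ i, (z + a i)⁻¹ * x i ^ 2 - N|} ∪
              {x | R ≤ |∑ i, a i * (z + a i)⁻¹ * x i ^ 2 - N * (1 - z)|}) := by
            refine measure_mono fun x hx => ?_
            simp only [t, s, Set.mem_compl_iff, Set.mem_ofPred_eq, mul_pow, hsq, not_and_or,
              not_lt] at hx
            simp only [Set.mem_union, Set.mem_ofPred_eq, mul_assoc]
            exact hx
        _ ≤ _ := measure_union_le _ _
        _ ≤ _ := add_le_add h1 h2
        _ = ENNReal.ofReal ((V * ∑ i, (z + a i)⁻¹ ^ 2) / R ^ 2 +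
              (V * ∑ i, (a i * (z + a i)⁻¹) ^ 2) / R ^ 2) := by
            rw [← ENNReal.ofReal_add (by positivity) (by positivity)]
        _ ≤ _ := by
            refine ENNReal.ofReal_le_ofReal ?_
            rw [← add_div, hR2, div_le_iff₀ (by positivity), hr2]
            have e1 := mul_le_mul_of_nonneg_left hL1 hV0
            have e2 := mul_le_mul_of_nonneg_left hL2 hV0
            have e3 : 0 ≤ V * (L ^ 2 + 1) * N := by positivity
            nlinarith
    have hadd := prob_add_prob_compl (μ := stdGaussianPi n) htm
    by_contra hlt
    rw [not_le] at hlt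
    have : stdGaussianPi n t + stdGaussianPi n tᶜ < 1 := by
      calc _ < ENNReal.ofReal (1 / 2) + ENNReal.ofReal (1 / 2) :=
            ENNReal.add_lt_add_of_lt_of_le (measure_ne_top _ _) hlt hcompl
        _ = 1 := by rw [← ENNReal.ofReal_add (by norm_num) (by norm_num)]; norm_num
    exact this.ne hadd
  have hset := setLIntegral_exp_stdGaussianPi (fun i => z + a i) hb hs
  calc ENNReal.ofReal (Real.exp (-2 * r ^ 2) / 2 * Real.exp
        (1 / 2 * (N * (z - 1) - ∑ i, Real.log (z + a i))))
      = ENNReal.ofReal (Real.exp (1 / 2 * (N * (z - 1)) - 2 * r ^ 2)) *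
        (ENNReal.ofReal (Real.exp (-(1 / 2) * ∑ i, Real.log (z + a i))) *
          ENNReal.ofReal (1 / 2)) := by
        rw [← ENNReal.ofReal_mul (Real.exp_pos _).le, ← ENNReal.ofReal_mul (Real.exp_pos _).le,
          ← mul_assoc, ← Real.exp_add, div_mul_eq_mul_div, ← Real.exp_add, div_eq_mul_one_div]
        congr 3; ring
    _ ≤ ENNReal.ofReal (Real.exp (1 / 2 * (N * (z - 1)) - 2 * r ^ 2)) *
        ∫⁻ x in s, ENNReal.ofReal (Real.exp (-(1 / 2) * ∑ i, (z + a i - 1) * x i ^ 2))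
          ∂stdGaussianPi n := by
        rw [hset]; gcongr
    _ = ∫⁻ x in s, ENNReal.ofReal (Real.exp (1 / 2 * (N * (z - 1)) - 2 * r ^ 2 +
          -(1 / 2) * ∑ i, (z + a i - 1) * x i ^ 2)) ∂stdGaussianPi n := by
        rw [← lintegral_const_mul' _ _ ENNReal.ofReal_ne_top]
        refine lintegral_congr fun x => ?_
        rw [← ENNReal.ofReal_mul (Real.exp_pos _).le, ← Real.exp_add]
    _ ≤ ∫⁻ g in s, ENNReal.ofReal (Real.exp (-(1 / 2) *
          (N * (g ⬝ᵥ Matrix.diagonal a *ᵥ g / g ⬝ᵥ g)))) ∂stdGaussianPi n := by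
        refine setLIntegral_mono' hs fun x hx => ?_
        refine ENNReal.ofReal_le_ofReal (Real.exp_le_exp.2 ?_)
        rw [dotProduct_diagonal_mulVec, dotProduct_self_eq_sum_sq]
        have e : ∑ i, (z + a i - 1) * x i ^ 2 =
            (z - 1) * ∑ i, x i ^ 2 + ∑ i, a i * x i ^ 2 := by
          rw [Finset.mul_sum, ← Finset.sum_add_distrib]
          exact Finset.sum_congr rfl fun i _ => by ring
        rw [e]
        exact saddle_exponent_bound hR2 hRN hz hz1 hx.1 hx.2
    _ ≤ _ := setLIntegral_le_lintegral _ _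

end SphericalIntegralLower

/-! ### Reduction of the expectation to spherical integrals -/

section RandomMatrix

theorem measurable_dotProduct_mulVec_const {n : Type*} [Fintype n] (u : n → ℝ) :
    Measurable (fun G : Matrix n n ℝ => u ⬝ᵥ G *ᵥ u) :=
  (continuous_const.dotProduct (Continuous.matrix_mulVec continuous_id continuous_const)).measurable

theorem measurable_transpose_mul_self {m n : Type*} [Fintype m] [Countable n] :
    Measurable (fun A : Matrix m n ℝ => Aᵀ * A) :=
  (Continuous.matrix_mul (Continuous.matrix_transpose continuous_id) continuous_id).measurable

theorem measurable_conj_diagonal {n : Type*} [Fintype n] [DecidableEq n] :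
    Measurable (fun q : Matrix n n ℝ × (n → ℝ) => q.1ᵀ * Matrix.diagonal q.2 * q.1) := by
  have hc : Continuous (fun q : Matrix n n ℝ × (n → ℝ) => q.1ᵀ * Matrix.diagonal q.2 * q.1) := by
    fun_prop
  exact hc.measurable

variable {Ω m n : Type*} [MeasurableSpace Ω] [Fintype m] [Fintype n] [DecidableEq n]

theorem IsRotationallyInvariant.exists_haar {P : Measure Ω} {A : Ω → Matrix m n ℝ}
    (h : IsRotationallyInvariant P A) :
    ∃ η : Measure (Matrix.orthogonalGroup n ℝ), η.IsMulLeftInvariant ∧ IsProbabilityMeasure η := by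
  obtain ⟨η, _, hη, hη1, _⟩ := h
  exact ⟨η, inferInstance, hη1⟩

/-- For a rotationally invariant matrix, the exponential moment of the quadratic form at a fixed
vector is an expected spherical integral. -/
theorem IsRotationallyInvariant.lintegral_exp [Nonempty n] {P : Measure Ω} {A : Ω → Matrix m n ℝ}
    (hA : Measurable A) (h : IsRotationallyInvariant P A) (t : ℝ) (u : n → ℝ) :
    ∫⁻ ω, ENNReal.ofReal (Real.exp (-(1 / 2) * (t * (u ⬝ᵥ ((A ω)ᵀ * A ω) *ᵥ u)))) ∂P =
      ∫⁻ ω, sphericalIntegral ((t * (u ⬝ᵥ u) / Fintype.card n) • ((A ω)ᵀ * A ω)) ∂P := by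
  obtain ⟨η, ρ, hη, hη1, hρ, hmap⟩ := h
  have hN : (Fintype.card n : ℝ) ≠ 0 := by simp
  set s := t * (u ⬝ᵥ u) / Fintype.card n with hs
  have hG : Measurable (fun ω => (A ω)ᵀ * A ω) := measurable_transpose_mul_self.comp hA
  have hF1 : Measurable (fun G : Matrix n n ℝ =>
      ENNReal.ofReal (Real.exp (-(1 / 2) * (t * (u ⬝ᵥ G *ᵥ u))))) := by
    have := measurable_dotProduct_mulVec_const u
    fun_prop
  have hF2 : Measurable (fun G : Matrix n n ℝ => sphericalIntegral (s • G)) :=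
    measurable_sphericalIntegral.comp (continuous_const_smul s).measurable
  have hq : Measurable (fun q : Matrix.orthogonalGroup n ℝ × (n → ℝ) =>
      (q.1 : Matrix n n ℝ)ᵀ * Matrix.diagonal q.2 * (q.1 : Matrix n n ℝ)) := by
    have h1 : Measurable (fun q : Matrix.orthogonalGroup n ℝ × (n → ℝ) => (q.1 : Matrix n n ℝ)) :=
      measurable_subtype_coe.comp measurable_fst
    have hp : Measurable (fun q : Matrix.orthogonalGroup n ℝ × (n → ℝ) =>
        ((q.1 : Matrix n n ℝ), q.2)) := h1.prodMk measurable_snd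
    exact Measurable.comp (g := fun q : Matrix n n ℝ × (n → ℝ) =>
        q.1ᵀ * Matrix.diagonal q.2 * q.1) (f := fun q : Matrix.orthogonalGroup n ℝ × (n → ℝ) =>
        ((q.1 : Matrix n n ℝ), q.2)) measurable_conj_diagonal hp
  have key : ∀ d : n → ℝ, ∀ O : Matrix.orthogonalGroup n ℝ,
      sphericalIntegral (s • ((O : Matrix n n ℝ)ᵀ * Matrix.diagonal d * (O : Matrix n n ℝ))) =
        sphericalIntegral (s • Matrix.diagonal d) := by
    intro d O
    rw [← sphericalIntegral_conj O.2 (s • Matrix.diagonal d)]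
    simp
  have hq1 := hF1.comp hq
  have hq2 := hF2.comp hq
  simp only [Function.comp_def] at hq1 hq2
  rw [← lintegral_map hF1 hG, ← lintegral_map hF2 hG, hmap, lintegral_map hF1 hq,
    lintegral_map hF2 hq, lintegral_prod_symm _ hq1.aemeasurable,
    lintegral_prod_symm _ hq2.aemeasurable]
  refine lintegral_congr fun d => ?_
  simp only [key, lintegral_const, measure_univ, mul_one]
  have hf : Measurable (fun x : n → ℝ => ENNReal.ofReal
      (Real.exp (-(1 / 2) * (t * (x ⬝ᵥ Matrix.diagonal d *ᵥ x))))) := by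
    have : Measurable (fun x : n → ℝ => x ⬝ᵥ Matrix.diagonal d *ᵥ x) :=
      (continuous_id.dotProduct (Continuous.matrix_mulVec continuous_const continuous_id)).measurable
    fun_prop
  have h1 := lintegral_orthogonal_mulVec η hf u
  simp only [dotProduct_conj_mulVec]
  rw [h1, sphericalIntegral]
  refine lintegral_congr fun g => ?_
  congr 3
  have hnn : 0 ≤ u ⬝ᵥ u / g ⬝ᵥ g :=
    div_nonneg (dotProduct_self_nonneg_real u) (dotProduct_self_nonneg_real g)
  rw [Matrix.mulVec_smul, smul_dotProduct, dotProduct_smul, Matrix.smul_mulVec, dotProduct_smul,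
    smul_smul, Real.mul_self_sqrt hnn, smul_eq_mul, smul_eq_mul, hs]
  field_simp

/-- The quadratic part of the exponent is absorbed as a change of variance to 1/b; the linear part
is then a Gaussian moment generating function. -/
theorem lintegral_exp_quadratic_gaussianReal {k : ℝ} (hk : 0 < k) (σ y : ℝ) :
    ∫⁻ x, ENNReal.ofReal (Real.exp (-(k / 2) * (σ * x - y) ^ 2)) ∂gaussianReal 0 1 =
      ENNReal.ofReal (Real.exp (-(1 / 2) * Real.log (1 + k * σ ^ 2) +
        -(1 / 2) * (k / (1 + k * σ ^ 2) * y ^ 2))) := by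
  set b := 1 + k * σ ^ 2 with hb
  have hb0 : 0 < b := by positivity
  have hpt : ∀ x : ℝ, ENNReal.ofReal (Real.exp (-(k / 2) * (σ * x - y) ^ 2)) =
      ENNReal.ofReal (Real.exp (-(k / 2) * y ^ 2)) *
        (ENNReal.ofReal (Real.exp (-(b - 1) / 2 * x ^ 2)) *
          ENNReal.ofReal (Real.exp (k * σ * y * x))) := by
    intro x
    rw [← ENNReal.ofReal_mul (Real.exp_pos _).le, ← ENNReal.ofReal_mul (Real.exp_pos _).le,
      ← Real.exp_add, ← Real.exp_add]
    congr 2; rw [hb]; ring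
  have hmgf : ∀ t : ℝ, ∫⁻ x, ENNReal.ofReal (Real.exp (t * x)) ∂gaussianReal 0 1 =
      ENNReal.ofReal (Real.exp (t ^ 2 / 2)) := by
    intro t
    rw [← ofReal_integral_eq_lintegral_ofReal (integrable_exp_mul_gaussianReal t)
      (ae_of_all _ fun x => (Real.exp_pos _).le)]
    have := congrFun (mgf_fun_id_gaussianReal (μ := 0) (v := 1)) t
    simp only [mgf] at this
    rw [this]; simp
  have h1 := lintegral_withDensity_eq_lintegral_mul (gaussianReal 0 1)
    (f := fun x => ENNReal.ofReal (Real.exp (-(b - 1) / 2 * x ^ 2))) (by fun_prop)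
    (g := fun x => ENNReal.ofReal (Real.exp (k * σ * y * x))) (by fun_prop)
  simp only [Pi.mul_apply] at h1
  simp only [hpt]
  rw [lintegral_const_mul _ (by fun_prop), ← h1, gaussianReal_withDensity_exp hb0,
    lintegral_smul_measure, lintegral_map (by fun_prop) (by fun_prop)]
  simp only [← mul_assoc]
  rw [hmgf, smul_eq_mul, ← ENNReal.ofReal_mul (Real.exp_pos _).le,
    ← ENNReal.ofReal_mul (Real.exp_pos _).le, ← Real.exp_add, ← Real.exp_add]
  congr 2
  rw [mul_pow, inv_pow, Real.sq_sqrt hb0.le]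
  field_simp
  rw [hb]; ring

omit [DecidableEq n] in
/-- Integrating out the Gaussian noise. -/
theorem lintegral_exp_noise {M : ℕ} {P : Measure Ω} [IsProbabilityMeasure P]
    {A : Ω → Matrix (Fin M) n ℝ} {w : Ω → Fin M → ℝ} (hA : Measurable A) (hw : Measurable w)
    (hwlaw : P.map w = Measure.pi (fun _ => gaussianReal 0 1)) (hwA : IndepFun w A P)
    {k : ℝ} (hk : 0 < k) (σ : ℝ) (u : n → ℝ) :
    ∫⁻ ω, ENNReal.ofReal (Real.exp (-(k / 2) * ‖WithLp.toLp 2 (σ • w ω - (A ω) *ᵥ u)‖ ^ 2)) ∂P =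
      ENNReal.ofReal (Real.exp (-(1 / 2) * (M * Real.log (1 + k * σ ^ 2)))) *
        ∫⁻ ω, ENNReal.ofReal (Real.exp (-(1 / 2) *
          (k / (1 + k * σ ^ 2) * (u ⬝ᵥ ((A ω)ᵀ * A ω) *ᵥ u)))) ∂P := by
  have hjoint := (indepFun_iff_map_prod_eq_prod_map_map hw.aemeasurable hA.aemeasurable).1 hwA
  have hAmap : IsProbabilityMeasure (P.map A) := Measure.isProbabilityMeasure_map hA.aemeasurable
  have hAu : Measurable (fun A : Matrix (Fin M) n ℝ => A *ᵥ u) :=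
    (Continuous.matrix_mulVec continuous_id continuous_const).measurable
  have hF : Measurable (fun p : (Fin M → ℝ) × Matrix (Fin M) n ℝ =>
      ∏ j, ENNReal.ofReal (Real.exp (-(k / 2) * (σ * p.1 j - (p.2 *ᵥ u) j) ^ 2))) := by
    have : Measurable (fun p : (Fin M → ℝ) × Matrix (Fin M) n ℝ => p.2 *ᵥ u) :=
      hAu.comp measurable_snd
    fun_prop
  have hpt : ∀ ω, ENNReal.ofReal
      (Real.exp (-(k / 2) * ‖WithLp.toLp 2 (σ • w ω - (A ω) *ᵥ u)‖ ^ 2)) =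
      ∏ j, ENNReal.ofReal (Real.exp (-(k / 2) * (σ * w ω j - ((A ω) *ᵥ u) j) ^ 2)) := by
    intro ω
    rw [← ENNReal.ofReal_prod_of_nonneg (fun i _ => (Real.exp_pos _).le), ← Real.exp_sum,
      EuclideanSpace.real_norm_sq_eq, Finset.mul_sum]
    simp
  simp only [hpt]
  have h1 : ∫⁻ ω, ∏ j, ENNReal.ofReal (Real.exp (-(k / 2) * (σ * w ω j - ((A ω) *ᵥ u) j) ^ 2)) ∂P =
      ∫⁻ p, ∏ j, ENNReal.ofReal (Real.exp (-(k / 2) * (σ * p.1 j - (p.2 *ᵥ u) j) ^ 2))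
        ∂(P.map fun ω => (w ω, A ω)) := by
    rw [lintegral_map hF (hw.prodMk hA)]
  rw [h1, hjoint, hwlaw, lintegral_prod_symm _ hF.aemeasurable]
  have h2 : ∀ B : Matrix (Fin M) n ℝ,
      ∫⁻ x, ∏ j, ENNReal.ofReal (Real.exp (-(k / 2) * (σ * x j - (B *ᵥ u) j) ^ 2))
        ∂(Measure.pi fun _ : Fin M => gaussianReal 0 1) =
      ENNReal.ofReal (Real.exp (-(1 / 2) * (M * Real.log (1 + k * σ ^ 2)))) *
        ENNReal.ofReal (Real.exp (-(1 / 2) *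
          (k / (1 + k * σ ^ 2) * (u ⬝ᵥ (Bᵀ * B) *ᵥ u)))) := by
    intro B
    rw [lintegral_pi_prod (fun _ => gaussianReal 0 1)
      (fun j x => ENNReal.ofReal (Real.exp (-(k / 2) * (σ * x - (B *ᵥ u) j) ^ 2)))
      (fun j => by fun_prop)]
    simp only [lintegral_exp_quadratic_gaussianReal hk]
    rw [← ENNReal.ofReal_prod_of_nonneg (fun i _ => (Real.exp_pos _).le), ← Real.exp_sum,
      ← ENNReal.ofReal_mul (Real.exp_pos _).le, ← Real.exp_add]
    congr 2
    have : u ⬝ᵥ (Bᵀ * B) *ᵥ u = ∑ j, (B *ᵥ u) j ^ 2 := by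
      rw [← Matrix.mulVec_mulVec, Matrix.dotProduct_mulVec, Matrix.vecMul_transpose,
        dotProduct_self_eq_sum_sq]
    rw [this]
    simp only [Finset.sum_add_distrib, ← Finset.mul_sum]
    simp
  have hF1 : Measurable (fun B : Matrix (Fin M) n ℝ => ENNReal.ofReal (Real.exp (-(1 / 2) *
          (k / (1 + k * σ ^ 2) * (u ⬝ᵥ (Bᵀ * B) *ᵥ u))))) := by
    have := (measurable_dotProduct_mulVec_const u).comp
      (measurable_transpose_mul_self (m := Fin M) (n := n))
    simp only [Function.comp_def] at this
    fun_prop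
  simp only [h2]
  rw [lintegral_const_mul _ hF1, lintegral_map hF1 hA]

end RandomMatrix

/-! ### Eigenvalues of the two Gram matrices -/

section Spectra

theorem isHermitian_transpose_mul_real {m n : Type*} [Fintype m] (A : Matrix m n ℝ) :
    (Aᵀ * A).IsHermitian := by
  simpa using Matrix.isHermitian_conjTranspose_mul_self A

theorem gramEig_nonneg {M : ℕ} {n : Type*} [Fintype n] (A : Matrix (Fin M) n ℝ) (i : Fin M) : 0 ≤ gramEig A i := by
  have h := Matrix.posSemidef_self_mul_conjTranspose A
  simp only [Matrix.conjTranspose_eq_transpose_of_trivial] at h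
  exact h.eigenvalues_nonneg i

variable {m n : Type*} [Fintype m] [Fintype n] [DecidableEq n]

/-- The eigenvalues of `Aᵀ A`, listed with multiplicity. -/
noncomputable def colEig (A : Matrix m n ℝ) : n → ℝ :=
  (isHermitian_transpose_mul_real A).eigenvalues

theorem colEig_nonneg (A : Matrix m n ℝ) (i : n) : 0 ≤ colEig A i := by
  have h := Matrix.posSemidef_conjTranspose_mul_self A
  simp only [Matrix.conjTranspose_eq_transpose_of_trivial] at h
  exact h.eigenvalues_nonneg i

theorem sphericalIntegral_smul_transpose_mul_self (A : Matrix m n ℝ) (s : ℝ) :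
    sphericalIntegral (s • (Aᵀ * A)) =
      sphericalIntegral (Matrix.diagonal fun i => s * colEig A i) := by
  set hA := isHermitian_transpose_mul_real A
  have h1 := hA.spectral_theorem
  set U := hA.eigenvectorUnitary
  have hU : (U : Matrix n n ℝ)ᵀ ∈ Matrix.orthogonalGroup n ℝ := (star U).2
  have h2 : s • (Aᵀ * A) = ((U : Matrix n n ℝ)ᵀ)ᵀ *
      Matrix.diagonal (fun i => s * colEig A i) * (U : Matrix n n ℝ)ᵀ := by
    have h3 : Matrix.diagonal (fun i => s * colEig A i) =
        s • Matrix.diagonal (hA.eigenvalues) := by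
      ext i j
      by_cases hij : i = j
      · subst hij; simp [colEig]
      · simp [hij]
    rw [h3, Matrix.mul_smul, Matrix.smul_mul]
    congr 1
  rw [h2, sphericalIntegral_conj hU]

-- The characteristic polynomials of AᵀA and AAᵀ differ by a power of X, so the former spectrum has
-- N - M additional zeros.
open Polynomial in
theorem sum_colEig {M : ℕ} (A : Matrix (Fin M) n ℝ) (hM : M ≤ Fintype.card n) (f : ℝ → ℝ) :
    ∑ i, f (colEig A i) = ∑ j, f (gramEig A j) + ((Fintype.card n : ℝ) - M) * f 0 := by
  have h1 := Matrix.charpoly_mul_comm_of_le Aᵀ A (by simpa using hM)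
  have h2 := (isHermitian_transpose_mul_real A).roots_charpoly_eq_eigenvalues
  have h3 := (isHermitian_mul_transpose_real A).roots_charpoly_eq_eigenvalues
  have hne : (X ^ (Fintype.card n - M) * (A * Aᵀ).charpoly : ℝ[X]) ≠ 0 :=
    mul_ne_zero (pow_ne_zero _ X_ne_zero) (Matrix.charpoly_monic _).ne_zero
  rw [Fintype.card_fin] at h1
  rw [h1, roots_mul hne, roots_pow, roots_X, h3] at h2
  have h4 := congrArg (fun s : Multiset ℝ => (s.map f).sum) h2
  simp only [Multiset.map_add, Multiset.sum_add, Multiset.map_map, Multiset.map_nsmul,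
    Multiset.sum_nsmul] at h4
  simp only [Multiset.map_singleton, Multiset.sum_singleton, nsmul_eq_mul, Nat.cast_sub hM] at h4
  rw [add_comm]
  exact h4.symm

end Spectra

/-! ### Convexity, stationary points and saddles of the potential -/

section Potential

/-- The set of `Λ` for which `Λ c + x` is bounded away from zero for almost every `x`. -/
def potentialDomain (c : ℝ) (G : Measure ℝ) : Set ℝ :=
  {Λ | ∃ ε > 0, ∀ᵐ x ∂G, ε ≤ Λ * c + x}

/-- The linearly tilted logarithmic potential of `G`. -/
noncomputable def potential (c p : ℝ) (G : Measure ℝ) (Λ : ℝ) : ℝ :=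
  Λ * p - ∫ x, Real.log (Λ * c + x) ∂G

variable {c p : ℝ} {G : Measure ℝ} [IsProbabilityMeasure G]

theorem integrable_log_potential (hG : Integrable (fun x => x) G) {Λ : ℝ}
    (hΛ : Λ ∈ potentialDomain c G) : Integrable (fun x => Real.log (Λ * c + x)) G := by
  obtain ⟨ε, hε, h⟩ := hΛ
  refine Integrable.mono' (g := fun x => |Real.log ε| + |Λ * c| + |x|)
    ((integrable_const _).add hG.abs) (Measurable.aestronglyMeasurable (by fun_prop)) ?_
  filter_upwards [h] with x hx
  have hpos : 0 < Λ * c + x := hε.trans_le hx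
  have h1 := Real.log_le_log hε hx
  have h2 := Real.log_le_sub_one_of_pos hpos
  rw [Real.norm_eq_abs, abs_le]
  have := abs_nonneg (Λ * c)
  have := abs_nonneg x
  have := le_abs_self (Λ * c)
  have := le_abs_self x
  have := neg_abs_le (Real.log ε)
  have := abs_nonneg (Real.log ε)
  constructor <;> linarith

theorem integrable_inv_potential {Λ : ℝ} (hΛ : Λ ∈ potentialDomain c G) :
    Integrable (fun x => (Λ * c + x)⁻¹) G := by
  obtain ⟨ε, hε, h⟩ := hΛ
  refine Integrable.of_bound (Measurable.aestronglyMeasurable (by fun_prop)) ε⁻¹ ?_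
  filter_upwards [h] with x hx
  rw [Real.norm_eq_abs, abs_of_pos (inv_pos.2 (hε.trans_le hx))]
  exact inv_anti₀ hε hx

omit [IsProbabilityMeasure G] in
theorem pos_mem_potentialDomain (hc : 0 < c) (hG0 : ∀ᵐ x ∂G, 0 ≤ x) {Λ : ℝ} (hΛ : 0 < Λ) :
    Λ ∈ potentialDomain c G := by
  refine ⟨Λ * c, by positivity, ?_⟩
  filter_upwards [hG0] with x hx
  linarith

theorem hasDerivAt_potential (hc : 0 < c) (hG : Integrable (fun x => x) G) {Λ : ℝ}
    (hΛ : Λ ∈ potentialDomain c G) :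
    HasDerivAt (potential c p G) (p - ∫ x, c * (Λ * c + x)⁻¹ ∂G) Λ := by
  have hΛ' := hΛ
  obtain ⟨ε, hε, h⟩ := hΛ
  -- On this ball Λc + x stays above ε/2 almost everywhere, which gives a constant dominating bound
  -- for the derivative.
  have hs : Metric.ball Λ (ε / (2 * c)) ∈ 𝓝 Λ := Metric.ball_mem_nhds _ (by positivity)
  have hball : ∀ᵐ x ∂G, ∀ y ∈ Metric.ball Λ (ε / (2 * c)), ε / 2 ≤ y * c + x := by
    filter_upwards [h] with x hx y hy
    rw [Metric.mem_ball, Real.dist_eq, lt_div_iff₀ (by positivity)] at hy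
    have h1 := neg_abs_le (y - Λ)
    have h2 := mul_le_mul_of_nonneg_right h1 hc.le
    nlinarith
  have key := hasDerivAt_integral_of_dominated_loc_of_deriv_le (μ := G)
    (F := fun Λ x => Real.log (Λ * c + x)) (F' := fun Λ x => c * (Λ * c + x)⁻¹)
    (bound := fun _ => c * (ε / 2)⁻¹) hs
    (Eventually.of_forall fun y => Measurable.aestronglyMeasurable (by fun_prop))
    (integrable_log_potential hG hΛ') (Measurable.aestronglyMeasurable (by fun_prop))
    (by
      filter_upwards [hball] with x hx y hy
      have := hx y hy
      have hpos : 0 < y * c + x := lt_of_lt_of_le (by positivity) this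
      rw [Real.norm_eq_abs, abs_of_pos (by positivity)]
      gcongr)
    (integrable_const _)
    (by
      filter_upwards [hball] with x hx y hy
      have hpos : 0 < y * c + x := lt_of_lt_of_le (by positivity) (hx y hy)
      have h1 : HasDerivAt (fun y : ℝ => y * c + x) c y := by
        simpa using ((hasDerivAt_id y).mul_const c).add_const x
      have := h1.log hpos.ne'
      rwa [div_eq_mul_inv] at this)
  have h2 : HasDerivAt (fun Λ : ℝ => Λ * p) p Λ := by
    simpa using (hasDerivAt_id Λ).mul_const p
  exact h2.sub key.2

/-- Concavity of the logarithm in tangent form; the convexity bounds for the potential rest on it.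
-/
theorem log_le_log_add_tangent {y y₀ : ℝ} (hy : 0 < y) (hy₀ : 0 < y₀) :
    Real.log y ≤ Real.log y₀ + (y - y₀) * y₀⁻¹ := by
  have h := Real.log_le_sub_one_of_pos (div_pos hy hy₀)
  rw [Real.log_div hy.ne' hy₀.ne'] at h
  have : (y - y₀) * y₀⁻¹ = y / y₀ - 1 := by field_simp
  linarith

theorem integral_log_le_tangent (hG : Integrable (fun x => x) G) {Λ Λ₀ : ℝ}
    (hΛ : Λ ∈ potentialDomain c G) (hΛ₀ : Λ₀ ∈ potentialDomain c G) :
    ∫ x, Real.log (Λ * c + x) ∂G ≤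
      ∫ x, Real.log (Λ₀ * c + x) ∂G + (Λ - Λ₀) * ∫ x, c * (Λ₀ * c + x)⁻¹ ∂G := by
  have hi := (integrable_inv_potential hΛ₀).const_mul c
  rw [← integral_const_mul, ← integral_add (integrable_log_potential hG hΛ₀) (hi.const_mul _)]
  refine integral_mono_ae (integrable_log_potential hG hΛ)
    ((integrable_log_potential hG hΛ₀).add (hi.const_mul _)) ?_
  obtain ⟨ε, hε, h⟩ := hΛ
  obtain ⟨ε₀, hε₀, h₀⟩ := hΛ₀
  filter_upwards [h, h₀] with x hx hx₀
  have := log_le_log_add_tangent (hε.trans_le hx) (hε₀.trans_le hx₀)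
  refine this.trans_eq ?_
  ring

/-- Stationary points of the potential are minimizers. -/
theorem potential_le_of_stationary (hc : 0 < c) (hG : Integrable (fun x => x) G) {Λ Λ₀ : ℝ}
    (hΛ : Λ ∈ potentialDomain c G) (hΛ₀ : Λ₀ ∈ potentialDomain c G)
    (hst : HasDerivAt (potential c p G) 0 Λ₀) : potential c p G Λ₀ ≤ potential c p G Λ := by
  have h1 := (hasDerivAt_potential (p := p) hc hG hΛ₀).unique hst
  have h2 := integral_log_le_tangent hG hΛ hΛ₀
  have h3 : ∫ x, c * (Λ₀ * c + x)⁻¹ ∂G = p := by linarith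
  rw [h3] at h2
  unfold potential
  linarith

/-- The derivative p - ∫ c/(Λc + x) dG is strictly increasing in Λ, hence vanishes at most once. -/
theorem stationary_potential_unique (hc : 0 < c) (hG : Integrable (fun x => x) G) {Λ₁ Λ₂ : ℝ}
    (h₁ : Λ₁ ∈ potentialDomain c G) (h₂ : Λ₂ ∈ potentialDomain c G)
    (hst₁ : HasDerivAt (potential c p G) 0 Λ₁) (hst₂ : HasDerivAt (potential c p G) 0 Λ₂) :
    Λ₁ = Λ₂ := by
  wlog hlt : Λ₁ < Λ₂ generalizing Λ₁ Λ₂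
  · rcases lt_trichotomy Λ₁ Λ₂ with h | h | h
    · exact absurd h hlt
    · exact h
    · exact (this h₂ h₁ hst₂ hst₁ h).symm
  exfalso
  have e₁ := (hasDerivAt_potential (p := p) hc hG h₁).unique hst₁
  have e₂ := (hasDerivAt_potential (p := p) hc hG h₂).unique hst₂
  have i₁ := (integrable_inv_potential h₁).const_mul c
  have i₂ := (integrable_inv_potential h₂).const_mul c
  have h0 : ∫ x, (c * (Λ₁ * c + x)⁻¹ - c * (Λ₂ * c + x)⁻¹) ∂G = 0 := by
    rw [integral_sub i₁ i₂]; linarith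
  obtain ⟨ε, hε, h⟩ := h₁
  have hpos : ∀ᵐ x ∂G, 0 < c * (Λ₁ * c + x)⁻¹ - c * (Λ₂ * c + x)⁻¹ := by
    filter_upwards [h] with x hx
    have hy : 0 < Λ₁ * c + x := hε.trans_le hx
    have : (Λ₂ * c + x)⁻¹ < (Λ₁ * c + x)⁻¹ := by
      refine inv_strictAnti₀ hy ?_
      have := mul_lt_mul_of_pos_right hlt hc
      linarith
    have := mul_lt_mul_of_pos_left this hc
    linarith
  have hz := (integral_eq_zero_iff_of_nonneg_ae (hpos.mono fun x hx => hx.le) (i₁.sub i₂)).1 h0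
  have : ∀ᵐ _ ∂G, False := by
    filter_upwards [hz, hpos] with x h1 h2
    simp only [Pi.zero_apply] at h1
    exact h2.ne' h1
  exact this.exists.choose_spec

/-- The tangent to the logarithm at c/p has slope p/c, so its growth in Λ cancels the linear term Λp
exactly. -/
theorem bddBelow_potential (hc : 0 < c) (hp : 0 < p) (hG : Integrable (fun x => x) G) :
    BddBelow (potential c p G '' potentialDomain c G) := by
  refine ⟨-(∫ x, x ∂G) * (p / c) - Real.log (c / p) + 1, ?_⟩
  rintro _ ⟨Λ, hΛ, rfl⟩
  have h1 : ∫ x, Real.log (Λ * c + x) ∂G ≤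
      ∫ x, (Real.log (c / p) + (Λ * c - c / p) * (c / p)⁻¹ + (c / p)⁻¹ * x) ∂G := by
    refine integral_mono_ae (integrable_log_potential hG hΛ)
      ((integrable_const _).add (hG.const_mul _)) ?_
    obtain ⟨ε, hε, h⟩ := hΛ
    filter_upwards [h] with x hx
    have := log_le_log_add_tangent (hε.trans_le hx) (div_pos hc hp)
    linarith
  rw [integral_add (integrable_const _) (hG.const_mul _), integral_const_mul] at h1
  simp only [integral_const, probReal_univ, smul_eq_mul, one_mul] at h1
  have h2 : (Λ * c - c / p) * (c / p)⁻¹ = Λ * p - 1 := by field_simp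
  rw [h2, inv_div] at h1
  unfold potential
  linarith

/-- If `G` has mass at least `κ` at zero, the saddle point equation has a solution, which moreover
is bounded away from zero. -/
theorem exists_saddle (hc : 0 < c) (hp : 0 < p) (hG0 : ∀ᵐ x ∂G, 0 ≤ x) {κ : ℝ} (hκ : 0 < κ)
    (hκG : κ ≤ G.real {0}) :
    ∃ Λ, κ / p ≤ Λ ∧ Λ ≤ 1 / p ∧ ∫ x, c * (Λ * c + x)⁻¹ ∂G = p := by
  have hκ1 : κ ≤ 1 := hκG.trans measureReal_le_one
  have hle : κ / p ≤ 1 / p := by gcongr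
  have hpos : ∀ Λ ∈ Set.Icc (κ / p) (1 / p), 0 < Λ := fun Λ h => (div_pos hκ hp).trans_le h.1
  have hcont : ContinuousOn (fun Λ => ∫ x, c * (Λ * c + x)⁻¹ ∂G) (Set.Icc (κ / p) (1 / p)) := by
    refine continuousOn_of_dominated (bound := fun _ => c * (κ / p * c)⁻¹)
      (fun Λ _ => Measurable.aestronglyMeasurable (by fun_prop)) ?_ (integrable_const _) ?_
    · intro Λ hΛ
      filter_upwards [hG0] with x hx
      have h1 : κ / p * c ≤ Λ * c + x := by
        have := mul_le_mul_of_nonneg_right hΛ.1 hc.le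
        linarith
      have h0 : 0 < κ / p * c := by positivity
      rw [Real.norm_eq_abs, abs_of_pos (mul_pos hc (inv_pos.2 (h0.trans_le h1)))]
      gcongr
    · filter_upwards [hG0] with x hx
      refine ContinuousOn.mul continuousOn_const (ContinuousOn.inv₀ (by fun_prop) ?_)
      intro Λ hΛ
      have := mul_pos (hpos Λ hΛ) hc
      linarith
  have hint : ∀ Λ, 0 < Λ → Integrable (fun x => c * (Λ * c + x)⁻¹) G := fun Λ hΛ =>
    (integrable_inv_potential (pos_mem_potentialDomain hc hG0 hΛ)).const_mul c
  -- At Λ = κ/p the atom alone contributes at least κ/Λ = p; at Λ = 1/p the integrand is at most p.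
  -- The intermediate value theorem does the rest.
  have hlow : p ≤ ∫ x, c * (κ / p * c + x)⁻¹ ∂G := by
    have hΛ : 0 < κ / p := div_pos hκ hp
    calc p ≤ G.real {0} * (p / κ) := by
          rw [← mul_div_assoc, le_div_iff₀ hκ, mul_comm p]; gcongr
      _ = ∫ x, ({0} : Set ℝ).indicator (fun _ => p / κ) x ∂G := by
          rw [integral_indicator_const _ (measurableSet_singleton 0), smul_eq_mul]
      _ ≤ _ := by
          refine integral_mono_ae ((integrable_const _).indicator (measurableSet_singleton 0))
            (hint _ hΛ) ?_
          filter_upwards [hG0] with x hx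
          by_cases h0 : x = 0
          · subst h0
            rw [Set.indicator_of_mem (Set.mem_singleton _)]
            apply le_of_eq; field_simp; simp
          · rw [Set.indicator_of_notMem (by simpa using h0)]
            positivity
  have hhigh : ∫ x, c * (1 / p * c + x)⁻¹ ∂G ≤ p := by
    calc ∫ x, c * (1 / p * c + x)⁻¹ ∂G ≤ ∫ _x, p ∂G := by
          refine integral_mono_ae (hint _ (by positivity)) (integrable_const _) ?_
          filter_upwards [hG0] with x hx
          calc c * (1 / p * c + x)⁻¹ ≤ c * (1 / p * c)⁻¹ := by
                gcongr; linarith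
            _ = p := by field_simp
      _ = p := by simp
  obtain ⟨Λ, hΛ, h⟩ := intermediate_value_Icc' hle hcont ⟨hhigh, hlow⟩
  exact ⟨Λ, hΛ.1, hΛ.2, h⟩

end Potential

/-! ### Empirical measures and the saddle bound in the presence of an atom -/

section Empirical

variable {n : Type*} [Fintype n]

/-- The uniform distribution on the values of `d`. -/
noncomputable def empiricalMeasure (d : n → ℝ) : Measure ℝ :=
  (Fintype.card n : ℝ≥0∞)⁻¹ • ∑ i, Measure.dirac (d i)

instance [Nonempty n] (d : n → ℝ) : IsProbabilityMeasure (empiricalMeasure d) := by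
  refine ⟨?_⟩
  simp [empiricalMeasure, ENNReal.inv_mul_cancel]

theorem integrable_empiricalMeasure [Nonempty n] (d : n → ℝ) (f : ℝ → ℝ) :
    Integrable f (empiricalMeasure d) :=
  Integrable.smul_measure (integrable_finsetSum_measure.2 fun i _ => integrable_dirac (by simp))
    (by simp)

theorem integral_empiricalMeasure [Nonempty n] (d : n → ℝ) (f : ℝ → ℝ) :
    ∫ x, f x ∂empiricalMeasure d = (Fintype.card n : ℝ)⁻¹ * ∑ i, f (d i) := by
  rw [empiricalMeasure, integral_smul_measure,
    integral_finsetSum_measure fun i _ => integrable_dirac (by simp)]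
  simp

theorem ae_empiricalMeasure [Nonempty n] (d : n → ℝ) (q : ℝ → Prop) :
    (∀ᵐ x ∂empiricalMeasure d, q x) ↔ ∀ i, q (d i) := by
  simp [ae_iff, empiricalMeasure, Measure.finsetSum_apply, Finset.sum_eq_zero_iff]

theorem sum_log_eq_integral_empiricalMeasure [Nonempty n] (d : n → ℝ) (f : ℝ → ℝ) :
    ∑ i, f (d i) = Fintype.card n * ∫ x, f x ∂empiricalMeasure d := by
  rw [integral_empiricalMeasure]
  field_simp

/-- An atom of mass κ places the saddle in [κ, 1] and bounds every tilted variance by κ⁻¹, so the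
constants depend on κ only and not on the spectrum or the dimension. -/
theorem exists_le_sphericalIntegral_of_atom {κ : ℝ} (hκ : 0 < κ) :
    ∃ C > 0, ∃ N₀ : ℕ, ∀ {n : Type*} [Fintype n] [DecidableEq n] [Nonempty n],
      N₀ ≤ Fintype.card n → ∀ a : n → ℝ, (∀ i, 0 ≤ a i) →
      κ ≤ (empiricalMeasure a).real {0} →
      ∃ w, κ ≤ w ∧ w ≤ 1 ∧
        ENNReal.ofReal (C * Real.exp (Fintype.card n / 2 *
          (w - 1 - ∫ x, Real.log (w + x) ∂empiricalMeasure a))) ≤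
        sphericalIntegral (Matrix.diagonal a) := by
  obtain ⟨C, hC, N₀, h⟩ := exists_le_sphericalIntegral_diagonal κ⁻¹
  refine ⟨C, hC, N₀, ?_⟩
  intro n _ _ _ hcard a ha hatom
  obtain ⟨w, hw1, hw2, hw⟩ := exists_saddle (c := 1) (p := 1) one_pos one_pos
    ((ae_empiricalMeasure a _).2 ha) hκ hatom
  rw [div_one] at hw1 hw2
  refine ⟨w, hw1, hw2, ?_⟩
  simp only [mul_one, one_mul] at hw
  have h1 := h hcard a w (hκ.trans_le hw1) hw2 ha
    (fun i => inv_anti₀ hκ (by linarith [ha i]))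
    (by rw [sum_log_eq_integral_empiricalMeasure a (fun x => (w + x)⁻¹), hw, mul_one])
  rw [sum_log_eq_integral_empiricalMeasure a (fun x => Real.log (w + x))] at h1
  refine le_of_eq_of_le ?_ h1
  congr 3; ring

end Empirical

/-! ### The law of the full spectrum and the extremization problem -/

section Mixture

/-- The mixture of `F` with a point mass at zero of weight `1 - α`. -/
noncomputable def mixZero (α : ℝ) (F : Measure ℝ) : Measure ℝ :=
  ENNReal.ofReal (1 - α) • Measure.dirac 0 + ENNReal.ofReal α • F

variable {α : ℝ} {F : Measure ℝ}

theorem isProbabilityMeasure_mixZero [IsProbabilityMeasure F] (hα : 0 ≤ α) (hα1 : α ≤ 1) :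
    IsProbabilityMeasure (mixZero α F) := by
  refine ⟨?_⟩
  simp only [mixZero, Measure.add_apply, Measure.smul_apply, measure_univ, smul_eq_mul, mul_one]
  rw [← ENNReal.ofReal_add (by linarith) hα]
  simp

theorem integrable_mixZero {f : ℝ → ℝ} (hf : Integrable f F) : Integrable f (mixZero α F) :=
  ((integrable_dirac (by simp)).smul_measure ENNReal.ofReal_ne_top).add_measure
    (hf.smul_measure ENNReal.ofReal_ne_top)

theorem integral_mixZero (hα : 0 ≤ α) (hα1 : α ≤ 1) {f : ℝ → ℝ} (hf : Integrable f F) :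
    ∫ x, f x ∂mixZero α F = (1 - α) * f 0 + α * ∫ x, f x ∂F := by
  rw [mixZero, integral_add_measure ((integrable_dirac (by simp)).smul_measure
    ENNReal.ofReal_ne_top) (hf.smul_measure ENNReal.ofReal_ne_top), integral_smul_measure,
    integral_smul_measure, integral_dirac, ENNReal.toReal_ofReal (by linarith),
    ENNReal.toReal_ofReal hα]
  simp

theorem ae_mixZero (hα : 0 < α) (q : ℝ → Prop) :
    (∀ᵐ x ∂mixZero α F, q x) ↔ (α < 1 → q 0) ∧ ∀ᵐ x ∂F, q x := by
  simp only [ae_iff, mixZero, Measure.add_apply, Measure.smul_apply, smul_eq_mul, add_eq_zero,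
    mul_eq_zero, ENNReal.ofReal_eq_zero, hα.not_ge, false_or, sub_nonpos]
  refine and_congr ?_ Iff.rfl
  rw [← not_lt, ← imp_iff_not_or]
  simp

theorem mixZero_one : mixZero 1 F = F := by simp [mixZero]

theorem le_mixZero_real_zero [IsProbabilityMeasure F] (hα : 0 ≤ α) (hα1 : α ≤ 1) :
    1 - α ≤ (mixZero α F).real {0} := by
  have := isProbabilityMeasure_mixZero (F := F) hα hα1
  rw [measureReal_def, ← ENNReal.ofReal_le_iff_le_toReal (measure_ne_top _ _)]
  simp [mixZero]

/-- Openness lets identities valid on the domain hold in a neighbourhood of each of its points, so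
that derivatives can be transferred. -/
theorem isOpen_potentialDomain (c : ℝ) (G : Measure ℝ) : IsOpen (potentialDomain c G) := by
  rw [isOpen_iff_mem_nhds]
  rintro Λ ⟨ε, hε, h⟩
  have hc : ContinuousAt (fun y : ℝ => (y - Λ) * c) Λ := by fun_prop
  have h2 : ∀ᶠ y in 𝓝 Λ, -(ε / 2) < (y - Λ) * c :=
    hc.eventually_const_lt (by simp only [sub_self, zero_mul]; linarith)
  filter_upwards [h2] with y hy
  refine ⟨ε / 2, by positivity, ?_⟩
  filter_upwards [h] with x hx
  nlinarith

variable {β lam σ ν : ℝ}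

/-- For α < 1 the condition Λ ≥ ε is exactly the condition at the atom x = 0, up to the factor c. -/
theorem objectiveDomain_eq (hα : 0 < α) (hβ : 0 < β) (hlam : 0 < lam) :
    objectiveDomain α β lam σ F = potentialDomain (β * σ ^ 2 + lam) (mixZero α F) := by
  have hc : 0 < β * σ ^ 2 + lam := by positivity
  ext Λ
  simp only [objectiveDomain, potentialDomain, ae_mixZero hα]
  constructor
  · rintro ⟨ε, hε, h1, h2⟩
    refine ⟨min ε (ε * (β * σ ^ 2 + lam)), by positivity, fun h => ?_, ?_⟩
    · rw [add_zero]
      exact (min_le_right _ _).trans (mul_le_mul_of_nonneg_right (h1 h) hc.le)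
    · filter_upwards [h2] with x hx
      refine (min_le_left _ _).trans (hx.trans_eq (by ring))
  · rintro ⟨ε, hε, h1, h2⟩
    refine ⟨min ε (ε / (β * σ ^ 2 + lam)), by positivity, fun h => ?_, ?_⟩
    · refine (min_le_right _ _).trans ?_
      rw [div_le_iff₀ hc]
      simpa using h1 h
    · filter_upwards [h2] with x hx
      refine (min_le_left _ _).trans (hx.trans_eq (by ring))

/-- The atom contributes (1 - α) ln(Λc), which splits into (1 - α) ln Λ and a constant; at α = 1
both vanish, so Λ need not be positive. -/
theorem objective_eq [IsProbabilityMeasure F] (hα : 0 < α) (hα1 : α ≤ 1) (hβ : 0 < β)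
    (hlam : 0 < lam) (hF : Integrable (fun x => x) F) {Λ : ℝ}
    (hΛ : Λ ∈ objectiveDomain α β lam σ F) :
    Integrable (fun x => Real.log (Λ * β * σ ^ 2 + Λ * lam + x)) F ∧
    objective α β lam σ ν F Λ = potential (β * σ ^ 2 + lam) (β * ν) (mixZero α F) Λ +
      (1 - α) * Real.log (β * σ ^ 2 + lam) := by
  have hc : 0 < β * σ ^ 2 + lam := by positivity
  have hΛF : Λ ∈ potentialDomain (β * σ ^ 2 + lam) F := by
    obtain ⟨ε, hε, _, h⟩ := hΛ
    exact ⟨ε, hε, h.mono fun x hx => hx.trans_eq (by ring)⟩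
  have hi := integrable_log_potential hF hΛF
  have he : ∀ x, Λ * β * σ ^ 2 + Λ * lam + x = Λ * (β * σ ^ 2 + lam) + x := fun x => by ring
  simp only [he]
  refine ⟨hi, ?_⟩
  rw [potential, integral_mixZero hα.le hα1 hi, objective]
  simp only [he]
  rcases hα1.lt_or_eq with h1 | h1
  · obtain ⟨ε, hε, h, _⟩ := hΛ
    rw [add_zero, Real.log_mul (hε.trans_le (h h1)).ne' hc.ne']
    ring
  · rw [h1]; ring

theorem stationaryPoints_objective [IsProbabilityMeasure F] (hα : 0 < α) (hα1 : α ≤ 1) (hβ : 0 < β)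
    (hlam : 0 < lam) (hF : Integrable (fun x => x) F) :
    stationaryPoints (objective α β lam σ ν F) (objectiveDomain α β lam σ F) =
      stationaryPoints (potential (β * σ ^ 2 + lam) (β * ν) (mixZero α F))
        (potentialDomain (β * σ ^ 2 + lam) (mixZero α F)) := by
  ext Λ
  simp only [stationaryPoints, Set.mem_ofPred_eq]
  rw [objectiveDomain_eq hα hβ hlam]
  refine and_congr_right fun hΛ => ?_
  have hev : objective α β lam σ ν F =ᶠ[𝓝 Λ] fun Λ =>
      potential (β * σ ^ 2 + lam) (β * ν) (mixZero α F) Λ +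
        (1 - α) * Real.log (β * σ ^ 2 + lam) := by
    filter_upwards [(isOpen_potentialDomain _ _).mem_nhds hΛ] with y hy
    rw [← objectiveDomain_eq hα hβ hlam] at hy
    exact (objective_eq hα hα1 hβ hlam hF hy).2
  rw [hev.hasDerivAt_iff, hasDerivAt_add_const_iff]

/-- The value `HFun` in terms of the infimum of the potential of the mixture. -/
theorem HFun_eq [IsProbabilityMeasure F] (hα : 0 < α) (hα1 : α ≤ 1) (hβ : 0 < β)
    (hlam : 0 < lam) (hF0 : ∀ᵐ x ∂F, 0 ≤ x) (hF : Integrable (fun x => x) F) (hν : 0 < ν) :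
    HFun α β lam σ ν F = 1 / 2 * sInf (potential (β * σ ^ 2 + lam) (β * ν) (mixZero α F) ''
        potentialDomain (β * σ ^ 2 + lam) (mixZero α F)) +
      ((1 - α) * Real.log (β * σ ^ 2 + lam) - 1 - Real.log (β * ν) + α * Real.log lam) / 2 := by
  have hc : 0 < β * σ ^ 2 + lam := by positivity
  have := isProbabilityMeasure_mixZero (F := F) hα.le hα1
  have hG := integrable_mixZero (α := α) hF
  have hG0 : ∀ᵐ x ∂mixZero α F, 0 ≤ x := (ae_mixZero hα _).2 ⟨fun _ => le_rfl, hF0⟩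
  have hbdd := bddBelow_potential (G := mixZero α F) hc (mul_pos hβ hν) hG
  set D := potentialDomain (β * σ ^ 2 + lam) (mixZero α F) with hD
  have hne : D.Nonempty := ⟨1, pos_mem_potentialDomain hc hG0 one_pos⟩
  have hext : extr (objective α β lam σ ν F) (objectiveDomain α β lam σ F) =
      sInf (potential (β * σ ^ 2 + lam) (β * ν) (mixZero α F) '' D) +
        (1 - α) * Real.log (β * σ ^ 2 + lam) := by
    rw [extr]
    split_ifs with h
    -- By convexity any stationary point attains the infimum, so the choice made in `extr` is
    -- immaterial.
    · have hs := h.some_mem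
      set Λ₀ := h.some
      have hs' := hs
      rw [stationaryPoints_objective hα hα1 hβ hlam hF] at hs'
      rw [(objective_eq hα hα1 hβ hlam hF hs.1).2]
      congr 1
      refine le_antisymm (le_csInf (hne.image _) ?_) (csInf_le hbdd ⟨Λ₀, hs'.1, rfl⟩)
      rintro _ ⟨Λ, hΛ, rfl⟩
      exact potential_le_of_stationary hc hG hΛ hs'.1 hs'.2
    · have himg : objective α β lam σ ν F '' objectiveDomain α β lam σ F =
          (fun y => y + (1 - α) * Real.log (β * σ ^ 2 + lam)) ''
            (potential (β * σ ^ 2 + lam) (β * ν) (mixZero α F) '' D) := by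
        rw [Set.image_image, hD, ← objectiveDomain_eq hα hβ hlam]
        exact Set.image_congr fun Λ hΛ => (objective_eq hα hα1 hβ hlam hF hΛ).2
      rw [himg]
      exact ((OrderIso.addRight ((1 - α) * Real.log (β * σ ^ 2 + lam))).map_csInf'
        (hne.image _) hbdd).symm
  rw [HFun, hext]
  ring

/-- The extremization problem is well posed. -/
theorem objective_wellPosed [IsProbabilityMeasure F] (hα : 0 < α) (hα1 : α ≤ 1) (hβ : 0 < β)
    (hlam : 0 < lam) (hF0 : ∀ᵐ x ∂F, 0 ≤ x) (hF : Integrable (fun x => x) F) (hν : 0 < ν) :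
    (objectiveDomain α β lam σ F).Nonempty ∧
    (∀ Λ ∈ objectiveDomain α β lam σ F,
      Integrable (fun x => Real.log (Λ * β * σ ^ 2 + Λ * lam + x)) F) ∧
    BddBelow (objective α β lam σ ν F '' objectiveDomain α β lam σ F) ∧
    (stationaryPoints (objective α β lam σ ν F) (objectiveDomain α β lam σ F)).Subsingleton ∧
    (α < 1 →
      (stationaryPoints (objective α β lam σ ν F) (objectiveDomain α β lam σ F)).Nonempty) := by
  have hc : 0 < β * σ ^ 2 + lam := by positivity
  have hp : 0 < β * ν := mul_pos hβ hν
  have := isProbabilityMeasure_mixZero (F := F) hα.le hα1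
  have hG := integrable_mixZero (α := α) hF
  have hG0 : ∀ᵐ x ∂mixZero α F, 0 ≤ x := (ae_mixZero hα _).2 ⟨fun _ => le_rfl, hF0⟩
  refine ⟨?_, fun Λ hΛ => (objective_eq (ν := ν) hα hα1 hβ hlam hF hΛ).1, ?_, ?_, fun h1 => ?_⟩
  · rw [objectiveDomain_eq hα hβ hlam]
    exact ⟨1, pos_mem_potentialDomain hc hG0 one_pos⟩
  · obtain ⟨b, hb⟩ := bddBelow_potential (G := mixZero α F) hc hp hG
    refine ⟨b + (1 - α) * Real.log (β * σ ^ 2 + lam), ?_⟩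
    rintro _ ⟨Λ, hΛ, rfl⟩
    rw [(objective_eq hα hα1 hβ hlam hF hΛ).2]
    rw [objectiveDomain_eq hα hβ hlam] at hΛ
    linarith [hb ⟨Λ, hΛ, rfl⟩]
  · rw [stationaryPoints_objective hα hα1 hβ hlam hF]
    exact fun Λ₁ h₁ Λ₂ h₂ => stationary_potential_unique hc hG h₁.1 h₂.1 h₁.2 h₂.2
  · rw [stationaryPoints_objective hα hα1 hβ hlam hF]
    obtain ⟨Λ, hΛ, -, h⟩ := exists_saddle hc hp hG0 (sub_pos.2 h1)
      (le_mixZero_real_zero hα.le hα1)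
    have hmem := pos_mem_potentialDomain hc hG0
      ((div_pos (sub_pos.2 h1) hp).trans_le hΛ)
    refine ⟨Λ, hmem, ?_⟩
    have := hasDerivAt_potential (p := β * ν) hc hG hmem
    rwa [h, sub_self] at this

theorem esd_eq {M : ℕ} {n : Type*} [Fintype n] (A : Matrix (Fin M) n ℝ) :
    esd A = empiricalMeasure (gramEig A) := by
  simp [esd, empiricalMeasure]

/-- The N - M additional zeros of AᵀA carry the weight 1 - α; the two measures are compared through
integrals of indicators. -/
theorem mixZero_esd {M : ℕ} {n : Type*} [Fintype n] [DecidableEq n] (A : Matrix (Fin M) n ℝ)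
    (hM0 : 0 < M) (hM : (M : ℝ) = α * Fintype.card n) (hα : 0 < α) (hα1 : α ≤ 1) :
    mixZero α (esd A) = empiricalMeasure (colEig A) := by
  have hMN : M ≤ Fintype.card n := by
    have : (M : ℝ) ≤ Fintype.card n := by
      rw [hM]; exact mul_le_of_le_one_left (by positivity) hα1
    exact_mod_cast this
  have hn : Nonempty n := Fintype.card_pos_iff.1 (hM0.trans_le hMN)
  have hfin : Nonempty (Fin M) := ⟨⟨0, hM0⟩⟩
  rw [esd_eq]
  have := isProbabilityMeasure_mixZero (F := empiricalMeasure (gramEig A)) hα.le hα1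
  ext s hs
  rw [← measureReal_eq_measureReal_iff, ← integral_indicator_one hs, ← integral_indicator_one hs,
    integral_mixZero hα.le hα1 (integrable_empiricalMeasure _ _), integral_empiricalMeasure,
    integral_empiricalMeasure, sum_colEig A hMN, Fintype.card_fin, hM]
  have : (Fintype.card n : ℝ) ≠ 0 := by simp
  field_simp
  ring

end Mixture

/-! ### From distribution functions to integrals of monotone test functions -/

section TestFunctions

/-- Only countably many level sets of f can have positive mass. -/
theorem exists_level_null (F : Measure ℝ) [IsProbabilityMeasure F] {f : ℝ → ℝ} (hf : Measurable f)
    {a b : ℝ} (hab : a < b) : ∃ y, a < y ∧ y < b ∧ F {x | f x = y} = 0 := by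
  have hc := Measure.countable_meas_level_set_pos (μ := F) hf
  obtain ⟨y, hy, h1, h2⟩ := (hc.dense_compl ℝ).exists_between hab
  exact ⟨y, h1, h2, by simpa using hy⟩

/-- With one level in each interval (j/n, (j+1)/n), the number of levels below v differs from nv by
at most one. -/
theorem abs_sub_card_level_le {n : ℕ} (hn : 0 < n) {y : ℕ → ℝ}
    (hy1 : ∀ j : ℕ, (j : ℝ) / n < y j) (hy2 : ∀ j : ℕ, y j < ((j : ℝ) + 1) / n) {v : ℝ}
    (hv0 : 0 ≤ v) (hv1 : v ≤ 1) :
    |v - (n : ℝ)⁻¹ * ∑ j ∈ Finset.range n, (if v ≤ y j then (0 : ℝ) else 1)| ≤ (n : ℝ)⁻¹ := by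
  have hn' : (0 : ℝ) < n := by exact_mod_cast hn
  have hsum : ∑ j ∈ Finset.range n, (if v ≤ y j then (0 : ℝ) else 1) =
      ((Finset.range n).filter fun j => y j < v).card := by
    rw [Finset.card_filter, Nat.cast_sum]
    refine Finset.sum_congr rfl fun j _ => ?_
    by_cases h : v ≤ y j
    · simp [h]
    · simp [h, not_le.1 h]
  have hlow : ⌊n * v⌋₊ ≤ ((Finset.range n).filter fun j => y j < v).card := by
    rw [← Finset.card_range ⌊n * v⌋₊]
    refine Finset.card_le_card fun j hj => ?_
    rw [Finset.mem_range] at hj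
    have h1 : ((j + 1 : ℕ) : ℝ) ≤ n * v := (Nat.le_floor_iff (by positivity)).1 hj
    rw [Finset.mem_filter, Finset.mem_range]
    refine ⟨?_, ?_⟩
    · have : ((j + 1 : ℕ) : ℝ) ≤ n := h1.trans (mul_le_of_le_one_right hn'.le hv1)
      have : j + 1 ≤ n := by exact_mod_cast this
      omega
    · refine (hy2 j).trans_le ?_
      rw [div_le_iff₀ hn']
      push_cast at h1
      linarith
  have hhigh : ((Finset.range n).filter fun j => y j < v).card ≤ ⌈n * v⌉₊ := by
    rw [← Finset.card_range ⌈n * v⌉₊]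
    refine Finset.card_le_card fun j hj => ?_
    rw [Finset.mem_filter] at hj
    rw [Finset.mem_range, Nat.lt_ceil]
    have := (hy1 j).trans hj.2
    rw [div_lt_iff₀ hn'] at this
    linarith
  rw [hsum]
  set q := ((Finset.range n).filter fun j => y j < v).card
  have h1 : n * v - 1 < q := (Nat.sub_one_lt_floor _).trans_le (by exact_mod_cast hlow)
  have h2 : (q : ℝ) < n * v + 1 :=
    lt_of_le_of_lt (by exact_mod_cast hhigh) (Nat.ceil_lt_add_one (by positivity))
  have h3 : v - (n : ℝ)⁻¹ * q = (n : ℝ)⁻¹ * (n * v - q) := by field_simp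
  rw [h3, abs_mul, abs_of_pos (inv_pos.2 hn')]
  refine mul_le_of_le_one_right (inv_pos.2 hn').le ?_
  rw [abs_le]
  constructor <;> linarith

/-- The integral of a `[0, 1]`-valued function is a Riemann sum of its distribution function, up to
the mesh size. -/
theorem abs_integral_sub_level_sum_le {n : ℕ} (hn : 0 < n) {y : ℕ → ℝ}
    (hy1 : ∀ j : ℕ, (j : ℝ) / n < y j) (hy2 : ∀ j : ℕ, y j < ((j : ℝ) + 1) / n) (μ : Measure ℝ)
    [IsProbabilityMeasure μ] {f : ℝ → ℝ} (hf : Measurable f) (hf0 : ∀ x, 0 ≤ f x)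
    (hf1 : ∀ x, f x ≤ 1) :
    |∫ x, f x ∂μ - (n : ℝ)⁻¹ * ∑ j ∈ Finset.range n, (1 - μ.real {x | f x ≤ y j})| ≤
      (n : ℝ)⁻¹ := by
  have hS : ∀ j, MeasurableSet {x | f x ≤ y j} := fun j => measurableSet_le hf measurable_const
  have hfi : Integrable f μ := Integrable.of_bound hf.aestronglyMeasurable 1
    (ae_of_all _ fun x => by rw [Real.norm_eq_abs, abs_of_nonneg (hf0 x)]; exact hf1 x)
  have hind : ∀ j x, (if f x ≤ y j then (0 : ℝ) else 1) =
      1 - ({x | f x ≤ y j} : Set ℝ).indicator (fun _ => 1) x := by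
    intro j x
    by_cases h : f x ≤ y j <;> simp [Set.indicator, h]
  have hii : ∀ j, Integrable (fun x => if f x ≤ y j then (0 : ℝ) else 1) μ := by
    intro j
    simp only [hind]
    exact (integrable_const _).sub ((integrable_const (1 : ℝ)).indicator (hS j))
  have hint : ∫ x, (n : ℝ)⁻¹ * ∑ j ∈ Finset.range n, (if f x ≤ y j then (0 : ℝ) else 1) ∂μ =
      (n : ℝ)⁻¹ * ∑ j ∈ Finset.range n, (1 - μ.real {x | f x ≤ y j}) := by
    rw [integral_const_mul, integral_finsetSum _ fun j _ => hii j]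
    congr 1
    refine Finset.sum_congr rfl fun j _ => ?_
    simp only [hind]
    rw [integral_sub (integrable_const _) ((integrable_const (1 : ℝ)).indicator (hS j)),
      integral_indicator_const _ (hS j)]
    simp
  rw [← hint, ← integral_sub hfi ((integrable_finsetSum _ fun j _ => hii j).const_mul _)]
  have hpt : ∀ x, ‖f x - (n : ℝ)⁻¹ * ∑ j ∈ Finset.range n, (if f x ≤ y j then (0 : ℝ) else 1)‖ ≤
      (n : ℝ)⁻¹ := fun x =>
    abs_sub_card_level_le hn hy1 hy2 (hf0 x) (hf1 x)
  have := norm_integral_le_of_norm_le_const (μ := μ) (ae_of_all _ hpt)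
  rwa [probReal_univ, mul_one] at this

variable {ι : Type*} {L : Filter ι} {G : ι → Measure ℝ} {F : Measure ℝ} [IsProbabilityMeasure F]

/-- A sublevel set of a continuous monotone function is empty, everything, or a half line. In the
last case the endpoint lies on the level y, hence is a continuity point of F. -/
theorem tendsto_measure_sublevel (hG : ∀ᶠ i in L, IsProbabilityMeasure (G i))
    (h : ∀ x, F {x} = 0 → Tendsto (fun i => (G i).real (Set.Iic x)) L (𝓝 (F.real (Set.Iic x))))
    {f : ℝ → ℝ} (hf : Monotone f) (hc : Continuous f) {y : ℝ} (hy : F {x | f x = y} = 0) :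
    Tendsto (fun i => (G i).real {x | f x ≤ y}) L (𝓝 (F.real {x | f x ≤ y})) := by
  by_cases h0 : ∃ x₀, f x₀ ≤ y
  swap
  · push Not at h0
    have : {x | f x ≤ y} = ∅ := Set.eq_empty_of_forall_notMem fun x hx => (h0 x).not_ge hx
    simp only [this, measureReal_empty]
    exact tendsto_const_nhds
  by_cases h1 : ∃ x₁, y < f x₁
  swap
  · push Not at h1
    have : {x | f x ≤ y} = Set.univ := Set.eq_univ_of_forall h1
    rw [this, probReal_univ]
    refine tendsto_const_nhds.congr' ?_
    filter_upwards [hG] with i hi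
    rw [probReal_univ]
  obtain ⟨x₀, hx₀⟩ := h0
  obtain ⟨x₁, hx₁⟩ := h1
  set U := {x | f x ≤ y} with hU
  have hbdd : BddAbove U := ⟨x₁, fun x hx => by
    by_contra hlt
    exact (hx₁.trans_le (hf (not_le.1 hlt).le)).not_ge hx⟩
  have hcl : IsClosed U := isClosed_le hc continuous_const
  have ht : sSup U ∈ U := hcl.csSup_mem ⟨x₀, hx₀⟩ hbdd
  have hUeq : U = Set.Iic (sSup U) :=
    Set.Subset.antisymm (fun x hx => le_csSup hbdd hx) fun x hx => (hf hx).trans ht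
  have hft : f (sSup U) = y := by
    refine le_antisymm ht ?_
    obtain ⟨s, hs⟩ := mem_range_of_exists_le_of_exists_ge hc ⟨x₀, hx₀⟩ ⟨x₁, hx₁.le⟩
    rw [← hs]
    exact hf (le_csSup hbdd hs.le)
  rw [hUeq]
  refine h _ (measure_mono_null ?_ hy)
  rintro x rfl
  exact hft

theorem tendsto_integral_of_monotone_unit (hG : ∀ᶠ i in L, IsProbabilityMeasure (G i))
    (h : ∀ x, F {x} = 0 → Tendsto (fun i => (G i).real (Set.Iic x)) L (𝓝 (F.real (Set.Iic x))))
    {f : ℝ → ℝ} (hf : Monotone f) (hc : Continuous f) (hf0 : ∀ x, 0 ≤ f x) (hf1 : ∀ x, f x ≤ 1) :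
    Tendsto (fun i => ∫ x, f x ∂G i) L (𝓝 (∫ x, f x ∂F)) := by
  rw [Metric.tendsto_nhds]
  intro ε hε
  obtain ⟨n, hn⟩ := exists_nat_gt (3 / ε)
  have hn0 : (0 : ℝ) < n := (by positivity : (0 : ℝ) < 3 / ε).trans hn
  have hninv : (n : ℝ)⁻¹ < ε / 3 := by
    rw [inv_lt_comm₀ hn0 (by positivity), inv_div]; exact hn
  have hex : ∀ j : ℕ, ∃ y, (j : ℝ) / n < y ∧ y < ((j : ℝ) + 1) / n ∧ F {x | f x = y} = 0 :=
    fun j => exists_level_null F hc.measurable (by gcongr; linarith)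
  choose y hy1 hy2 hy3 using hex
  have hnpos : 0 < n := by exact_mod_cast hn0
  have hsum : Tendsto
      (fun i => (n : ℝ)⁻¹ * ∑ j ∈ Finset.range n, (1 - (G i).real {x | f x ≤ y j})) L
      (𝓝 ((n : ℝ)⁻¹ * ∑ j ∈ Finset.range n, (1 - F.real {x | f x ≤ y j}))) :=
    (tendsto_finsetSum _ fun j _ =>
      (tendsto_measure_sublevel hG h hf hc (hy3 j)).const_sub 1).const_mul _
  filter_upwards [hG, Metric.tendsto_nhds.1 hsum (ε / 3) (by positivity)] with i hi hd
  have e1 := abs_integral_sub_level_sum_le hnpos hy1 hy2 (G i) hc.measurable hf0 hf1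
  have e2 := abs_integral_sub_level_sum_le hnpos hy1 hy2 F hc.measurable hf0 hf1
  rw [Real.dist_eq] at hd ⊢
  rw [abs_le] at e1 e2
  rw [abs_lt] at hd ⊢
  constructor <;> linarith [e1.1, e1.2, e2.1, e2.2, hd.1, hd.2]

/-- Convergence of distribution functions at continuity points implies convergence of the integrals
of bounded continuous monotone functions, along an arbitrary filter. -/
theorem tendsto_integral_of_monotone (hG : ∀ᶠ i in L, IsProbabilityMeasure (G i))
    (h : ∀ x, F {x} = 0 → Tendsto (fun i => (G i).real (Set.Iic x)) L (𝓝 (F.real (Set.Iic x))))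
    {f : ℝ → ℝ} (hf : Monotone f) (hc : Continuous f) {B : ℝ} (hB : ∀ x, |f x| ≤ B) :
    Tendsto (fun i => ∫ x, f x ∂G i) L (𝓝 (∫ x, f x ∂F)) := by
  have hB0 : 0 ≤ B := (abs_nonneg _).trans (hB 0)
  have hpos : 0 < 2 * B + 1 := by linarith
  have hb := fun x => abs_le.1 (hB x)
  have key := tendsto_integral_of_monotone_unit (f := fun x => (2 * B + 1)⁻¹ * (f x + B)) hG h
    (fun x y hxy => mul_le_mul_of_nonneg_left (by linarith [hf hxy]) (by positivity))
    (by fun_prop)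
    (fun x => mul_nonneg (by positivity) (by linarith [(hb x).1]))
    (fun x => by
      rw [inv_mul_le_iff₀ hpos]; linarith [(hb x).2])
  have hconv : ∀ μ : Measure ℝ, IsProbabilityMeasure μ →
      ∫ x, f x ∂μ = (2 * B + 1) * ∫ x, (2 * B + 1)⁻¹ * (f x + B) ∂μ - B := by
    intro μ hμ
    have hi : Integrable f μ := Integrable.of_bound hc.aestronglyMeasurable B
      (ae_of_all _ fun x => hB x)
    rw [integral_const_mul, integral_add hi (integrable_const _)]
    simp only [integral_const, probReal_univ, smul_eq_mul, one_mul]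
    field_simp
    ring
  rw [hconv F inferInstance]
  refine ((key.const_mul (2 * B + 1)).sub_const B).congr' ?_
  filter_upwards [hG] with i hi
  rw [hconv (G i) hi]

theorem tendsto_integral_of_antitone (hG : ∀ᶠ i in L, IsProbabilityMeasure (G i))
    (h : ∀ x, F {x} = 0 → Tendsto (fun i => (G i).real (Set.Iic x)) L (𝓝 (F.real (Set.Iic x))))
    {f : ℝ → ℝ} (hf : Antitone f) (hc : Continuous f) {B : ℝ} (hB : ∀ x, |f x| ≤ B) :
    Tendsto (fun i => ∫ x, f x ∂G i) L (𝓝 (∫ x, f x ∂F)) := by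
  have := (tendsto_integral_of_monotone (f := fun x => -f x) hG h hf.neg hc.neg
    (fun x => by rw [abs_neg]; exact hB x)).neg
  simpa [integral_neg] using this

end TestFunctions

/-! ### Convergence up to superexponentially small probability, as a filter -/

section Superexponential

/-- The filter of events whose complements have superexponentially small probability. -/
def superexpFilter {Ω : ℕ → Type*} [∀ k, MeasurableSpace (Ω k)] (P : ∀ k, Measure (Ω k))
    [∀ k, IsProbabilityMeasure (P k)] (N : ℕ → ℝ) (hN : Tendsto N atTop atTop) :
    Filter (Σ k, Ω k) where
  sets := {S | ∀ C : ℝ, ∀ᶠ k in atTop,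
    (P k).real {ω | (⟨k, ω⟩ : Σ k, Ω k) ∉ S} ≤ Real.exp (-C * N k)}
  univ_sets := fun C => Eventually.of_forall fun k => by simp [Real.exp_nonneg]
  sets_of_superset := fun {S T} hS hST C => by
    filter_upwards [hS C] with k hk
    have hsub : {ω | (⟨k, ω⟩ : Σ k, Ω k) ∉ T} ⊆ {ω | (⟨k, ω⟩ : Σ k, Ω k) ∉ S} :=
      fun ω hω h => hω (hST h)
    exact (measureReal_mono hsub).trans hk
  inter_sets := fun {S T} hS hT C => by
    -- The extra unit in the rate absorbs the factor 2 of the union bound once N ≥ 1.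
    filter_upwards [hS (C + 1), hT (C + 1), hN.eventually_ge_atTop 1] with k h1 h2 h3
    have hsub : {ω | (⟨k, ω⟩ : Σ k, Ω k) ∉ S ∩ T} ⊆
        {ω | (⟨k, ω⟩ : Σ k, Ω k) ∉ S} ∪ {ω | (⟨k, ω⟩ : Σ k, Ω k) ∉ T} := by
      intro ω hω
      by_contra hc
      simp only [Set.mem_union, Set.mem_ofPred_eq, not_or, not_not] at hc
      exact hω hc
    have hexp : Real.exp (-(C + 1) * N k) = Real.exp (-C * N k) * Real.exp (-N k) := by
      rw [← Real.exp_add]; congr 1; ring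
    have h4 : Real.exp (-N k) ≤ 1 / 2 := by
      rw [Real.exp_neg, inv_le_comm₀ (Real.exp_pos _) (by norm_num)]
      have := Real.add_one_le_exp (N k)
      norm_num
      linarith
    calc (P k).real {ω | (⟨k, ω⟩ : Σ k, Ω k) ∉ S ∩ T}
        ≤ _ := (measureReal_mono hsub).trans (measureReal_union_le _ _)
      _ ≤ Real.exp (-(C + 1) * N k) + Real.exp (-(C + 1) * N k) := add_le_add h1 h2
      _ ≤ Real.exp (-C * N k) := by
          rw [hexp]
          nlinarith [Real.exp_pos (-C * N k)]

variable {Ω : ℕ → Type*} [∀ k, MeasurableSpace (Ω k)] {P : ∀ k, Measure (Ω k)}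
    [∀ k, IsProbabilityMeasure (P k)] {N : ℕ → ℝ} {hN : Tendsto N atTop atTop}

theorem eventually_superexpFilter_fst {q : ℕ → Prop} (h : ∀ᶠ k in atTop, q k) :
    ∀ᶠ i in superexpFilter P N hN, q i.1 := by
  intro C
  filter_upwards [h] with k hk
  simp [hk, Real.exp_nonneg]

theorem superexpFilter_measure_le {q : (Σ k, Ω k) → Prop}
    (h : ∀ᶠ i in superexpFilter P N hN, q i) {ε : ℝ} (hε : 0 < ε) :
    ∀ᶠ k in atTop, (P k).real {ω | ¬ q ⟨k, ω⟩} ≤ ε := by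
  have h1 : Tendsto (fun k => Real.exp (-1 * N k)) atTop (𝓝 0) := by
    simp only [neg_mul, one_mul]
    exact Real.tendsto_exp_neg_atTop_nhds_zero.comp hN
  filter_upwards [h 1, h1.eventually_le_const hε] with k hk1 hk2
  exact hk1.trans hk2

/-- Gives uniqueness of limits along the filter. -/
instance : (superexpFilter P N hN).NeBot := by
  rw [neBot_iff]
  intro hbot
  have h : ∀ᶠ i in superexpFilter P N hN, False := by rw [hbot]; exact Filter.eventually_bot
  obtain ⟨k, hk⟩ := (superexpFilter_measure_le h (ε := 1 / 2) (by norm_num)).exists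
  norm_num at hk

theorem SpectrumConverges.tendsto_superexp {M : ℕ → ℕ} {n : ℕ → Type*} [∀ k, Fintype (n k)]
    {A : ∀ k, Ω k → Matrix (Fin (M k)) (n k) ℝ} {F : Measure ℝ}
    (hF : SpectrumConverges P A N F) {x : ℝ} (hx : F {x} = 0) :
    Tendsto (fun i : Σ k, Ω k => (esd (A i.1 i.2)).real (Set.Iic x)) (superexpFilter P N hN)
      (𝓝 (F.real (Set.Iic x))) := by
  rw [Metric.tendsto_nhds]
  intro ε hε C
  filter_upwards [hF x hx ε hε C] with k hk
  refine le_of_eq_of_le ?_ hk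
  congr 1
  ext ω
  simp [Real.dist_eq]

end Superexponential

/-! ### Convergence of the random spectra and consequences for the limit law -/

section SpectralConvergence

theorem mean_colEig {M : ℕ} {n : Type*} [Fintype n] [DecidableEq n] [Nonempty n]
    (A : Matrix (Fin M) n ℝ) :
    ∫ x, x ∂empiricalMeasure (colEig A) = (Fintype.card n : ℝ)⁻¹ * ∑ i, (A * Aᵀ) i i := by
  rw [integral_empiricalMeasure]
  congr 1
  have h := (isHermitian_transpose_mul_real A).trace_eq_sum_eigenvalues
  rw [Matrix.trace_mul_comm] at h
  simpa [Matrix.trace, colEig] using h.symm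

/-- Markov's inequality: the normalization makes the expected mean eigenvalue equal to M/(αN) = 1.
-/
theorem IsNormalized.mean_colEig_ge {Ω : Type*} {M : ℕ} {n : Type*} [MeasurableSpace Ω] [Fintype n]
    [DecidableEq n] [Nonempty n] {α : ℝ} {P : Measure Ω} [IsProbabilityMeasure P]
    {A : Ω → Matrix (Fin M) n ℝ}
    (h : IsNormalized α P A) (hα : 0 < α) (hM : (M : ℝ) = α * Fintype.card n) {t : ℝ} (ht : 0 < t) :
    P.real {ω | t ≤ ∫ x, x ∂empiricalMeasure (colEig (A ω))} ≤ 1 / t := by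
  have hcard : (Fintype.card n : ℝ) ≠ 0 := by simp
  have hint : Integrable (fun ω => ∫ x, x ∂empiricalMeasure (colEig (A ω))) P := by
    simp only [mean_colEig]
    exact (integrable_finsetSum _ fun i _ => (h i i).1).const_mul _
  have hval : ∫ ω, ∫ x, x ∂empiricalMeasure (colEig (A ω)) ∂P = 1 := by
    simp only [mean_colEig]
    rw [integral_const_mul, integral_finsetSum _ fun i _ => (h i i).1]
    have : ∀ i, ∫ ω, (A ω * (A ω)ᵀ) i i ∂P = 1 / α := fun i => by
      have := (h i i).2
      rw [Matrix.one_apply_eq] at this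
      field_simp
      linarith
    simp only [this, Finset.sum_const, Finset.card_univ, Fintype.card_fin, nsmul_eq_mul, hM]
    field_simp
  have hnn : 0 ≤ᵐ[P] fun ω => ∫ x, x ∂empiricalMeasure (colEig (A ω)) := ae_of_all _ fun ω =>
    integral_nonneg_of_ae ((ae_empiricalMeasure _ _).2 (colEig_nonneg (A ω)))
  have := mul_meas_ge_le_integral_of_nonneg hnn hint t
  rw [hval] at this
  rw [le_div_iff₀ ht, mul_comm]
  exact this

variable {Ω : ℕ → Type*} [∀ k, MeasurableSpace (Ω k)] {P : ∀ k, Measure (Ω k)}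
  [∀ k, IsProbabilityMeasure (P k)] {M : ℕ → ℕ} {n : ℕ → Type*} [∀ k, Fintype (n k)]
  [∀ k, DecidableEq (n k)] {A : ∀ k, Ω k → Matrix (Fin (M k)) (n k) ℝ} {α : ℝ}
  {F : Measure ℝ} [IsProbabilityMeasure F]
  {hN : Tendsto (fun k => (Fintype.card (n k) : ℝ)) atTop atTop}

omit [∀ k, DecidableEq (n k)] in
theorem eventually_nonempty (hN : Tendsto (fun k => (Fintype.card (n k) : ℝ)) atTop atTop)
    (hα : 0 < α) (hM : ∀ k, (M k : ℝ) = α * Fintype.card (n k)) :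
    ∀ᶠ k in atTop, 0 < M k ∧ Nonempty (n k) := by
  filter_upwards [hN.eventually_gt_atTop 0] with k hk
  constructor
  · have : (0 : ℝ) < M k := by rw [hM]; positivity
    exact_mod_cast this
  · exact Fintype.card_pos_iff.1 (by exact_mod_cast hk)

omit [∀ k, DecidableEq (n k)] in
theorem eventually_isProbabilityMeasure_esd (hα : 0 < α)
    (hM : ∀ k, (M k : ℝ) = α * Fintype.card (n k)) :
    ∀ᶠ i : Σ k, Ω k in superexpFilter P _ hN, IsProbabilityMeasure (esd (A i.1 i.2)) := by
  filter_upwards [eventually_superexpFilter_fst (eventually_nonempty hN hα hM)] with i hi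
  have : Nonempty (Fin (M i.1)) := ⟨⟨0, hi.1⟩⟩
  rw [esd_eq]
  infer_instance

omit [∀ k, DecidableEq (n k)] in
theorem SpectrumConverges.tendsto_integral_esd
    (hF : SpectrumConverges P A (fun k => (Fintype.card (n k) : ℝ)) F) (hα : 0 < α)
    (hM : ∀ k, (M k : ℝ) = α * Fintype.card (n k)) {f : ℝ → ℝ} (hf : Monotone f ∨ Antitone f)
    (hc : Continuous f) {B : ℝ} (hB : ∀ x, |f x| ≤ B) :
    Tendsto (fun i : Σ k, Ω k => ∫ x, f x ∂esd (A i.1 i.2)) (superexpFilter P _ hN)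
      (𝓝 (∫ x, f x ∂F)) := by
  have hp := eventually_isProbabilityMeasure_esd (P := P) (A := A) (hN := hN) hα hM
  rcases hf with hf | hf
  · exact tendsto_integral_of_monotone hp (fun x hx => hF.tendsto_superexp hx) hf hc hB
  · exact tendsto_integral_of_antitone hp (fun x hx => hF.tendsto_superexp hx) hf hc hB

theorem SpectrumConverges.tendsto_integral
    (hF : SpectrumConverges P A (fun k => (Fintype.card (n k) : ℝ)) F) (hα : 0 < α) (hα1 : α ≤ 1)
    (hM : ∀ k, (M k : ℝ) = α * Fintype.card (n k)) {f : ℝ → ℝ} (hf : Monotone f ∨ Antitone f)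
    (hc : Continuous f) {B : ℝ} (hB : ∀ x, |f x| ≤ B) :
    Tendsto (fun i : Σ k, Ω k => ∫ x, f x ∂empiricalMeasure (colEig (A i.1 i.2)))
      (superexpFilter P _ hN) (𝓝 (∫ x, f x ∂mixZero α F)) := by
  have hi : ∀ μ : Measure ℝ, IsProbabilityMeasure μ → Integrable f μ := fun μ _ =>
    Integrable.of_bound hc.aestronglyMeasurable B (ae_of_all _ fun x => hB x)
  rw [integral_mixZero hα.le hα1 (hi F inferInstance)]
  refine (((hF.tendsto_integral_esd (hN := hN) hα hM hf hc hB).const_mul α).const_add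
    ((1 - α) * f 0)).congr' ?_
  filter_upwards [eventually_superexpFilter_fst (eventually_nonempty hN hα hM),
    eventually_isProbabilityMeasure_esd hα hM] with i h1 h2
  rw [← integral_mixZero hα.le hα1 (hi _ h2), mixZero_esd _ h1.1 (hM _) hα hα1]

-- A bounded test function positive exactly on the negative axis integrates to zero against every
-- nonempty Gram spectrum, hence also against F.
omit [∀ k, DecidableEq (n k)] in
theorem SpectrumConverges.ae_nonneg (hN : Tendsto (fun k => (Fintype.card (n k) : ℝ)) atTop atTop)
    (hF : SpectrumConverges P A (fun k => (Fintype.card (n k) : ℝ)) F) (hα : 0 < α)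
    (hM : ∀ k, (M k : ℝ) = α * Fintype.card (n k)) : ∀ᵐ x ∂F, 0 ≤ x := by
  let f : ℝ → ℝ := fun x => min (max (-x) 0) 1
  have hf0 : ∀ x, 0 ≤ f x := fun x => le_min (le_max_right _ _) zero_le_one
  have hf1 : ∀ x, |f x| ≤ 1 := fun x => by rw [abs_of_nonneg (hf0 x)]; exact min_le_right _ _
  have hfc : Continuous f := by fun_prop
  have ht := hF.tendsto_integral_esd (hN := hN) hα hM (f := f)
    (Or.inr fun x y hxy => by
      refine min_le_min_right _ (max_le_max_right _ ?_)
      linarith) hfc hf1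
  have hz : ∀ᶠ i : Σ k, Ω k in superexpFilter P _ hN, ∫ x, f x ∂esd (A i.1 i.2) = 0 := by
    filter_upwards [eventually_superexpFilter_fst (eventually_nonempty hN hα hM)] with i hi
    have : Nonempty (Fin (M i.1)) := ⟨⟨0, hi.1⟩⟩
    rw [esd_eq]
    refine integral_eq_zero_of_ae ((ae_empiricalMeasure _ _).2 fun j => ?_)
    have := gramEig_nonneg (A i.1 i.2) j
    simp [f, this]
  have h0 : ∫ x, f x ∂F = 0 :=
    tendsto_nhds_unique ht (tendsto_const_nhds.congr' (hz.mono fun i hi => hi.symm))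
  have hfi : Integrable f F := Integrable.of_bound hfc.aestronglyMeasurable 1 (ae_of_all _ hf1)
  filter_upwards [(integral_eq_zero_iff_of_nonneg hf0 hfi).1 h0] with x hx
  by_contra hneg
  rw [not_le] at hneg
  have : 0 < f x := lt_min (lt_max_of_lt_left (by linarith)) one_pos
  exact this.ne' hx

/-- If a truncated mean of the limit exceeded 2, the empirical mean would exceed 2 with probability
at least 3/4, whereas Markov allows 1/2. Monotone convergence then removes the truncation. -/
theorem SpectrumConverges.integrable_id
    (hN : Tendsto (fun k => (Fintype.card (n k) : ℝ)) atTop atTop)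
    (hF : SpectrumConverges P A (fun k => (Fintype.card (n k) : ℝ)) F) (hα : 0 < α) (hα1 : α ≤ 1)
    (hM : ∀ k, (M k : ℝ) = α * Fintype.card (n k)) (hnorm : ∀ k, IsNormalized α (P k) (A k)) :
    Integrable (fun x => x) F := by
  have hF0 := hF.ae_nonneg hN hα hM
  let f : ℕ → ℝ → ℝ := fun K x => min (max x 0) K
  have hf0 : ∀ K x, 0 ≤ f K x := fun K x => le_min (le_max_right _ _) (Nat.cast_nonneg _)
  have hf1 : ∀ K x, |f K x| ≤ K := fun K x => by
    rw [abs_of_nonneg (hf0 K x)]; exact min_le_right _ _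
  have hfc : ∀ K, Continuous (f K) := fun K => by fun_prop
  have hfi : ∀ K, Integrable (f K) F := fun K =>
    Integrable.of_bound (hfc K).aestronglyMeasurable K (ae_of_all _ (hf1 K))
  have hle : ∀ K, ∫ x, f K x ∂mixZero α F ≤ 2 := by
    intro K
    by_contra hlt
    rw [not_le] at hlt
    have ht := hF.tendsto_integral (hN := hN) hα hα1 hM (f := f K)
      (Or.inl fun x y hxy => min_le_min_right _ (max_le_max_right _ hxy)) (hfc K) (hf1 K)
    obtain ⟨k, hk1, hk2⟩ := ((superexpFilter_measure_le (ht.eventually_const_lt hlt)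
      (ε := 1 / 4) (by norm_num)).and (eventually_nonempty hN hα hM)).exists
    have : Nonempty (n k) := hk2.2
    have h2 := (hnorm k).mean_colEig_ge hα (hM k) (t := 2) two_pos
    have hcover : (Set.univ : Set (Ω k)) ⊆
        {ω | ¬ 2 < ∫ x, f K x ∂empiricalMeasure (colEig (A k ω))} ∪
        {ω | 2 ≤ ∫ x, x ∂empiricalMeasure (colEig (A k ω))} := by
      intro ω _
      by_cases hω : 2 < ∫ x, f K x ∂empiricalMeasure (colEig (A k ω))
      · refine Or.inr (hω.le.trans ?_)
        refine integral_mono_ae (integrable_empiricalMeasure _ _) (integrable_empiricalMeasure _ _)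
          ((ae_empiricalMeasure _ _).2 fun i => ?_)
        exact (min_le_left _ _).trans (max_eq_left (colEig_nonneg (A k ω) i)).le
      · exact Or.inl hω
    have h3 := (measureReal_mono (μ := P k) hcover).trans (measureReal_union_le _ _)
    rw [probReal_univ] at h3
    linarith
  have hle' : ∀ K, ∫ x, f K x ∂F ≤ 2 / α := by
    intro K
    have := hle K
    rw [integral_mixZero hα.le hα1 (hfi K)] at this
    have h0 : f K 0 = 0 := by simp [f]
    rw [h0, mul_zero, zero_add] at this
    rw [le_div_iff₀ hα]
    linarith
  refine ⟨Measurable.aestronglyMeasurable measurable_id, ?_⟩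
  rw [hasFiniteIntegral_iff_ofReal hF0]
  have hsup : ∀ x : ℝ, ENNReal.ofReal x ≤ ⨆ K, ENNReal.ofReal (f K x) := by
    intro x
    obtain ⟨K, hK⟩ := exists_nat_ge (max x 0)
    refine le_iSup_of_le K (ENNReal.ofReal_le_ofReal ?_)
    exact le_min (le_max_left _ _) ((le_max_left _ _).trans hK)
  calc ∫⁻ x, ENNReal.ofReal x ∂F ≤ ∫⁻ x, ⨆ K, ENNReal.ofReal (f K x) ∂F := lintegral_mono hsup
    _ = ⨆ K, ∫⁻ x, ENNReal.ofReal (f K x) ∂F := by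
        refine lintegral_iSup (fun K => (hfc K).measurable.ennreal_ofReal) ?_
        intro K K' hKK' x
        exact ENNReal.ofReal_le_ofReal (min_le_min_left _ (by exact_mod_cast hKK'))
    _ ≤ ENNReal.ofReal (2 / α) := by
        refine iSup_le fun K => ?_
        rw [← ofReal_integral_eq_lintegral_ofReal (hfi K) (ae_of_all _ (hf0 K))]
        exact ENNReal.ofReal_le_ofReal (hle' K)
    _ < ∞ := ENNReal.ofReal_lt_top

omit [IsProbabilityMeasure F] in
/-- With overwhelming probability, the spectrum stays in the region in which the logarithm in the
potential is defined. -/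
theorem eventually_le_add_colEig (hα : 0 < α) (hα1 : α ≤ 1)
    (hM : ∀ k, (M k : ℝ) = α * Fintype.card (n k))
    (hedge : α = 1 → NoLowOutliers P A (fun k => (Fintype.card (n k) : ℝ)) F)
    {s ε : ℝ} (hε : 0 < ε) (h : ∀ᵐ x ∂mixZero α F, ε ≤ s + x) :
    ∀ᶠ i : Σ k, Ω k in superexpFilter P _ hN, ∀ j, ε / 2 ≤ s + colEig (A i.1 i.2) j := by
  rcases hα1.lt_or_eq with h1 | h1
  -- The atom at zero already forces s ≥ ε, so no control of outliers is needed.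
  · have h0 := ((ae_mixZero hα _).1 h).1 h1
    refine Eventually.of_forall fun i j => ?_
    have := colEig_nonneg (A i.1 i.2) j
    linarith
  · subst h1
    rw [mixZero_one] at h
    have hFz : F (Set.Iio (ε - s)) = 0 := by
      rw [← compl_mem_ae_iff]
      filter_upwards [h] with x hx
      simp only [Set.mem_compl_iff, Set.mem_Iio, not_lt]
      linarith
    intro C
    filter_upwards [hedge rfl (ε - s) (ε / 2 - s) (by linarith) hFz C] with k hk
    refine (measureReal_mono ?_).trans hk
    intro ω hω
    simp only [Set.mem_ofPred_eq, not_forall, not_le] at hω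
    obtain ⟨j, hj⟩ := hω
    by_contra hno
    simp only [Set.mem_ofPred_eq, not_exists, not_lt] at hno
    have hMk : M k = Fintype.card (n k) := by
      have := hM k
      rw [one_mul] at this
      exact_mod_cast this
    -- For square matrices the two spectra coincide; counting eigenvalues below the threshold
    -- transfers the absence of outliers.
    have hsum := sum_colEig (A k ω) hMk.le (fun x => if x < ε / 2 - s then (1 : ℝ) else 0)
    have hz : (Fintype.card (n k) : ℝ) - M k = 0 := by rw [hM, one_mul, sub_self]
    rw [hz, zero_mul, add_zero,
      Finset.sum_eq_zero (s := (Finset.univ : Finset (Fin (M k))))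
        (fun i _ => if_neg (hno i).not_gt)] at hsum
    have := (Finset.sum_eq_zero_iff_of_nonneg (fun i _ => by positivity)).1 hsum j
      (Finset.mem_univ j)
    rw [if_pos (by linarith)] at this
    exact one_ne_zero this

end SpectralConvergence

/-! ### Upper bound for the growth rate -/

section UpperBound

theorem integral_empiricalMeasure_comp {n : Type*} [Fintype n] [Nonempty n] (d : n → ℝ)
    (f g : ℝ → ℝ) :
    ∫ x, f x ∂empiricalMeasure (fun i => g (d i)) = ∫ x, f (g x) ∂empiricalMeasure d := by
  rw [integral_empiricalMeasure, integral_empiricalMeasure]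

theorem sphericalIntegral_gram_le_one {m n : Type*} [Fintype m] [Fintype n] (A : Matrix m n ℝ)
    {s : ℝ} (hs : 0 ≤ s) : sphericalIntegral (s • (Aᵀ * A)) ≤ 1 := by
  refine sphericalIntegral_le_one fun g => ?_
  rw [Matrix.smul_mulVec, dotProduct_smul, smul_eq_mul, ← Matrix.mulVec_mulVec,
    Matrix.dotProduct_mulVec, Matrix.vecMul_transpose]
  exact mul_nonneg hs (dotProduct_self_nonneg_real _)

theorem sphericalIntegral_gram_le {m n : Type*} [Fintype m] [Fintype n] [DecidableEq n] [Nonempty n]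
    (η : Measure (Matrix.orthogonalGroup n ℝ)) [η.IsMulLeftInvariant] [IsProbabilityMeasure η]
    (A : Matrix m n ℝ) {c p : ℝ} (hc : 0 < c) (hp : 0 < p) {Λ : ℝ}
    (h : ∀ i, 0 < Λ * c + colEig A i) :
    sphericalIntegral ((p / c) • (Aᵀ * A)) ≤ ENNReal.ofReal (Real.exp (Fintype.card n / 2 *
      (potential c p (empiricalMeasure (colEig A)) Λ - 1 - Real.log (p / c)))) := by
  have hθ : 0 < p / c := div_pos hp hc
  have he : ∀ i, Λ * p + p / c * colEig A i = p / c * (Λ * c + colEig A i) := fun i => by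
    field_simp
  rw [sphericalIntegral_smul_transpose_mul_self]
  refine (sphericalIntegral_diagonal_le η _ (z := Λ * p) fun i => ?_).trans_eq ?_
  · rw [he]; exact mul_pos hθ (h i)
  · have hl : ∀ i, Real.log (Λ * p + p / c * colEig A i) =
        Real.log (p / c) + Real.log (Λ * c + colEig A i) := fun i => by
      rw [he, Real.log_mul hθ.ne' (h i).ne']
    simp only [hl, Finset.sum_add_distrib, Finset.sum_const, Finset.card_univ, nsmul_eq_mul]
    rw [sum_log_eq_integral_empiricalMeasure (colEig A) (fun x => Real.log (Λ * c + x)), potential]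
    congr 2
    ring

theorem exists_truncation_le {G : Measure ℝ} {f : ℝ → ℝ}
    (hf : Integrable f G) {δ : ℝ} (hδ : 0 < δ) :
    ∃ K₀ : ℕ, ∀ K ≥ K₀, ∫ x, f x ∂G - δ ≤ ∫ x, min (f x) (K : ℕ) ∂G := by
  have hlim : Tendsto (fun K : ℕ => ∫ x, min (f x) (K : ℝ) ∂G) atTop (𝓝 (∫ x, f x ∂G)) := by
    refine tendsto_integral_of_dominated_convergence (fun x => |f x|)
      (fun K => (hf.1.inf aestronglyMeasurable_const)) hf.abs
      (fun K => ae_of_all _ fun x => ?_) (ae_of_all _ fun x => ?_)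
    · have hK : (0 : ℝ) ≤ K := Nat.cast_nonneg K
      rw [Real.norm_eq_abs]
      rcases le_total (f x) K with h | h
      · rw [min_eq_left h]
      · rw [min_eq_right h, abs_of_nonneg hK]; exact h.trans (le_abs_self _)
    · obtain ⟨K, hK⟩ := exists_nat_ge (f x)
      refine tendsto_const_nhds.congr' ?_
      filter_upwards [eventually_ge_atTop K] with K' hK'
      rw [min_eq_left (hK.trans (by exact_mod_cast hK'))]
  obtain ⟨K₀, h⟩ := eventually_atTop.1 (hlim.eventually_const_lt (sub_lt_self _ hδ))
  exact ⟨K₀, fun K hK => (h K hK).le⟩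

/-- Cutting the logarithm off at both ends makes it an admissible bounded monotone test function. -/
theorem truncatedLog_properties {e : ℝ} (he : 0 < e) {g : ℝ → ℝ} (hg : Monotone g)
    (hgc : Continuous g) (K : ℕ) :
    Monotone (fun x => min (Real.log (max (g x) e)) (K : ℝ)) ∧
    Continuous (fun x => min (Real.log (max (g x) e)) (K : ℝ)) ∧
    ∀ x, |min (Real.log (max (g x) e)) (K : ℝ)| ≤ |Real.log e| + K := by
  have hpos : ∀ x, 0 < max (g x) e := fun x => lt_max_of_lt_right he
  refine ⟨fun x y hxy => min_le_min_right _ (Real.log_le_log (hpos x) (max_le_max_right _ (hg hxy))),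
    ((hgc.max continuous_const).log fun x => (hpos x).ne').min continuous_const, fun x => ?_⟩
  have hK : (0 : ℝ) ≤ K := Nat.cast_nonneg K
  have h1 := Real.log_le_log he (le_max_right (g x) e)
  have h2 := neg_abs_le (Real.log e)
  have h3 := abs_nonneg (Real.log e)
  rw [abs_le]
  constructor
  · exact le_min (by linarith) (by linarith)
  · exact (min_le_right _ _).trans (by linarith)

/-- Off S only the trivial bound 1 is used. The measurable hull of the complement is taken because S
need not be measurable. -/
theorem lintegral_le_of_superexp {Ω : Type*} [MeasurableSpace Ω] {P : Measure Ω}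
    [IsProbabilityMeasure P] {J : Ω → ℝ≥0∞} (hJ1 : ∀ ω, J ω ≤ 1) {S : Set Ω} {b r : ℝ}
    (hJS : ∀ ω ∈ S, J ω ≤ ENNReal.ofReal b) (hS : P.real Sᶜ ≤ r) :
    ∫⁻ ω, J ω ∂P ≤ ENNReal.ofReal b + ENNReal.ofReal r := by
  set T := toMeasurable P Sᶜ
  have hpt : ∀ ω, J ω ≤ ENNReal.ofReal b + T.indicator 1 ω := by
    intro ω
    by_cases hω : ω ∈ S
    · exact (hJS ω hω).trans le_self_add
    · rw [Set.indicator_of_mem (subset_toMeasurable _ _ hω)]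
      exact (hJ1 ω).trans le_add_self
  refine (lintegral_mono hpt).trans ?_
  rw [lintegral_add_left measurable_const, lintegral_indicator_one (measurableSet_toMeasurable _ _),
    measure_toMeasurable]
  simp only [lintegral_const, measure_univ, mul_one]
  gcongr
  rw [← ENNReal.ofReal_toReal (measure_ne_top P Sᶜ)]
  exact ENNReal.ofReal_le_ofReal hS

variable {Ω : ℕ → Type*} [∀ k, MeasurableSpace (Ω k)] {P : ∀ k, Measure (Ω k)}
  [∀ k, IsProbabilityMeasure (P k)] {M : ℕ → ℕ} {n : ℕ → Type*} [∀ k, Fintype (n k)]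
  [∀ k, DecidableEq (n k)] {A : ∀ k, Ω k → Matrix (Fin (M k)) (n k) ℝ} {α : ℝ}
  {F : Measure ℝ} [IsProbabilityMeasure F]

/-- The exponential growth rate of the expected spherical integral is at most the value of the
potential at any admissible point. -/
theorem eventually_lintegral_sphericalIntegral_le
    (hN : Tendsto (fun k => (Fintype.card (n k) : ℝ)) atTop atTop)
    (hF : SpectrumConverges P A (fun k => (Fintype.card (n k) : ℝ)) F) (hα : 0 < α) (hα1 : α ≤ 1)
    (hM : ∀ k, (M k : ℝ) = α * Fintype.card (n k)) (hnorm : ∀ k, IsNormalized α (P k) (A k))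
    (hrot : ∀ k, IsRotationallyInvariant (P k) (A k))
    (hedge : α = 1 → NoLowOutliers P A (fun k => (Fintype.card (n k) : ℝ)) F)
    {c p : ℝ} (hc : 0 < c) (hp : 0 < p) {Λ : ℝ} (hΛ : Λ ∈ potentialDomain c (mixZero α F))
    {δ : ℝ} (hδ : 0 < δ) :
    ∀ᶠ k in atTop, ∫⁻ ω, sphericalIntegral ((p / c) • ((A k ω)ᵀ * A k ω)) ∂P k ≤
      ENNReal.ofReal (Real.exp (Fintype.card (n k) / 2 *
        (potential c p (mixZero α F) Λ - 1 - Real.log (p / c) + δ))) := by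
  have hGp := isProbabilityMeasure_mixZero (F := F) hα.le hα1
  have hGi := integrable_mixZero (α := α) (hF.integrable_id hN hα hα1 hM hnorm)
  have hlog := integrable_log_potential hGi hΛ
  obtain ⟨ε, hε, hεG⟩ := hΛ
  -- One quarter of δ pays for the truncation and one for the convergence; the remaining half
  -- absorbs a factor 2 at the end.
  obtain ⟨K, hK⟩ := exists_truncation_le hlog (δ := δ / 4) (by positivity)
  have hK := hK K le_rfl
  obtain ⟨h1, h2, h3⟩ := truncatedLog_properties (half_pos hε) (g := fun x => Λ * c + x)
    (fun x y hxy => by linarith) (by fun_prop) K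
  have ht := hF.tendsto_integral (hN := hN) hα hα1 hM (Or.inl h1) h2 h3
  have hGeq : ∫ x, min (Real.log (max (Λ * c + x) (ε / 2))) (K : ℝ) ∂mixZero α F =
      ∫ x, min (Real.log (Λ * c + x)) (K : ℝ) ∂mixZero α F := by
    refine integral_congr_ae ?_
    filter_upwards [hεG] with x hx
    rw [max_eq_left (by linarith)]
  rw [hGeq] at ht
  have hev := (ht.eventually_const_lt (sub_lt_self _ (by positivity : 0 < δ / 4))).and
    (eventually_le_add_colEig (P := P) (A := A) (hN := hN) hα hα1 hM hedge hε hεG)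
  set B := 1 / 2 * (potential c p (mixZero α F) Λ - 1 - Real.log (p / c) + δ / 2) with hB
  -- Membership in the filter is a statement for every rate. The rate -B makes the bad event as
  -- unlikely as the main term exp(BN).
  filter_upwards [hev (-B), eventually_nonempty hN hα hM,
    hN.eventually_ge_atTop (4 * Real.log 2 / δ)] with k hk hne hlarge
  obtain ⟨η, hη, hη1⟩ := (hrot k).exists_haar
  have : Nonempty (n k) := hne.2
  set N : ℝ := (Fintype.card (n k) : ℝ)
  rw [neg_neg] at hk
  refine (lintegral_le_of_superexp (b := Real.exp (B * N))
    (fun ω => sphericalIntegral_gram_le_one (A k ω) (div_pos hp hc).le)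
    ?_ hk).trans ?_
  · intro ω hω
    obtain ⟨hω1, hω2⟩ := hω
    have hpos : ∀ i, 0 < Λ * c + colEig (A k ω) i := fun i => (half_pos hε).trans_le (hω2 i)
    refine (sphericalIntegral_gram_le η (A k ω) hc hp hpos).trans ?_
    refine ENNReal.ofReal_le_ofReal (Real.exp_le_exp.2 ?_)
    have hle : ∫ x, min (Real.log (max (Λ * c + x) (ε / 2))) (K : ℝ)
        ∂empiricalMeasure (colEig (A k ω)) ≤
        ∫ x, Real.log (Λ * c + x) ∂empiricalMeasure (colEig (A k ω)) := by
      refine integral_mono_ae (integrable_empiricalMeasure _ _) (integrable_empiricalMeasure _ _)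
        ((ae_empiricalMeasure _ _).2 fun i => ?_)
      beta_reduce
      rw [max_eq_left (hω2 i)]
      exact min_le_left _ _
    have hfin : potential c p (empiricalMeasure (colEig (A k ω))) Λ ≤
        potential c p (mixZero α F) Λ + δ / 2 := by
      unfold potential
      linarith
    calc N / 2 * (potential c p (empiricalMeasure (colEig (A k ω))) Λ - 1 - Real.log (p / c))
        ≤ N / 2 * (potential c p (mixZero α F) Λ + δ / 2 - 1 - Real.log (p / c)) := by gcongr
      _ = B * N := by rw [hB]; ring
  · rw [← ENNReal.ofReal_add (Real.exp_pos _).le (Real.exp_pos _).le]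
    refine ENNReal.ofReal_le_ofReal ?_
    have hle : Real.log 2 + B * N ≤
        N / 2 * (potential c p (mixZero α F) Λ - 1 - Real.log (p / c) + δ) := by
      rw [div_le_iff₀ hδ] at hlarge
      rw [hB]
      nlinarith
    refine le_trans ?_ (Real.exp_le_exp.2 hle)
    rw [Real.exp_add, Real.exp_log two_pos, two_mul]

end UpperBound

/-! ### Lower bound for the growth rate -/

section LowerBound

theorem empiricalMeasure_real_zero {n : Type*} [Fintype n] [Nonempty n] (d : n → ℝ)
    {f g : ℝ → ℝ} (h : ∀ i, f (d i) ≤ ({0} : Set ℝ).indicator 1 (g (d i))) :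
    ∫ x, f x ∂empiricalMeasure d ≤ (empiricalMeasure fun i => g (d i)).real {0} := by
  rw [← integral_indicator_one (measurableSet_singleton 0), integral_empiricalMeasure_comp]
  exact integral_mono_ae (integrable_empiricalMeasure _ _) (integrable_empiricalMeasure _ _)
    ((ae_empiricalMeasure _ _).2 h)

/-- If a positive fraction of the eigenvalues vanishes, the saddle point value of the spherical
integral is sharp up to a constant. -/
theorem exists_le_sphericalIntegral_gram {κ : ℝ} (hκ : 0 < κ) {c p : ℝ} (hc : 0 < c) (hp : 0 < p) :
    ∃ C > 0, ∃ N₀ : ℕ, ∀ {M : ℕ} {n : Type*} [Fintype n] [DecidableEq n] [Nonempty n],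
      N₀ ≤ Fintype.card n → ∀ A : Matrix (Fin M) n ℝ,
      κ ≤ (empiricalMeasure (colEig A)).real {0} →
      ∃ Λ > 0, ENNReal.ofReal (C * Real.exp (Fintype.card n / 2 *
          (potential c p (empiricalMeasure (colEig A)) Λ - 1 - Real.log (p / c)))) ≤
        sphericalIntegral ((p / c) • (Aᵀ * A)) := by
  obtain ⟨C, hC, N₀, h⟩ := exists_le_sphericalIntegral_of_atom hκ
  refine ⟨C, hC, N₀, ?_⟩
  intro M n _ _ _ hcard A hatom
  have hθ : 0 < p / c := div_pos hp hc
  have hatom' : κ ≤ (empiricalMeasure fun i => p / c * colEig A i).real {0} := by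
    refine hatom.trans ?_
    rw [← integral_indicator_one (measurableSet_singleton 0)]
    refine empiricalMeasure_real_zero (colEig A) (g := fun x => p / c * x) fun i => ?_
    by_cases h0 : colEig A i = 0
    · simp [h0]
    · simp [h0, hθ.ne']
  obtain ⟨w, hw1, -, hw⟩ := h hcard (fun i => p / c * colEig A i)
    (fun i => mul_nonneg hθ.le (colEig_nonneg A i)) hatom'
  have hw0 : 0 < w := hκ.trans_le hw1
  refine ⟨w / p, div_pos hw0 hp, ?_⟩
  rw [sphericalIntegral_smul_transpose_mul_self]
  refine le_of_eq_of_le ?_ hw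
  have hl : ∀ᵐ x ∂empiricalMeasure (colEig A), Real.log (w + p / c * x) =
      Real.log (p / c) + Real.log (w / p * c + x) := by
    refine (ae_empiricalMeasure _ _).2 fun i => ?_
    have : 0 < w / p * c + colEig A i :=
      add_pos_of_pos_of_nonneg (by positivity) (colEig_nonneg A i)
    rw [← Real.log_mul hθ.ne' this.ne']
    congr 1
    field_simp
  rw [integral_empiricalMeasure_comp (colEig A) (fun x => Real.log (w + x)), integral_congr_ae hl,
    integral_add (integrable_const _) (integrable_empiricalMeasure _ _), potential]
  simp only [integral_const, probReal_univ, smul_eq_mul, one_mul]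
  congr 4
  field_simp
  ring

/-- Raising eigenvalues by at most s raises the Rayleigh quotient by at most s. -/
theorem sphericalIntegral_diagonal_shift {n : Type*} [Fintype n] [DecidableEq n] {a b : n → ℝ}
    {s : ℝ} (hs : 0 ≤ s) (h : ∀ i, a i ≤ b i + s) :
    ENNReal.ofReal (Real.exp (-(1 / 2) * (Fintype.card n * s))) *
      sphericalIntegral (Matrix.diagonal b) ≤ sphericalIntegral (Matrix.diagonal a) := by
  unfold sphericalIntegral
  rw [← lintegral_const_mul' _ _ ENNReal.ofReal_ne_top]
  refine lintegral_mono fun g => ?_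
  rw [← ENNReal.ofReal_mul (Real.exp_pos _).le, ← Real.exp_add]
  refine ENNReal.ofReal_le_ofReal (Real.exp_le_exp.2 ?_)
  rw [← mul_add, ← mul_add]
  have hq : g ⬝ᵥ Matrix.diagonal a *ᵥ g / g ⬝ᵥ g ≤
      s + g ⬝ᵥ Matrix.diagonal b *ᵥ g / g ⬝ᵥ g := by
    rcases (dotProduct_self_nonneg_real g).eq_or_lt with h0 | h0
    -- At g = 0 both quotients are 0 by the division convention, so s ≥ 0 suffices.
    · rw [← h0]; simpa using hs
    · rw [div_le_iff₀ h0, add_mul, div_mul_cancel₀ _ h0.ne', dotProduct_diagonal_mulVec,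
        dotProduct_diagonal_mulVec, dotProduct_self_eq_sum_sq, Finset.mul_sum,
        ← Finset.sum_add_distrib]
      refine Finset.sum_le_sum fun i _ => ?_
      have := mul_le_mul_of_nonneg_right (h i) (sq_nonneg (g i))
      linarith
  have := mul_le_mul_of_nonneg_left hq (Nat.cast_nonneg (α := ℝ) (Fintype.card n))
  linarith

/-- The first multiple of δ that fails to be an essential lower bound; its predecessor still is one.
-/
theorem exists_approx_essInf {G : Measure ℝ} [IsProbabilityMeasure G] (hG : ∀ᵐ x ∂G, 0 ≤ x) {δ : ℝ}
    (hδ : 0 < δ) : ∃ a, 0 ≤ a ∧ (∀ᵐ x ∂G, a ≤ x) ∧ ¬ ∀ᵐ x ∂G, a + δ ≤ x := by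
  have hex : ∃ j : ℕ, ¬ ∀ᵐ x ∂G, j * δ ≤ x := by
    by_contra hall
    push Not at hall
    have hall' := ae_all_iff.2 hall
    obtain ⟨x, hx⟩ := hall'.exists
    obtain ⟨j, hj⟩ := exists_nat_gt (x / δ)
    rw [div_lt_iff₀ hδ] at hj
    exact (hx j).not_gt hj
  classical
  obtain ⟨j, hj⟩ : ∃ j, Nat.find hex = j + 1 := Nat.exists_eq_succ_of_ne_zero fun h0 => by
    have := Nat.find_spec hex
    rw [h0] at this
    simp only [Nat.cast_zero, zero_mul] at this
    exact this hG
  refine ⟨j * δ, by positivity, ?_, ?_⟩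
  · have := Nat.find_min hex (m := j) (by omega)
    exact not_not.1 this
  · have := Nat.find_spec hex
    rw [hj] at this
    push_cast at this
    rwa [add_mul, one_mul] at this

theorem le_lintegral_of_prob {Ω : Type*} [MeasurableSpace Ω] {P : Measure Ω}
    [IsProbabilityMeasure P] {J : Ω → ℝ≥0∞} {S : Set Ω} {b : ℝ} (hb : 0 ≤ b)
    (hJS : ∀ ω ∈ S, ENNReal.ofReal b ≤ J ω) (hS : P.real Sᶜ ≤ 1 / 2) :
    ENNReal.ofReal (b / 2) ≤ ∫⁻ ω, J ω ∂P := by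
  set T := (toMeasurable P Sᶜ)ᶜ with hT
  have hTm : MeasurableSet T := (measurableSet_toMeasurable _ _).compl
  have hTS : T ⊆ S := by
    rw [hT, Set.compl_subset_comm]
    exact subset_toMeasurable _ _
  have hPT : 1 / 2 ≤ P.real T := by
    rw [hT, probReal_compl_eq_one_sub (measurableSet_toMeasurable _ _), measureReal_def,
      measure_toMeasurable, ← measureReal_def]
    linarith
  calc ENNReal.ofReal (b / 2) ≤ ENNReal.ofReal (b * P.real T) := by
        refine ENNReal.ofReal_le_ofReal ?_
        rw [div_eq_mul_one_div]
        gcongr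
    _ = ∫⁻ _ω in T, ENNReal.ofReal b ∂P := by
        rw [setLIntegral_const, ENNReal.ofReal_mul hb, ofReal_measureReal]
    _ ≤ ∫⁻ ω in T, J ω ∂P := setLIntegral_mono' hTm fun ω hω => hJS ω (hTS hω)
    _ ≤ _ := setLIntegral_le_lintegral _ _

/-- Where ln y exceeds K, apply ln t ≤ t - 1 to t = exp(-K)y. The excess is thus controlled by the
first moment. -/
theorem log_le_min_add {y : ℝ} (hy : 0 < y) (K : ℝ) :
    Real.log y ≤ min (Real.log y) K + Real.exp (-K) * y := by
  rcases le_total (Real.log y) K with h | h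
  · rw [min_eq_left h]
    have := mul_pos (Real.exp_pos (-K)) hy
    linarith
  · rw [min_eq_right h]
    have h1 := Real.log_le_sub_one_of_pos (mul_pos (Real.exp_pos (-K)) hy)
    rw [Real.log_mul (Real.exp_pos _).ne' hy.ne', Real.log_exp] at h1
    linarith

/-- Comparison of the saddle point value for the empirical measure `E` with a reference value,
in terms of finitely many test functions of `E`. -/
theorem saddle_value_ge {E : Measure ℝ} [IsProbabilityMeasure E] (hE : ∀ f : ℝ → ℝ, Integrable f E)
    (hE0 : ∀ᵐ x ∂E, 0 ≤ x) {ξ : ℝ → ℝ} (hξ0 : ∀ x, 0 ≤ ξ x) {θ : ℝ} (hθ : 0 < θ)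
    (hξ : ∀ x, 0 ≤ x → ξ x ≤ θ * x) {w w₀ η K I : ℝ} (hw : 0 < w) (hw1 : w ≤ 1) (hw₀ : 0 < w₀)
    (hw₀1 : w₀ ≤ 1) (hmean : ∫ x, x ∂E ≤ 4) (hK : Real.exp (-K) * (1 + 4 * θ) ≤ η)
    (hinv : |∫ x, (w₀ + ξ x)⁻¹ ∂E - 1| ≤ η)
    (hlog : ∫ x, min (Real.log (w₀ + ξ x)) K ∂E ≤ I + η) :
    w₀ - I - 3 * η ≤ w - ∫ x, Real.log (w + ξ x) ∂E := by
  -- Tangent at w₀, the saddle of the limit law, evaluated at the random saddle w. No convergence of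
  -- w to w₀ is needed: |w - w₀| ≤ 1 and near stationarity at w₀ cost one η. The log tail and the
  -- convergence of the truncated log cost the other two.
  have h1 : ∫ x, Real.log (w + ξ x) ∂E ≤
      ∫ x, Real.log (w₀ + ξ x) ∂E + (w - w₀) * ∫ x, (w₀ + ξ x)⁻¹ ∂E := by
    rw [← integral_const_mul, ← integral_add (hE _) (hE _)]
    refine integral_mono (hE _) (hE _) fun x => ?_
    have := log_le_log_add_tangent (add_pos_of_pos_of_nonneg hw (hξ0 x))
      (add_pos_of_pos_of_nonneg hw₀ (hξ0 x))
    rwa [add_sub_add_right_eq_sub] at this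
  have h2 : ∫ x, Real.log (w₀ + ξ x) ∂E ≤
      ∫ x, min (Real.log (w₀ + ξ x)) K ∂E + Real.exp (-K) * (1 + θ * ∫ x, x ∂E) := by
    have e : Real.exp (-K) * (1 + θ * ∫ x, x ∂E) = ∫ x, Real.exp (-K) * (1 + θ * x) ∂E := by
      rw [integral_const_mul, integral_add (integrable_const _) (hE _), integral_const_mul]
      simp
    rw [e, ← integral_add (hE _) (hE _)]
    refine integral_mono_ae (hE _) (hE _) ?_
    filter_upwards [hE0] with x hx
    refine (log_le_min_add (add_pos_of_pos_of_nonneg hw₀ (hξ0 x)) K).trans ?_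
    have := hξ x hx
    gcongr
  have h3 : Real.exp (-K) * (1 + θ * ∫ x, x ∂E) ≤ η := by
    refine le_trans ?_ hK
    have := mul_le_mul_of_nonneg_left hmean hθ.le
    refine mul_le_mul_of_nonneg_left ?_ (Real.exp_pos _).le
    linarith
  have h4 : -η ≤ (w - w₀) * (1 - ∫ x, (w₀ + ξ x)⁻¹ ∂E) := by
    have hη : 0 ≤ η := (abs_nonneg _).trans hinv
    have h5 : |(w - w₀) * (1 - ∫ x, (w₀ + ξ x)⁻¹ ∂E)| ≤ 1 * η := by
      rw [abs_mul]
      refine mul_le_mul ?_ ?_ (abs_nonneg _) zero_le_one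
      · rw [abs_le]; constructor <;> linarith
      · rwa [abs_sub_comm]
    have := (abs_le.1 h5).1
    linarith
  nlinarith

variable {Ω : ℕ → Type*} [∀ k, MeasurableSpace (Ω k)] {P : ∀ k, Measure (Ω k)}
  [∀ k, IsProbabilityMeasure (P k)] {M : ℕ → ℕ} {n : ℕ → Type*} [∀ k, Fintype (n k)]
  [∀ k, DecidableEq (n k)] {A : ∀ k, Ω k → Matrix (Fin (M k)) (n k) ℝ} {α : ℝ}
  {F : Measure ℝ} [IsProbabilityMeasure F]

/-- The exponential growth rate of the expected spherical integral is at least the infimum of the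
potential. -/
theorem eventually_le_lintegral_sphericalIntegral
    (hN : Tendsto (fun k => (Fintype.card (n k) : ℝ)) atTop atTop)
    (hF : SpectrumConverges P A (fun k => (Fintype.card (n k) : ℝ)) F) (hα : 0 < α) (hα1 : α ≤ 1)
    (hM : ∀ k, (M k : ℝ) = α * Fintype.card (n k)) (hnorm : ∀ k, IsNormalized α (P k) (A k))
    {c p : ℝ} (hc : 0 < c) (hp : 0 < p) {δ : ℝ} (hδ : 0 < δ) :
    ∃ Λ ∈ potentialDomain c (mixZero α F), ∀ᶠ k in atTop,
      ENNReal.ofReal (Real.exp (Fintype.card (n k) / 2 *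
        (potential c p (mixZero α F) Λ - 1 - Real.log (p / c) - δ))) ≤
      ∫⁻ ω, sphericalIntegral ((p / c) • ((A k ω)ᵀ * A k ω)) ∂P k := by
  have hGp := isProbabilityMeasure_mixZero (F := F) hα.le hα1
  have hGi := integrable_mixZero (α := α) (hF.integrable_id hN hα hα1 hM hnorm)
  have hG0 : ∀ᵐ x ∂mixZero α F, 0 ≤ x :=
    (ae_mixZero hα _).2 ⟨fun _ => le_rfl, hF.ae_nonneg hN hα hM⟩
  set G := mixZero α F with hG
  set θ := p / c with hθdef
  have hθ : 0 < θ := div_pos hp hc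
  set δ₁ := δ / (8 * θ) with hδ₁def
  have hδ₁ : 0 < δ₁ := by positivity
  have hθδ : θ * δ₁ = δ / 8 := by rw [hδ₁def]; field_simp
  set η := δ / 16 with hη
  have hη0 : 0 < η := by positivity
  -- The level a₀ bounds the spectrum from below and keeps Λ admissible, while the cut at a = a₀ +
  -- δ₁ captures positive mass. The gap costs θδ₁ = δ/8.
  obtain ⟨a₀, ha₀, hlow, hnot⟩ := exists_approx_essInf hG0 hδ₁
  set a := a₀ + δ₁ with ha
  -- the truncated spectral variable
  let ξ : ℝ → ℝ := fun x => θ * (max x a - a)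
  have hξ0 : ∀ x, 0 ≤ ξ x := fun x => mul_nonneg hθ.le (sub_nonneg.2 (le_max_right _ _))
  have hξm : Monotone ξ := fun x y hxy =>
    mul_le_mul_of_nonneg_left (sub_le_sub_right (max_le_max_right _ hxy) _) hθ.le
  have hξc : Continuous ξ := by fun_prop
  have hξle : ∀ b x, b ≤ a → b ≤ x → ξ x ≤ θ * (x - b) := fun b x hba hbx =>
    mul_le_mul_of_nonneg_left (by
      rcases max_cases x a with ⟨h, _⟩ | ⟨h, _⟩ <;> rw [h] <;> linarith) hθ.le
  -- a positive fraction of the spectrum lies below `a`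
  let h : ℝ → ℝ := fun x => min (max ((a - x) / δ₁) 0) 1
  have hh0 : ∀ x, 0 ≤ h x := fun x => le_min (le_max_right _ _) zero_le_one
  have hh1 : ∀ x, |h x| ≤ 1 := fun x => by rw [abs_of_nonneg (hh0 x)]; exact min_le_right _ _
  have hhc : Continuous h := by fun_prop
  have hhm : Antitone h := fun x y hxy => min_le_min_right _ (max_le_max_right _
    (div_le_div_of_nonneg_right (by linarith) hδ₁.le))
  have hhi : Integrable h G := Integrable.of_bound hhc.aestronglyMeasurable 1 (ae_of_all _ hh1)
  have hhξ : ∀ x, h x ≤ ({0} : Set ℝ).indicator 1 (ξ x) := fun x => by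
    rcases le_total x a with hxa | hxa
    · have : ξ x = 0 := by simp [ξ, max_eq_right hxa]
      simp [this, h]
    · have : h x = 0 := by
        have : (a - x) / δ₁ ≤ 0 := div_nonpos_of_nonpos_of_nonneg (by linarith) hδ₁.le
        simp [h, max_eq_right this]
      rw [this]
      exact Set.indicator_nonneg (fun _ _ => zero_le_one) _
  have hhpos : 0 < ∫ x, h x ∂G := by
    refine lt_of_le_of_ne (integral_nonneg hh0) fun heq => hnot ?_
    filter_upwards [(integral_eq_zero_iff_of_nonneg hh0 hhi).1 heq.symm] with x hx
    by_contra hlt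
    rw [not_le] at hlt
    have : 0 < h x := lt_min (lt_max_of_lt_left (div_pos (by linarith) hδ₁)) one_pos
    exact this.ne' hx
  set κ := (∫ x, h x ∂G) / 2 with hκ
  have hκ0 : 0 < κ := half_pos hhpos
  -- the saddle point of the limiting truncated spectrum
  have hξae : AEMeasurable ξ G := hξc.aemeasurable
  have hmapp : IsProbabilityMeasure (G.map ξ) := Measure.isProbabilityMeasure_map hξae
  obtain ⟨w₀, hw₀κ, hw₀1, hw₀⟩ := exists_saddle (c := 1) (p := 1) (G := G.map ξ) one_pos one_pos
    ((ae_map_iff hξae measurableSet_Ici).2 (ae_of_all _ hξ0)) hκ0 (by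
      rw [← integral_indicator_one (measurableSet_singleton 0), integral_map hξae
        ((measurable_one.indicator (measurableSet_singleton 0)).aestronglyMeasurable)]
      have hle : ∫ x, h x ∂G ≤ ∫ x, ({0} : Set ℝ).indicator 1 (ξ x) ∂G := by
        refine integral_mono hhi ?_ hhξ
        refine Integrable.of_bound ((measurable_one.indicator
          (measurableSet_singleton 0)).comp hξc.measurable).aestronglyMeasurable 1
          (ae_of_all _ fun x => ?_)
        by_cases hx : ξ x = 0 <;> simp [hx]
      linarith)
  rw [integral_map hξae (Measurable.aestronglyMeasurable (by fun_prop))] at hw₀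
  simp only [mul_one, one_mul, div_one] at hw₀ hw₀κ hw₀1
  have hw₀0 : 0 < w₀ := hκ0.trans_le hw₀κ
  have hypos : ∀ x, 0 < w₀ + ξ x := fun x => add_pos_of_pos_of_nonneg hw₀0 (hξ0 x)
  -- the corresponding point in the domain of the potential
  set Λ := (w₀ / θ - a₀) / c with hΛ
  have hΛc : Λ * c = w₀ / θ - a₀ := by rw [hΛ]; field_simp
  have hΛmem : Λ ∈ potentialDomain c G := by
    refine ⟨w₀ / θ, by positivity, ?_⟩
    filter_upwards [hlow] with x hx
    linarith
  have hlogi := integrable_log_potential hGi hΛmem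
  -- By the choice of Λ, θ(Λc + x) = w₀ + θ(x - a₀), and flattening at a ≥ a₀ only decreases the
  -- second term.
  have hpt : ∀ᵐ x ∂G, Real.log (w₀ + ξ x) ≤ Real.log θ + Real.log (Λ * c + x) := by
    filter_upwards [hlow] with x hx
    have hpos : 0 < Λ * c + x := by
      rw [hΛc]; have : 0 < w₀ / θ := by positivity
      linarith
    rw [← Real.log_mul hθ.ne' hpos.ne']
    refine Real.log_le_log (hypos x) ?_
    have h1 := hξle a₀ x (by linarith) hx
    have h2 : θ * (Λ * c + x) = w₀ + θ * (x - a₀) := by rw [hΛc]; field_simp; ring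
    linarith
  have hlogξi : Integrable (fun x => Real.log (w₀ + ξ x)) G := by
    refine Integrable.mono' (g := fun x => |Real.log w₀| + |Real.log θ| + |Real.log (Λ * c + x)|)
      ((integrable_const _).add hlogi.abs)
      (Measurable.aestronglyMeasurable (by have := hξc.measurable; fun_prop)) ?_
    filter_upwards [hpt] with x hx
    have h1 := Real.log_le_log hw₀0 (le_add_of_nonneg_right (hξ0 x))
    rw [Real.norm_eq_abs, abs_le]
    have := neg_abs_le (Real.log w₀)
    have := le_abs_self (Real.log θ)
    have := le_abs_self (Real.log (Λ * c + x))
    have := abs_nonneg (Real.log w₀)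
    have := abs_nonneg (Real.log θ)
    have := abs_nonneg (Real.log (Λ * c + x))
    constructor <;> linarith
  set I := ∫ x, Real.log (w₀ + ξ x) ∂G with hI
  have hIle : I ≤ Real.log θ + ∫ x, Real.log (Λ * c + x) ∂G := by
    have := integral_mono_ae hlogξi ((integrable_const _).add hlogi) hpt
    rw [integral_add' (integrable_const _) hlogi] at this
    simpa using this
  -- test functions
  obtain ⟨K, hK⟩ : ∃ K : ℕ, Real.exp (-(K : ℝ)) * (1 + 4 * θ) ≤ η := by
    have h1 : Tendsto (fun K : ℕ => Real.exp (-(K : ℝ)) * (1 + 4 * θ)) atTop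
        (𝓝 (0 * (1 + 4 * θ))) :=
      (Real.tendsto_exp_neg_atTop_nhds_zero.comp tendsto_natCast_atTop_atTop).mul_const _
    rw [zero_mul] at h1
    exact (h1.eventually_le_const hη0).exists
  have hmaxeq : ∀ x, max (w₀ + ξ x) w₀ = w₀ + ξ x := fun x =>
    max_eq_left (le_add_of_nonneg_right (hξ0 x))
  obtain ⟨hl1, hl2, hl3⟩ := truncatedLog_properties hw₀0 (g := fun x => w₀ + ξ x)
    (fun x y hxy => by linarith [hξm hxy]) (by fun_prop) K
  simp only [hmaxeq] at hl1 hl2 hl3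
  have ht1 := hF.tendsto_integral (hN := hN) hα hα1 hM (Or.inr hhm) hhc hh1
  have ht2 := hF.tendsto_integral (hN := hN) hα hα1 hM (f := fun x => (w₀ + ξ x)⁻¹) (B := w₀⁻¹)
    (Or.inr fun x y hxy => inv_anti₀ (hypos x) (by linarith [hξm hxy]))
    (Continuous.inv₀ (by fun_prop) fun x => (hypos x).ne')
    (fun x => by
      rw [abs_of_pos (inv_pos.2 (hypos x))]
      exact inv_anti₀ hw₀0 (le_add_of_nonneg_right (hξ0 x)))
  have ht3 := hF.tendsto_integral (hN := hN) hα hα1 hM (Or.inl hl1) hl2 hl3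
  rw [← hG] at ht1 ht2 ht3
  rw [hw₀] at ht2
  have hmin : ∫ x, min (Real.log (w₀ + ξ x)) (K : ℝ) ∂G ≤ I :=
    integral_mono (Integrable.of_bound hl2.aestronglyMeasurable _ (ae_of_all _ hl3)) hlogξi
      fun x => min_le_left _ _
  have hev := ((ht1.eventually_const_lt (half_lt_self hhpos)).and
    ((Metric.tendsto_nhds.1 ht2 η hη0).and
      (ht3.eventually_lt_const (lt_add_of_pos_right _ hη0))))
  obtain ⟨C, hC, N₀, hS⟩ := exists_le_sphericalIntegral_of_atom hκ0
  refine ⟨Λ, hΛmem, ?_⟩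
  filter_upwards [superexpFilter_measure_le hev (ε := 1 / 4) (by norm_num),
    eventually_nonempty hN hα hM, hN.eventually_ge_atTop (N₀ : ℝ),
    hN.eventually_ge_atTop (4 * Real.log (2 / C) / δ), hN.eventually_ge_atTop 0]
    with k hk hne hk1 hk2 hk3
  have : Nonempty (n k) := hne.2
  set N : ℝ := (Fintype.card (n k) : ℝ)
  -- Level 4 leaves failure probability 1/4, which together with 1/4 from the test functions gives
  -- the required 1/2.
  have hmean := (hnorm k).mean_colEig_ge hα (hM k) (t := 4) (by norm_num)
  have hbound := le_lintegral_of_prob (P := P k)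
    (J := fun ω => sphericalIntegral (θ • ((A k ω)ᵀ * A k ω)))
    (S := {ω | κ < ∫ x, h x ∂empiricalMeasure (colEig (A k ω)) ∧
      dist (∫ x, (w₀ + ξ x)⁻¹ ∂empiricalMeasure (colEig (A k ω))) 1 < η ∧
      ∫ x, min (Real.log (w₀ + ξ x)) (K : ℝ) ∂empiricalMeasure (colEig (A k ω)) <
        ∫ x, min (Real.log (w₀ + ξ x)) (K : ℝ) ∂G + η} ∩
      {ω | ∫ x, x ∂empiricalMeasure (colEig (A k ω)) < 4})
    (b := C * Real.exp (N / 2 * (potential c p G Λ - 1 - Real.log θ - θ * δ₁ - 3 * η)))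
    (by positivity) ?_ ?_
  -- The losses θδ₁ + 3η amount to 5δ/16; the rest of δ absorbs the saddle constant and the
  -- probability, together C/2.
  · refine le_trans (ENNReal.ofReal_le_ofReal ?_) hbound
    rw [div_le_iff₀ hδ] at hk2
    have hexp : N / 2 * (potential c p G Λ - 1 - Real.log θ - δ) + Real.log (2 / C) ≤
        N / 2 * (potential c p G Λ - 1 - Real.log θ - θ * δ₁ - 3 * η) := by
      rw [hθδ, hη]
      have : 0 ≤ N * δ := by positivity
      nlinarith
    have := Real.exp_le_exp.2 hexp
    rw [Real.exp_add, Real.exp_log (by positivity)] at this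
    calc Real.exp (N / 2 * (potential c p G Λ - 1 - Real.log θ - δ))
        = C / 2 * (Real.exp (N / 2 * (potential c p G Λ - 1 - Real.log θ - δ)) * (2 / C)) := by
          field_simp
      _ ≤ C / 2 * Real.exp (N / 2 * (potential c p G Λ - 1 - Real.log θ - θ * δ₁ - 3 * η)) := by
          gcongr
      _ = _ := by ring
  · rintro ω ⟨⟨hω1, hω2, hω3⟩, hω4⟩
    have hd := colEig_nonneg (A k ω)
    obtain ⟨w, hwκ, hw1, hwS⟩ := hS (Nat.cast_le.1 hk1) (fun i => ξ (colEig (A k ω) i))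
      (fun i => hξ0 _)
      (hω1.le.trans (empiricalMeasure_real_zero (colEig (A k ω)) fun i => hhξ _))
    rw [integral_empiricalMeasure_comp (colEig (A k ω)) (fun x => Real.log (w + x)) ξ] at hwS
    have hval := saddle_value_ge (E := empiricalMeasure (colEig (A k ω)))
      (integrable_empiricalMeasure _) ((ae_empiricalMeasure _ _).2 hd) hξ0 hθ
      (fun x hx => by simpa using hξle 0 x (by linarith) hx)
      (I := I) (hκ0.trans_le hwκ) hw1 hw₀0 hw₀1 (le_of_lt hω4) hK (le_of_lt hω2)
      (hω3.le.trans (by linarith))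
    have hshift := sphericalIntegral_diagonal_shift (a := fun i => θ * colEig (A k ω) i)
      (b := fun i => ξ (colEig (A k ω) i)) (s := θ * a) (by positivity) (fun i => by
        have := mul_le_mul_of_nonneg_left (le_max_left (colEig (A k ω) i) a) hθ.le
        simp only [ξ]
        linarith)
    rw [sphericalIntegral_smul_transpose_mul_self]
    refine le_trans ?_ ((mul_le_mul_right hwS _).trans hshift)
    rw [← ENNReal.ofReal_mul (Real.exp_pos _).le]
    refine ENNReal.ofReal_le_ofReal ?_
    rw [mul_left_comm, ← Real.exp_add]
    gcongr
    have hpotΛ : potential c p G Λ = w₀ - θ * a₀ - ∫ x, Real.log (Λ * c + x) ∂G := by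
      have : Λ * p = w₀ - θ * a₀ := by
        have : Λ * p = Λ * c * θ := by rw [hθdef]; field_simp
        rw [this, hΛc]; field_simp
      rw [potential, this]
    have hkey : potential c p G Λ - 1 - Real.log θ - θ * δ₁ - 3 * η ≤
        w - 1 - ∫ x, Real.log (w + ξ x) ∂empiricalMeasure (colEig (A k ω)) - θ * a := by
      have : θ * a = θ * a₀ + θ * δ₁ := by rw [ha]; ring
      linarith
    have := mul_le_mul_of_nonneg_left hkey (by positivity : 0 ≤ N / 2)
    linarith
  · have hsub : ({ω | κ < ∫ x, h x ∂empiricalMeasure (colEig (A k ω)) ∧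
      dist (∫ x, (w₀ + ξ x)⁻¹ ∂empiricalMeasure (colEig (A k ω))) 1 < η ∧
      ∫ x, min (Real.log (w₀ + ξ x)) (K : ℝ) ∂empiricalMeasure (colEig (A k ω)) <
        ∫ x, min (Real.log (w₀ + ξ x)) (K : ℝ) ∂G + η} ∩
      {ω | ∫ x, x ∂empiricalMeasure (colEig (A k ω)) < 4})ᶜ ⊆
      {ω | ¬ (κ < ∫ x, h x ∂empiricalMeasure (colEig (A k ω)) ∧
      dist (∫ x, (w₀ + ξ x)⁻¹ ∂empiricalMeasure (colEig (A k ω))) 1 < η ∧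
      ∫ x, min (Real.log (w₀ + ξ x)) (K : ℝ) ∂empiricalMeasure (colEig (A k ω)) <
        ∫ x, min (Real.log (w₀ + ξ x)) (K : ℝ) ∂G + η)} ∪
      {ω | 4 ≤ ∫ x, x ∂empiricalMeasure (colEig (A k ω))} := by
      rw [Set.compl_inter]
      refine Set.union_subset_union (fun ω hω => hω) fun ω hω => ?_
      simpa using hω
    refine ((measureReal_mono hsub).trans (measureReal_union_le _ _)).trans ?_
    linarith

end LowerBound

/-! ### Attainment of the infimum and continuity in the matrix -/

section FreeEnergy

section Deterministic

variable {c p : ℝ} {G : Measure ℝ} [IsProbabilityMeasure G]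

/-- If `G` has an atom at zero, the infimum of the potential is attained. -/
theorem exists_potential_eq_sInf (hc : 0 < c) (hp : 0 < p) (hG : Integrable (fun x => x) G)
    (hG0 : ∀ᵐ x ∂G, 0 ≤ x) (hatom : 0 < G.real {0}) :
    ∃ Λ > 0, potential c p G Λ = sInf (potential c p G '' potentialDomain c G) := by
  obtain ⟨Λ, hΛ, -, h⟩ := exists_saddle hc hp hG0 hatom le_rfl
  have hΛ0 : 0 < Λ := (div_pos hatom hp).trans_le hΛ
  have hmem := pos_mem_potentialDomain hc hG0 hΛ0
  have hd := hasDerivAt_potential (p := p) hc hG hmem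
  rw [h, sub_self] at hd
  refine ⟨Λ, hΛ0, le_antisymm (le_csInf ⟨_, Λ, hmem, rfl⟩ ?_)
    (csInf_le (bddBelow_potential hc hp hG) ⟨Λ, hmem, rfl⟩)⟩
  rintro _ ⟨Λ', hΛ', rfl⟩
  exact potential_le_of_stationary hc hG hΛ' hmem hd

end Deterministic

section Measurability

variable {m n : Type*} [Fintype m] [Fintype n] [DecidableEq n] [Nonempty n]

/-- The logarithmic sum is the logarithm of a characteristic polynomial at -Λc. Its sign is
irrelevant since `Real.log` sees only the absolute value, and continuity in A becomes visible
without continuity of eigenvalues. -/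
theorem potential_colEig (c p : ℝ) {Λ : ℝ} (h : 0 < Λ * c) (A : Matrix m n ℝ) :
    (Matrix.scalar n (-(Λ * c)) - Aᵀ * A).det ≠ 0 ∧
    potential c p (empiricalMeasure (colEig A)) Λ = Λ * p - (Fintype.card n : ℝ)⁻¹ *
      Real.log (Matrix.scalar n (-(Λ * c)) - Aᵀ * A).det := by
  have hdet : (Matrix.scalar n (-(Λ * c)) - Aᵀ * A).det = ∏ i, (-(Λ * c) - colEig A i) := by
    rw [← Matrix.eval_charpoly, (isHermitian_transpose_mul_real A).charpoly_eq,
      Polynomial.eval_prod]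
    simp [colEig]
  have hne : ∀ i, -(Λ * c) - colEig A i ≠ 0 := fun i => by
    have := colEig_nonneg A i
    linarith
  refine ⟨by rw [hdet]; exact Finset.prod_ne_zero_iff.2 fun i _ => hne i, ?_⟩
  rw [potential, integral_empiricalMeasure, hdet, Real.log_prod fun i _ => hne i]
  congr 2
  refine Finset.sum_congr rfl fun i _ => ?_
  rw [← Real.log_neg_eq_log]
  congr 1
  ring

theorem continuous_potential_colEig (c p : ℝ) {Λ : ℝ} (h : 0 < Λ * c) :
    Continuous fun A : Matrix m n ℝ => potential c p (empiricalMeasure (colEig A)) Λ := by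
  have h1 := fun A : Matrix m n ℝ => (potential_colEig c p h A).2
  simp only [h1]
  refine continuous_const.sub (continuous_const.mul (Continuous.log ?_ fun A =>
    (potential_colEig c p h A).1))
  fun_prop

end Measurability

end FreeEnergy

/-! ### Two-sided bounds in a fixed dimension for α < 1 -/

section FreeEnergyBounds

section FixedDimension

variable {M : ℕ} {n : Type*} [Fintype n] [DecidableEq n] [Nonempty n] {α β lam σ ν : ℝ}

/-- The value `HFun` of the empirical spectral distribution as an infimum over positive reals. -/
theorem HFun_esd (hM : (M : ℝ) = α * Fintype.card n) (hα : 0 < α) (hα1 : α < 1) (hβ : 0 < β)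
    (hlam : 0 < lam) (hν : 0 < ν) (A : Matrix (Fin M) n ℝ) :
    1 - α ≤ (empiricalMeasure (colEig A)).real {0} ∧
    (∀ Λ > 0, HFun α β lam σ ν (esd A) ≤
      1 / 2 * potential (β * σ ^ 2 + lam) (β * ν) (empiricalMeasure (colEig A)) Λ +
        ((1 - α) * Real.log (β * σ ^ 2 + lam) - 1 - Real.log (β * ν) + α * Real.log lam) / 2) ∧
    ∃ Λ > 0, HFun α β lam σ ν (esd A) =
      1 / 2 * potential (β * σ ^ 2 + lam) (β * ν) (empiricalMeasure (colEig A)) Λ +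
        ((1 - α) * Real.log (β * σ ^ 2 + lam) - 1 - Real.log (β * ν) + α * Real.log lam) / 2 := by
  have hc : 0 < β * σ ^ 2 + lam := by positivity
  have hp : 0 < β * ν := mul_pos hβ hν
  have hcard : (0 : ℝ) < Fintype.card n := by exact_mod_cast Fintype.card_pos
  have hM0 : 0 < M := by
    have : (0 : ℝ) < M := by rw [hM]; positivity
    exact_mod_cast this
  have : Nonempty (Fin M) := ⟨⟨0, hM0⟩⟩
  have hprob : IsProbabilityMeasure (esd A) := by rw [esd_eq]; infer_instance
  have hmix := mixZero_esd A hM0 hM hα hα1.le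
  have hatom := le_mixZero_real_zero (F := esd A) hα.le hα1.le
  have hH := HFun_eq (σ := σ) (F := esd A) hα hα1.le hβ hlam
    (by rw [esd_eq]; exact (ae_empiricalMeasure _ _).2 (gramEig_nonneg A))
    (by rw [esd_eq]; exact integrable_empiricalMeasure _ _) hν
  rw [hmix] at hatom hH
  have hG0 : ∀ᵐ x ∂empiricalMeasure (colEig A), 0 ≤ x :=
    (ae_empiricalMeasure _ _).2 (colEig_nonneg A)
  refine ⟨hatom, fun Λ hΛ => ?_, ?_⟩
  · rw [hH]
    gcongr
    exact csInf_le (bddBelow_potential hc hp (integrable_empiricalMeasure _ _))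
      ⟨Λ, pos_mem_potentialDomain hc hG0 hΛ, rfl⟩
  · obtain ⟨Λ, hΛ, h⟩ := exists_potential_eq_sInf hc hp
      (integrable_empiricalMeasure (colEig A) _) hG0 ((sub_pos.2 hα1).trans_le hatom)
    exact ⟨Λ, hΛ, by rw [hH, h]⟩

theorem measurable_HFun_esd (hM : (M : ℝ) = α * Fintype.card n) (hα : 0 < α) (hα1 : α < 1)
    (hβ : 0 < β) (hlam : 0 < lam) (hν : 0 < ν) :
    Measurable fun A : Matrix (Fin M) n ℝ => HFun α β lam σ ν (esd A) := by
  have hc : 0 < β * σ ^ 2 + lam := by positivity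
  -- An infimum of continuous functions is upper semicontinuous, so its strict sublevel sets are
  -- open even though the infimum is uncountable.
  refine measurable_of_Iio fun r => IsOpen.measurableSet ?_
  set b := ((1 - α) * Real.log (β * σ ^ 2 + lam) - 1 - Real.log (β * ν) + α * Real.log lam) / 2
  have hset : (fun A : Matrix (Fin M) n ℝ => HFun α β lam σ ν (esd A)) ⁻¹' Set.Iio r =
      ⋃ Λ ∈ Set.Ioi (0 : ℝ), {A : Matrix (Fin M) n ℝ |
        1 / 2 * potential (β * σ ^ 2 + lam) (β * ν) (empiricalMeasure (colEig A)) Λ + b < r} := by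
    ext A
    obtain ⟨-, h1, Λ, hΛ, h2⟩ := HFun_esd (σ := σ) hM hα hα1 hβ hlam hν A
    simp only [Set.mem_preimage, Set.mem_Iio, Set.mem_iUnion, Set.mem_Ioi, Set.mem_ofPred_eq,
      exists_prop]
    exact ⟨fun h => ⟨Λ, hΛ, h2 ▸ h⟩, fun ⟨Λ', hΛ', h⟩ => (h1 Λ' hΛ').trans_lt h⟩
  rw [hset]
  refine isOpen_biUnion fun Λ hΛ => isOpen_lt ?_ continuous_const
  exact (continuous_const.mul (continuous_potential_colEig _ _ (mul_pos hΛ hc))).add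
    continuous_const

variable {Ω : Type*} [MeasurableSpace Ω] {P : Measure Ω} [IsProbabilityMeasure P]
  {A : Ω → Matrix (Fin M) n ℝ} {w : Ω → Fin M → ℝ}

/-- The expectation over noise and matrix in terms of spherical integrals. -/
theorem integral_exp_eq (hA : Measurable A) (hw : Measurable w)
    (hwlaw : P.map w = Measure.pi (fun _ => gaussianReal 0 1)) (hwA : IndepFun w A P)
    (hrot : IsRotationallyInvariant P A) (hβ : 0 < β) (hlam : 0 < lam) {u : n → ℝ}
    (hu : u ⬝ᵥ u = Fintype.card n * ν) :
    ∫ ω, Real.exp (-(β / (2 * lam)) * ‖WithLp.toLp 2 (σ • w ω - (A ω) *ᵥ u)‖ ^ 2) ∂P =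
      Real.exp (-(1 / 2) * (M * Real.log ((β * σ ^ 2 + lam) / lam))) *
        (∫⁻ ω, sphericalIntegral ((β * ν / (β * σ ^ 2 + lam)) • ((A ω)ᵀ * A ω)) ∂P).toReal := by
  have hc : 0 < β * σ ^ 2 + lam := by positivity
  have hcard : (Fintype.card n : ℝ) ≠ 0 := by simp
  have hmeas : Measurable fun ω =>
      Real.exp (-(β / (2 * lam)) * ‖WithLp.toLp 2 (σ • w ω - (A ω) *ᵥ u)‖ ^ 2) := by
    have hAu : Measurable fun ω => (A ω) *ᵥ u :=
      (Continuous.matrix_mulVec continuous_id continuous_const).measurable.comp hA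
    have hv : Measurable fun ω => σ • w ω - (A ω) *ᵥ u := (hw.const_smul σ).sub hAu
    have hv' := (WithLp.measurable_toLp 2 (Fin M → ℝ)).comp hv
    exact ((hv'.norm.pow_const 2).const_mul _).exp
  rw [integral_eq_lintegral_of_nonneg_ae (ae_of_all _ fun ω => (Real.exp_pos _).le)
    hmeas.aestronglyMeasurable]
  have hk : -(β / (2 * lam)) = -(β / lam / 2) := by field_simp
  have hb : 1 + β / lam * σ ^ 2 = (β * σ ^ 2 + lam) / lam := by field_simp; ring
  have hq : β / lam / ((β * σ ^ 2 + lam) / lam) = β / (β * σ ^ 2 + lam) := by field_simp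
  have ht : β / (β * σ ^ 2 + lam) * (Fintype.card n * ν) / Fintype.card n =
      β * ν / (β * σ ^ 2 + lam) := by field_simp
  rw [hk, lintegral_exp_noise hA hw hwlaw hwA (div_pos hβ hlam), hb, hq,
    hrot.lintegral_exp hA, hu, ht, ENNReal.toReal_mul, ENNReal.toReal_ofReal (Real.exp_pos _).le]

/-- For a spectrum with a positive fraction of zeros, the expectation is determined up to
constants by the empirical spectral distribution. -/
theorem integral_exp_HFun_bounds (hA : Measurable A) (hrot : IsRotationallyInvariant P A)
    (hM : (M : ℝ) = α * Fintype.card n) (hα : 0 < α) (hα1 : α < 1) (hβ : 0 < β) (hlam : 0 < lam)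
    (hν : 0 < ν) {C : ℝ} (hC : 0 < C)
    (hS : ∀ B : Matrix (Fin M) n ℝ, 1 - α ≤ (empiricalMeasure (colEig B)).real {0} →
      ∃ Λ > 0, ENNReal.ofReal (C * Real.exp (Fintype.card n / 2 *
          (potential (β * σ ^ 2 + lam) (β * ν) (empiricalMeasure (colEig B)) Λ - 1 -
            Real.log (β * ν / (β * σ ^ 2 + lam))))) ≤
        sphericalIntegral ((β * ν / (β * σ ^ 2 + lam)) • (Bᵀ * B))) :
    0 < ∫ ω, Real.exp (Fintype.card n * HFun α β lam σ ν (esd (A ω))) ∂P ∧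
    C * ∫ ω, Real.exp (Fintype.card n * HFun α β lam σ ν (esd (A ω))) ∂P ≤
      Real.exp (-(1 / 2) * (M * Real.log ((β * σ ^ 2 + lam) / lam))) *
        (∫⁻ ω, sphericalIntegral ((β * ν / (β * σ ^ 2 + lam)) • ((A ω)ᵀ * A ω)) ∂P).toReal ∧
    Real.exp (-(1 / 2) * (M * Real.log ((β * σ ^ 2 + lam) / lam))) *
        (∫⁻ ω, sphericalIntegral ((β * ν / (β * σ ^ 2 + lam)) • ((A ω)ᵀ * A ω)) ∂P).toReal ≤
      ∫ ω, Real.exp (Fintype.card n * HFun α β lam σ ν (esd (A ω))) ∂P := by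
  have hc : 0 < β * σ ^ 2 + lam := by positivity
  have hp : 0 < β * ν := mul_pos hβ hν
  obtain ⟨η, hη, hη1⟩ := hrot.exists_haar
  set N : ℝ := (Fintype.card n : ℝ)
  set E := Real.exp (-(1 / 2) * (M * Real.log ((β * σ ^ 2 + lam) / lam))) with hE
  have hE0 : 0 < E := Real.exp_pos _
  set J : Ω → ℝ≥0∞ := fun ω =>
    sphericalIntegral ((β * ν / (β * σ ^ 2 + lam)) • ((A ω)ᵀ * A ω)) with hJ
  have hJ1 : ∀ ω, J ω ≤ 1 := fun ω => sphericalIntegral_gram_le_one (A ω) (div_pos hp hc).le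
  have hJtop : ∀ ω, J ω ≠ ∞ := fun ω => ((hJ1 ω).trans_lt ENNReal.one_lt_top).ne
  have hJm : Measurable J :=
    measurable_sphericalIntegral.comp ((continuous_const_smul _).measurable.comp
      (measurable_transpose_mul_self.comp hA))
  have hJint : Integrable (fun ω => (J ω).toReal) P :=
    Integrable.of_bound hJm.ennreal_toReal.aestronglyMeasurable 1 (ae_of_all _ fun ω => by
      rw [Real.norm_of_nonneg ENNReal.toReal_nonneg]
      exact ENNReal.toReal_le_of_le_ofReal zero_le_one (by simpa using hJ1 ω))
  have hJeq : (∫⁻ ω, J ω ∂P).toReal = ∫ ω, (J ω).toReal ∂P :=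
    (integral_toReal hJm.aemeasurable (ae_of_all _ fun ω => (hJtop ω).lt_top)).symm
  have hexp : ∀ q : ℝ, Real.exp (N * (1 / 2 * q + ((1 - α) * Real.log (β * σ ^ 2 + lam) - 1 -
        Real.log (β * ν) + α * Real.log lam) / 2)) =
      E * Real.exp (N / 2 * (q - 1 - Real.log (β * ν / (β * σ ^ 2 + lam)))) := fun q => by
    rw [hE, ← Real.exp_add, hM, Real.log_div hc.ne' hlam.ne', Real.log_div hp.ne' hc.ne']
    congr 1
    ring
  -- The upper bound uses the minimizing Λ; the lower one below needs only that the value at any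
  -- positive Λ dominates the infimum.
  have hup : ∀ ω, E * (J ω).toReal ≤ Real.exp (N * HFun α β lam σ ν (esd (A ω))) := fun ω => by
    obtain ⟨-, -, Λ, hΛ, h⟩ := HFun_esd (σ := σ) hM hα hα1 hβ hlam hν (A ω)
    rw [h, hexp]
    refine mul_le_mul_of_nonneg_left (ENNReal.toReal_le_of_le_ofReal (Real.exp_pos _).le
      (sphericalIntegral_gram_le η (A ω) hc hp fun i => ?_)) hE0.le
    exact add_pos_of_pos_of_nonneg (mul_pos hΛ hc) (colEig_nonneg _ i)
  have hlow : ∀ ω, C * Real.exp (N * HFun α β lam σ ν (esd (A ω))) ≤ E * (J ω).toReal := fun ω => by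
    obtain ⟨hatom, h, -⟩ := HFun_esd (σ := σ) hM hα hα1 hβ hlam hν (A ω)
    obtain ⟨Λ, hΛ, hΛS⟩ := hS (A ω) hatom
    have h1 := (ENNReal.ofReal_le_iff_le_toReal (hJtop ω)).1 hΛS
    have h2 := h Λ hΛ
    calc C * Real.exp (N * HFun α β lam σ ν (esd (A ω)))
        ≤ C * Real.exp (N * (1 / 2 * potential (β * σ ^ 2 + lam) (β * ν)
            (empiricalMeasure (colEig (A ω))) Λ + ((1 - α) * Real.log (β * σ ^ 2 + lam) - 1 -
              Real.log (β * ν) + α * Real.log lam) / 2)) := by gcongr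
      _ = E * (C * _) := by rw [hexp]; exact mul_left_comm _ _ _
      _ ≤ _ := mul_le_mul_of_nonneg_left h1 hE0.le
  have hHm : Measurable fun ω => Real.exp (N * HFun α β lam σ ν (esd (A ω))) :=
    (((measurable_HFun_esd hM hα hα1 hβ hlam hν).comp hA).const_mul N).exp
  have hHint : Integrable (fun ω => Real.exp (N * HFun α β lam σ ν (esd (A ω)))) P := by
    refine Integrable.mono' ((hJint.const_mul E).const_mul C⁻¹) hHm.aestronglyMeasurable
      (ae_of_all _ fun ω => ?_)
    rw [Real.norm_of_nonneg (Real.exp_pos _).le, le_inv_mul_iff₀ hC]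
    exact hlow ω
  rw [hJeq, ← integral_const_mul, ← integral_const_mul]
  exact ⟨integral_exp_pos hHint, integral_mono (hHint.const_mul C) (hJint.const_mul E) hlow,
    integral_mono (hJint.const_mul E) hHint hup⟩

end FixedDimension

end FreeEnergyBounds

/-! ### The limit and the error term -/

section FreeEnergyLimit

variable {Ω : ℕ → Type*} [∀ k, MeasurableSpace (Ω k)] {P : ∀ k, Measure (Ω k)}
  [∀ k, IsProbabilityMeasure (P k)] {M : ℕ → ℕ} {n : ℕ → Type*} [∀ k, Fintype (n k)]
  [∀ k, DecidableEq (n k)] {A : ∀ k, Ω k → Matrix (Fin (M k)) (n k) ℝ}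
  {w : ∀ k, Ω k → Fin (M k) → ℝ} {u : ∀ k, n k → ℝ} {α β lam σ ν : ℝ}
  {F : Measure ℝ} [IsProbabilityMeasure F]

theorem tendsto_finiteH (hN : Tendsto (fun k => (Fintype.card (n k) : ℝ)) atTop atTop)
    (hα : 0 < α) (hα1 : α ≤ 1) (hβ : 0 < β) (hlam : 0 < lam) (hν : 0 < ν)
    (hM : ∀ k, (M k : ℝ) = α * Fintype.card (n k)) (hu : ∀ k, u k ⬝ᵥ u k = Fintype.card (n k) * ν)
    (hA : ∀ k, Measurable (A k)) (hw : ∀ k, Measurable (w k))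
    (hwlaw : ∀ k, (P k).map (w k) = Measure.pi (fun _ => gaussianReal 0 1))
    (hwA : ∀ k, IndepFun (w k) (A k) (P k)) (hrot : ∀ k, IsRotationallyInvariant (P k) (A k))
    (hnorm : ∀ k, IsNormalized α (P k) (A k))
    (hF : SpectrumConverges P A (fun k => (Fintype.card (n k) : ℝ)) F)
    (hedge : α = 1 → NoLowOutliers P A (fun k => (Fintype.card (n k) : ℝ)) F) :
    Tendsto (fun k => finiteH (P k) (w k) (A k) β lam σ (u k)) atTop
      (𝓝 (HFun α β lam σ ν F)) := by
  have hc : 0 < β * σ ^ 2 + lam := by positivity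
  have hp : 0 < β * ν := mul_pos hβ hν
  have := isProbabilityMeasure_mixZero (F := F) hα.le hα1
  have hF0 := hF.ae_nonneg hN hα hM
  have hFi := hF.integrable_id hN hα hα1 hM hnorm
  have hG0 : ∀ᵐ x ∂mixZero α F, 0 ≤ x := (ae_mixZero hα _).2 ⟨fun _ => le_rfl, hF0⟩
  have hbdd := bddBelow_potential hc hp (integrable_mixZero (α := α) hFi)
  have hH := HFun_eq (σ := σ) hα hα1 hβ hlam hF0 hFi hν
  set D := potentialDomain (β * σ ^ 2 + lam) (mixZero α F) with hD
  set s := sInf (potential (β * σ ^ 2 + lam) (β * ν) (mixZero α F) '' D) with hs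
  have hne : (potential (β * σ ^ 2 + lam) (β * ν) (mixZero α F) '' D).Nonempty :=
    ⟨_, 1, pos_mem_potentialDomain hc hG0 one_pos, rfl⟩
  set J : ℕ → ℝ≥0∞ := fun k =>
    ∫⁻ ω, sphericalIntegral ((β * ν / (β * σ ^ 2 + lam)) • ((A k ω)ᵀ * A k ω)) ∂P k with hJ
  have hJtop : ∀ k, J k ≠ ∞ := fun k => by
    refine ((lintegral_mono fun ω =>
      sphericalIntegral_gram_le_one (A k ω) (div_pos hp hc).le).trans_lt ?_).ne
    simp
  have hval : ∀ {k : ℕ}, 0 < (Fintype.card (n k) : ℝ) → ∀ τ : ℝ,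
      (Fintype.card (n k) : ℝ)⁻¹ * Real.log (Real.exp (-(1 / 2) * (M k * Real.log
        ((β * σ ^ 2 + lam) / lam))) * Real.exp (Fintype.card (n k) / 2 *
          (s - 1 - Real.log (β * ν / (β * σ ^ 2 + lam)) + τ))) = HFun α β lam σ ν F + τ / 2 := by
    intro k hk τ
    rw [← Real.exp_add, Real.log_exp, hH, hM, Real.log_div hc.ne' hlam.ne',
      Real.log_div hp.ne' hc.ne']
    field_simp
    ring
  have hlow : ∀ δ > 0, ∀ᶠ k in atTop, Real.exp (Fintype.card (n k) / 2 *
      (s - 1 - Real.log (β * ν / (β * σ ^ 2 + lam)) + -δ)) ≤ (J k).toReal := by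
    intro δ hδ
    obtain ⟨Λ, hΛ, h⟩ := eventually_le_lintegral_sphericalIntegral hN hF hα hα1 hM hnorm hc hp hδ
    filter_upwards [h] with k hk
    refine le_trans (Real.exp_le_exp.2 ?_) ((ENNReal.ofReal_le_iff_le_toReal (hJtop k)).1 hk)
    have : s ≤ potential (β * σ ^ 2 + lam) (β * ν) (mixZero α F) Λ := csInf_le hbdd ⟨Λ, hΛ, rfl⟩
    rw [← sub_eq_add_neg]
    gcongr
  have hup : ∀ δ > 0, ∀ᶠ k in atTop, (J k).toReal ≤ Real.exp (Fintype.card (n k) / 2 *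
      (s - 1 - Real.log (β * ν / (β * σ ^ 2 + lam)) + δ)) := by
    intro δ hδ
    obtain ⟨_, ⟨Λ, hΛ, rfl⟩, hlt⟩ := exists_lt_of_csInf_lt hne
      (lt_add_of_pos_right s (half_pos hδ))
    filter_upwards [eventually_lintegral_sphericalIntegral_le hN hF hα hα1 hM hnorm hrot hedge hc hp
      hΛ (half_pos hδ)] with k hk
    refine (ENNReal.toReal_le_of_le_ofReal (Real.exp_pos _).le hk).trans (Real.exp_le_exp.2 ?_)
    refine mul_le_mul_of_nonneg_left ?_ (by positivity)
    linarith
  have hfin : ∀ᶠ k in atTop, 0 < (Fintype.card (n k) : ℝ) ∧ finiteH (P k) (w k) (A k) β lam σ (u k) =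
      (Fintype.card (n k) : ℝ)⁻¹ * Real.log (Real.exp (-(1 / 2) * (M k * Real.log
        ((β * σ ^ 2 + lam) / lam))) * (J k).toReal) := by
    filter_upwards [eventually_nonempty hN hα hM] with k hk
    have := hk.2
    exact ⟨by exact_mod_cast Fintype.card_pos, by rw [finiteH,
      integral_exp_eq (hA k) (hw k) (hwlaw k) (hwA k) (hrot k) hβ hlam (hu k)]⟩
  refine tendsto_order.2 ⟨fun a ha => ?_, fun a ha => ?_⟩
  · filter_upwards [hfin, hlow _ (sub_pos.2 ha)] with k hk hlk
    rw [hk.2]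
    refine lt_of_lt_of_le ?_ (mul_le_mul_of_nonneg_left (Real.log_le_log (by positivity)
      (mul_le_mul_of_nonneg_left hlk (Real.exp_pos _).le)) (inv_pos.2 hk.1).le)
    rw [hval hk.1]
    linarith
  · filter_upwards [hfin, hlow 1 one_pos, hup _ (sub_pos.2 ha)] with k hk hlk huk
    rw [hk.2]
    refine lt_of_le_of_lt (mul_le_mul_of_nonneg_left (Real.log_le_log
      (mul_pos (Real.exp_pos _) ((Real.exp_pos _).trans_le hlk))
      (mul_le_mul_of_nonneg_left huk (Real.exp_pos _).le)) (inv_pos.2 hk.1).le) ?_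
    rw [hval hk.1]
    linarith

/-- The two expectations agree up to a factor between C and 1, with C independent of the dimension;
taking logarithms and dividing by N gives the rate. -/
theorem finiteH_sub_isBigO {n : ℕ → Type} [∀ k, Fintype (n k)] [∀ k, DecidableEq (n k)]
    {A : ∀ k, Ω k → Matrix (Fin (M k)) (n k) ℝ} {u : ∀ k, n k → ℝ}
    (hN : Tendsto (fun k => (Fintype.card (n k) : ℝ)) atTop atTop)
    (hα : 0 < α) (hα1 : α < 1) (hβ : 0 < β) (hlam : 0 < lam) (hν : 0 < ν)
    (hM : ∀ k, (M k : ℝ) = α * Fintype.card (n k)) (hu : ∀ k, u k ⬝ᵥ u k = Fintype.card (n k) * ν)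
    (hA : ∀ k, Measurable (A k)) (hw : ∀ k, Measurable (w k))
    (hwlaw : ∀ k, (P k).map (w k) = Measure.pi (fun _ => gaussianReal 0 1))
    (hwA : ∀ k, IndepFun (w k) (A k) (P k)) (hrot : ∀ k, IsRotationallyInvariant (P k) (A k)) :
    (fun k => finiteH (P k) (w k) (A k) β lam σ (u k) - (Fintype.card (n k) : ℝ)⁻¹ *
        Real.log (∫ ω, Real.exp (Fintype.card (n k) * HFun α β lam σ ν (esd (A k ω))) ∂P k))
      =O[atTop] fun k => (Fintype.card (n k) : ℝ)⁻¹ := by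
  have hc : 0 < β * σ ^ 2 + lam := by positivity
  obtain ⟨C, hC, N₀, hS⟩ := exists_le_sphericalIntegral_gram (sub_pos.2 hα1) hc (mul_pos hβ hν)
  refine IsBigO.of_bound (-Real.log C) ?_
  filter_upwards [eventually_nonempty hN hα hM, hN.eventually_ge_atTop (N₀ : ℝ)] with k hk hk0
  have := hk.2
  obtain ⟨h0, h1, h2⟩ := integral_exp_HFun_bounds (σ := σ) (hA k) (hrot k) (hM k) hα hα1 hβ hlam hν
    hC (hS (Nat.cast_le.1 hk0))
  rw [finiteH, integral_exp_eq (hA k) (hw k) (hwlaw k) (hwA k) (hrot k) hβ hlam (hu k), ← mul_sub,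
    norm_mul, mul_comm]
  refine mul_le_mul_of_nonneg_right ?_ (norm_nonneg _)
  have h3 := Real.log_le_log (mul_pos hC h0) h1
  have h4 := Real.log_le_log ((mul_pos hC h0).trans_le h1) h2
  rw [Real.log_mul hC.ne' h0.ne'] at h3
  rw [Real.norm_eq_abs, abs_le]
  constructor <;> linarith

end FreeEnergyLimit

/-! ### Assembly for block vectors -/

theorem lemma2
    (T : ℕ) (α β lam σ : ℝ) (hα : 0 < α) (hα1 : α ≤ 1) (hβ : 0 < β) (hlam : 0 < lam)
    -- block norms and their mean
    (νs : Fin T → ℝ) (hνs : ∀ t, 0 ≤ νs t) (ν : ℝ) (hν : ν = (T : ℝ)⁻¹ * ∑ t, νs t)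
    (hνpos : 0 < ν)
    -- dimensions: `N k = T * m k` columns and `M k = α * N k` rows
    (M m : ℕ → ℕ) (hm : Tendsto m atTop atTop)
    (hM : ∀ k, (M k : ℝ) = α * ((T : ℝ) * (m k : ℝ)))
    -- the fixed vectors
    (u : ∀ k, Fin T → EuclideanSpace ℝ (Fin (m k)))
    (hu : ∀ k t, ‖u k t‖ ^ 2 = (m k : ℝ) * νs t)
    -- the random matrices and the Gaussian noise
    (Ω : ℕ → Type*) [∀ k, MeasurableSpace (Ω k)] (P : ∀ k, Measure (Ω k))
    [∀ k, IsProbabilityMeasure (P k)]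
    (A : ∀ k, Ω k → Matrix (Fin (M k)) (Fin T × Fin (m k)) ℝ)
    (w : ∀ k, Ω k → Fin (M k) → ℝ)
    (hA : ∀ k, Measurable (A k)) (hw : ∀ k, Measurable (w k))
    (hwlaw : ∀ k, (P k).map (w k) = Measure.pi (fun _ => gaussianReal 0 1))
    (hwA : ∀ k, IndepFun (w k) (A k) (P k))
    (hrot : ∀ k, IsRotationallyInvariant (P k) (A k))
    (hnorm : ∀ k, IsNormalized α (P k) (A k))
    -- the limiting spectral distribution
    (F : Measure ℝ) [IsProbabilityMeasure F]
    (hF : SpectrumConverges P A (fun k => (T : ℝ) * (m k : ℝ)) F)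
    (hedge : α = 1 → NoLowOutliers P A (fun k => (T : ℝ) * (m k : ℝ)) F) :
    -- the extremization problem is well posed
    (objectiveDomain α β lam σ F).Nonempty ∧
    (∀ Λ ∈ objectiveDomain α β lam σ F,
      Integrable (fun x => Real.log (Λ * β * σ ^ 2 + Λ * lam + x)) F) ∧
    BddBelow (objective α β lam σ ν F '' objectiveDomain α β lam σ F) ∧
    (stationaryPoints (objective α β lam σ ν F) (objectiveDomain α β lam σ F)).Subsingleton ∧
    (α < 1 →
      (stationaryPoints (objective α β lam σ ν F) (objectiveDomain α β lam σ F)).Nonempty) ∧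
    -- the limit
    Tendsto (fun k => finiteH (P k) (w k) (A k) β lam σ (fun p => u k p.1 p.2)) atTop
      (𝓝 (HFun α β lam σ ν F)) ∧
    -- the error of order `1 / N`, relative to the empirical spectral distribution
    (α < 1 →
      (fun k => finiteH (P k) (w k) (A k) β lam σ (fun p => u k p.1 p.2)
          - ((T : ℝ) * (m k : ℝ))⁻¹ * Real.log (∫ ω,
              Real.exp ((T : ℝ) * (m k : ℝ) * HFun α β lam σ ν (esd (A k ω))) ∂(P k)))
        =O[atTop] (fun k => ((T : ℝ) * (m k : ℝ))⁻¹)) := by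
  -- For T = 0 the mean ν would be 0.
  have hT : 0 < T := by
    rcases Nat.eq_zero_or_pos T with rfl | h
    · simp at hν; exact absurd hν hνpos.ne'
    · exact h
  have hT0 : (0 : ℝ) < T := by exact_mod_cast hT
  have hcard : ∀ k, (T : ℝ) * (m k : ℝ) = (Fintype.card (Fin T × Fin (m k)) : ℝ) := by simp
  simp only [hcard] at hM hF hedge ⊢
  have hN : Tendsto (fun k => (Fintype.card (Fin T × Fin (m k)) : ℝ)) atTop atTop := by
    simp only [← hcard]
    exact (tendsto_natCast_atTop_atTop.comp hm).const_mul_atTop hT0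
  -- The only place where the individual block norms enter: they add up to Nν.
  have hu' : ∀ k, (fun p : Fin T × Fin (m k) => u k p.1 p.2) ⬝ᵥ (fun p => u k p.1 p.2) =
      Fintype.card (Fin T × Fin (m k)) * ν := fun k => by
    have h1 : ∀ t, ∑ j, u k t j * u k t j = m k * νs t := fun t => by
      rw [← hu, EuclideanSpace.real_norm_sq_eq]
      simp only [sq]
    rw [dotProduct, Fintype.sum_prod_type, ← hcard, hν]
    simp only [h1]
    rw [← Finset.mul_sum]
    field_simp
  obtain ⟨h1, h2, h3, h4, h5⟩ := objective_wellPosed (σ := σ) hα hα1 hβ hlam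
    (hF.ae_nonneg hN hα hM) (hF.integrable_id hN hα hα1 hM hnorm) hνpos
  exact ⟨h1, h2, h3, h4, h5,
    tendsto_finiteH hN hα hα1 hβ hlam hνpos hM hu' hA hw hwlaw hwA hrot hnorm hF hedge,
    fun hα1 => finiteH_sub_isBigO hN hα hα1 hβ hlam hνpos hM hu' hA hw hwlaw hwA hrot⟩
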